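/- Let $n\ge 5$, let $\Omega\subset\mathbb{R}^n$ be a bounded domain (connected open set) with smooth boundary, and let $K$ be a positive $C^3$ function on $\overline{\Omega}$. Then there is a constant $\varepsilon_0>0$ (depending only on $n$, $\Omega$ and $K$) with the following property. Let $u\in H^2(\Omega)$ be a (real-valued) weak solution of $$\Delta^2 u=K|u|^{\frac{8}{n-4}}u\ \text{ in }\Omega,\qquad u=\Delta u=0\ \text{ on }\partial\Omega,$$ that is, $u\in H^2(\Omega)\cap H^1_0(\Omega)$ and $\int_\Omega \Delta u\,\Delta\varphi=\int_\Omega K|u|^{\frac{8}{n-4}}u\,\varphi$ for all $\varphi\in H^2(\Omega)\cap H^1_0(\Omega)$. If $u^-:=\max(0,-u)$ satisfies $\|u^-\|_{L^{2n/(n-4)}(\Omega)}<\varepsilon_0$, then $u\ge 0$ almost everywhere in $\Omega$; and, unless $u=0$ almost everywhere, $u$ is positive in $\Omega$, in the sense that for every compact set $C\subset\Omega$ there is $c>0$ with $u\ge c$ almost everywhere on $C$ (so every continuous representative of $u$ is strictly positive at every point of $\Omega$). -/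

import Mathlib

open MeasureTheory Filter Topology
open scoped ContDiff

namespace NavierBiharmonic

/-- `Ω` is a bounded smooth domain of `ℝⁿ`: nonempty, open, connected and bounded, and near every
boundary point `Ω` is the negative side `{ρ < 0}` of a smooth local defining function `ρ`
whose differential does not vanish at that point. -/
structure IsBoundedSmoothDomain {n : ℕ} (Ω : Set (EuclideanSpace ℝ (Fin n))) : Prop where
  isOpen : IsOpen Ω
  isConnected : IsConnected Ω
  isBounded : Bornology.IsBounded Ω
  smooth_boundary : ∀ x ∈ frontier Ω, ∃ U ∈ 𝓝 x, ∃ ρ : EuclideanSpace ℝ (Fin n) → ℝ,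
    ContDiff ℝ ∞ ρ ∧ fderiv ℝ ρ x ≠ 0 ∧ ∀ y ∈ U, y ∈ Ω ↔ ρ y < 0

/-- Test functions `φ ∈ C_c^∞(Ω)`, extended by zero to `ℝⁿ`. -/
def IsTestFunction {n : ℕ} (Ω : Set (EuclideanSpace ℝ (Fin n)))
    (φ : EuclideanSpace ℝ (Fin n) → ℝ) : Prop :=
  ContDiff ℝ ∞ φ ∧ HasCompactSupport φ ∧ tsupport φ ⊆ Ω

/-- The classical partial derivative `∂ᵢ φ`. -/
noncomputable def partialDeriv {n : ℕ} (i : Fin n) (φ : EuclideanSpace ℝ (Fin n) → ℝ)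
    (x : EuclideanSpace ℝ (Fin n)) : ℝ :=
  fderiv ℝ φ x (EuclideanSpace.single i 1)

/-- `g` is the weak partial derivative `∂ᵢ u` on `Ω`. Values of `u` and `g` outside `Ω` play no
role, here and below. -/
def HasWeakPartialDeriv {n : ℕ} (Ω : Set (EuclideanSpace ℝ (Fin n))) (i : Fin n)
    (u g : EuclideanSpace ℝ (Fin n) → ℝ) : Prop :=
  LocallyIntegrableOn u Ω ∧ LocallyIntegrableOn g Ω ∧
    ∀ φ, IsTestFunction Ω φ →
      ∫ x in Ω, u x * partialDeriv i φ x = -∫ x in Ω, g x * φ x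

/-- `f` is the weak (distributional) Laplacian `Δu` on `Ω`. -/
def HasWeakLaplacian {n : ℕ} (Ω : Set (EuclideanSpace ℝ (Fin n)))
    (u f : EuclideanSpace ℝ (Fin n) → ℝ) : Prop :=
  LocallyIntegrableOn u Ω ∧ LocallyIntegrableOn f Ω ∧
    ∀ φ, IsTestFunction Ω φ →
      ∫ x in Ω, u x * Laplacian.laplacian φ x = ∫ x in Ω, f x * φ x

/-- The Sobolev space `H²(Ω) = W^{2,2}(Ω)`: `u`, its weak first derivatives `g i` and its weak
second derivatives `h i j` are in `L²(Ω)`. -/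
def MemH2 {n : ℕ} (Ω : Set (EuclideanSpace ℝ (Fin n)))
    (u : EuclideanSpace ℝ (Fin n) → ℝ) : Prop :=
  MemLp u 2 (volume.restrict Ω) ∧
    ∃ (g : Fin n → EuclideanSpace ℝ (Fin n) → ℝ)
      (h : Fin n → Fin n → EuclideanSpace ℝ (Fin n) → ℝ),
      (∀ i, MemLp (g i) 2 (volume.restrict Ω) ∧ HasWeakPartialDeriv Ω i u (g i)) ∧
      ∀ i j, MemLp (h i j) 2 (volume.restrict Ω) ∧ HasWeakPartialDeriv Ω j (g i) (h i j)

/-- The Sobolev space `H¹₀(Ω)`: the closure of `C_c^∞(Ω)` in `H¹(Ω)`. -/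
def MemH10 {n : ℕ} (Ω : Set (EuclideanSpace ℝ (Fin n)))
    (u : EuclideanSpace ℝ (Fin n) → ℝ) : Prop :=
  MemLp u 2 (volume.restrict Ω) ∧
    ∃ g : Fin n → EuclideanSpace ℝ (Fin n) → ℝ,
      (∀ i, MemLp (g i) 2 (volume.restrict Ω) ∧ HasWeakPartialDeriv Ω i u (g i)) ∧
      ∃ φ : ℕ → EuclideanSpace ℝ (Fin n) → ℝ,
        (∀ k, IsTestFunction Ω (φ k)) ∧
        Tendsto (fun k => eLpNorm (fun x => φ k x - u x) 2 (volume.restrict Ω)) atTop (𝓝 0) ∧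
        ∀ i, Tendsto (fun k => eLpNorm (fun x => partialDeriv i (φ k) x - g i x) 2
          (volume.restrict Ω)) atTop (𝓝 0)

/-- `u ∈ H²(Ω)` is a solution of `Δ²u = K |u|^{8/(n-4)} u` in `Ω`, `u = Δu = 0` on `∂Ω`, in the
usual weak sense: `u ∈ H² ∩ H¹₀(Ω)` and
`∫_Ω Δu Δφ = ∫_Ω K |u|^{8/(n-4)} u φ` for every `φ ∈ H² ∩ H¹₀(Ω)`.
The condition `u = 0` on `∂Ω` is the membership in `H¹₀`; the condition `Δu = 0` on `∂Ω` is the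
natural boundary condition of this formulation. -/
def IsNavierSolution {n : ℕ} (Ω : Set (EuclideanSpace ℝ (Fin n)))
    (K u : EuclideanSpace ℝ (Fin n) → ℝ) : Prop :=
  MemH2 Ω u ∧ MemH10 Ω u ∧
    ∃ Lu : EuclideanSpace ℝ (Fin n) → ℝ,
      MemLp Lu 2 (volume.restrict Ω) ∧ HasWeakLaplacian Ω u Lu ∧
      ∀ φ Lφ : EuclideanSpace ℝ (Fin n) → ℝ, MemH2 Ω φ → MemH10 Ω φ →
        HasWeakLaplacian Ω φ Lφ →
        ∫ x in Ω, Lu x * Lφ x =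
          ∫ x in Ω, K x * |u x| ^ ((8 : ℝ) / ((n : ℝ) - 4)) * u x * φ x

end NavierBiharmonic

/-!
A solution `u` has `v = -Δu`, and the weak formulation says that `v` is, in a dual sense, the
solution of `-Δv = f` with `f = K |u|^{8/(n-4)} u`. With `G` the solution operator of the Dirichlet
problem for `-Δ` in `H¹₀(Ω)` (`IsDirichlet`, `exists_isDirichlet`), testing the equation with `G h`
gives `∫ v h = ∫ f G h` (`IsNavierSolution.integral_eq`) and, by the symmetry of `G`,
`∫ u h = ∫ f G (G h)`, for every `h ∈ L²(Ω)`.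

**Nonnegativity.** Put `q = 2n/(n-4)` and `p = q - 1`, and take `h = min(u⁻, m)^p`. As `G` preserves
positivity (`IsDirichlet.nonneg`), only the part of `f` with `u < 0` contributes to a negative
`∫ f G (G h)`, so `∫ u⁻ h ≤ max K ∫ (u⁻)^p G (G h)`. The operator `G ∘ G` maps `L^{q'}` to `L^q`
(`exists_dual_bound`): this is the boundedness of `G` from `L²` to `L^q`, obtained by testing with
truncated powers (`exists_moser_bound`), combined with duality. Letting `m → ∞` yields
`‖u⁻‖_q ≤ C ‖u⁻‖_q^p` (`exists_negPart_bound`), and `p > 1`, so `u⁻ = 0` once `‖u⁻‖_q` is small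
(`exists_forall_nonneg`).

**Admissibility of the test functions.** The weak formulation allows only test functions in
`H² ∩ H¹₀(Ω)`, so `G h ∈ H²(Ω)` is needed; this is where the smoothness of the boundary enters
(`IsDirichlet.memH2`). Instead of flattening the boundary, let `ρ` be a smooth function that is
positive in `Ω`, vanishes on the boundary and has `|∇ρ|² + ρ² ≥ c` (`IsDefining`). For `φ = G h`
the quotient `ψ = φ/ρ` is in `L²(Ω)` by Hardy's inequality (`IsH10.hardy`), and
`ρ Δψ + 2 ∇ρ·∇ψ + ψ Δρ = -h`. Integrating the divergence of the Rellich field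
`ρ ((∇ρ·∇ψ) ∇ψ - |∇ψ|² ∇ρ / 2)`, which needs no boundary condition because of the factor `ρ`,
bounds `∇ψ` in `L²` (`IsDefining.rellich_estimate`); a second divergence identity then bounds
`ρ D²ψ`, and so `D²φ` (`IsDefining.hessian_estimate`). The estimates are carried out for
mollifications of `φ`, with cutoffs near the boundary whose error is an energy in a thin layer; the
second derivatives come from these bounds by duality.

**Positivity.** If `u ≥ 0` then `f ≥ 0`, hence `v ≥ 0` and `u` is weakly superharmonic
(`IsNavierSolution.integral_laplacian_nonpos`). Smooth averages of `u` over balls increase as the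
radius shrinks (`monotoneOn_average`), so by Lebesgue's differentiation theorem `u` is bounded below
at almost every point by its means over balls (`ae_setIntegral_ball_le`), and connectedness gives
the alternative between `u = 0` and local positive lower bounds (`exists_le_of_superharmonic`).
-/

open MeasureTheory Filter Topology
open scoped ContDiff

namespace NavierBiharmonic

/-! ### Calculus of partial derivatives -/

section Calculus

variable {n : ℕ} {f g : EuclideanSpace ℝ (Fin n) → ℝ} {x : EuclideanSpace ℝ (Fin n)} {i j : Fin n}

lemma partialDeriv_add (hf : DifferentiableAt ℝ f x) (hg : DifferentiableAt ℝ g x) :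
    partialDeriv i (fun y => f y + g y) x = partialDeriv i f x + partialDeriv i g x := by
  simp only [partialDeriv]
  rw [fderiv_fun_add hf hg]; rfl

lemma partialDeriv_sub (hf : DifferentiableAt ℝ f x) (hg : DifferentiableAt ℝ g x) :
    partialDeriv i (fun y => f y - g y) x = partialDeriv i f x - partialDeriv i g x := by
  simp only [partialDeriv]
  rw [fderiv_fun_sub hf hg]; rfl

lemma partialDeriv_mul (hf : DifferentiableAt ℝ f x) (hg : DifferentiableAt ℝ g x) :
    partialDeriv i (fun y => f y * g y) x =
      partialDeriv i f x * g x + f x * partialDeriv i g x := by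
  simp only [partialDeriv]
  rw [fderiv_fun_mul hf hg]
  simp; ring

lemma partialDeriv_sum {ι : Type*} {s : Finset ι} {F : ι → EuclideanSpace ℝ (Fin n) → ℝ}
    (hF : ∀ k ∈ s, DifferentiableAt ℝ (F k) x) :
    partialDeriv i (fun y => ∑ k ∈ s, F k y) x = ∑ k ∈ s, partialDeriv i (F k) x := by
  simp only [partialDeriv]
  rw [fderiv_fun_sum hF]; simp

lemma partialDeriv_const (c : ℝ) : partialDeriv i (fun _ => c) x = 0 := by
  simp [partialDeriv]

lemma partialDeriv_comp {β : ℝ → ℝ} (hβ : DifferentiableAt ℝ β (f x))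
    (hf : DifferentiableAt ℝ f x) :
    partialDeriv i (fun y => β (f y)) x = deriv β (f x) * partialDeriv i f x := by
  have h := (hβ.hasDerivAt.comp_hasFDerivAt x hf.hasFDerivAt).fderiv
  simp only [partialDeriv]
  change fderiv ℝ (β ∘ f) x _ = _
  rw [h]; simp

lemma partialDeriv_comp_const_sub {a : EuclideanSpace ℝ (Fin n)} (hf : Differentiable ℝ f) :
    partialDeriv i (fun y => f (a - y)) x = -partialDeriv i f (a - x) := by
  have h : HasFDerivAt (fun y => f (a - y))
      ((fderiv ℝ f (a - x)).comp (-ContinuousLinearMap.id ℝ _)) x :=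
    (hf (a - x)).hasFDerivAt.comp x ((hasFDerivAt_id x).const_sub a)
  simp only [partialDeriv, h.fderiv]
  simp

lemma contDiff_partialDeriv {m k : WithTop ℕ∞} (hf : ContDiff ℝ k f) (h : m + 1 ≤ k) :
    ContDiff ℝ m (partialDeriv i f) :=
  (hf.fderiv_right h).clm_apply contDiff_const

lemma ContDiff.partialDeriv_infty (hf : ContDiff ℝ ∞ f) : ContDiff ℝ ∞ (partialDeriv i f) :=
  contDiff_partialDeriv hf (by simp)

lemma partialDeriv_partialDeriv (hf : ContDiff ℝ 2 f) :
    partialDeriv i (partialDeriv j f) x =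
      fderiv ℝ (fderiv ℝ f) x (EuclideanSpace.single i 1) (EuclideanSpace.single j 1) := by
  have h1 : DifferentiableAt ℝ (fderiv ℝ f) x :=
    (hf.fderiv_right (m := 1) (by norm_num)).differentiable (by norm_num) x
  change fderiv ℝ (fun y => fderiv ℝ f y (EuclideanSpace.single j 1)) x _ = _
  rw [fderiv_clm_apply h1 (differentiableAt_const _)]
  simp

lemma partialDeriv_comm (hf : ContDiff ℝ 2 f) :
    partialDeriv i (partialDeriv j f) x = partialDeriv j (partialDeriv i f) x := by
  rw [partialDeriv_partialDeriv hf, partialDeriv_partialDeriv hf]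
  exact (hf.contDiffAt.isSymmSndFDerivAt (by simp)).eq _ _

lemma laplacian_eq_sum (hf : ContDiff ℝ 2 f) :
    Laplacian.laplacian f x = ∑ i, partialDeriv i (partialDeriv i f) x := by
  rw [InnerProductSpace.laplacian_eq_iteratedFDeriv_orthonormalBasis f
    (EuclideanSpace.basisFun (Fin n) ℝ)]
  refine Finset.sum_congr rfl fun i _ => ?_
  rw [iteratedFDeriv_two_apply, partialDeriv_partialDeriv hf]
  simp

lemma tsupport_partialDeriv_subset : tsupport (partialDeriv i f) ⊆ tsupport f :=
  tsupport_fderiv_apply_subset ℝ _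

lemma HasCompactSupport.partialDeriv_compact (hf : HasCompactSupport f) :
    HasCompactSupport (partialDeriv i f) :=
  hf.mono' (subset_tsupport _ |>.trans tsupport_partialDeriv_subset)

lemma integral_partialDeriv_eq_zero (hf : ContDiff ℝ 1 f) (hc : HasCompactSupport f) :
    ∫ x, partialDeriv i f x = 0 := by
  have h1 : Continuous (partialDeriv i f) :=
    (contDiff_partialDeriv (m := 0) hf (by norm_num)).continuous
  have hi : Integrable (partialDeriv i f) :=
    h1.integrable_of_hasCompactSupport (HasCompactSupport.partialDeriv_compact hc)
  have := integral_mul_fderiv_eq_neg_fderiv_mul_of_integrable (𝕜 := ℝ)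
    (μ := (volume : Measure (EuclideanSpace ℝ (Fin n))))
    (f := fun _ => (1 : ℝ)) (g := f) (v := EuclideanSpace.single i 1) (by simp)
    (by simpa using! hi)
    (by simpa using hf.continuous.integrable_of_hasCompactSupport hc)
    (fun _ _ => differentiableAt_const _) (fun x _ => hf.differentiable (by norm_num) x)
  simpa [partialDeriv] using this

/-- Integration by parts against a compactly supported function. -/
lemma integral_mul_partialDeriv (hf : ContDiff ℝ 1 f) (hg : ContDiff ℝ 1 g)
    (hc : HasCompactSupport g) :
    ∫ x, f x * partialDeriv i g x = -∫ x, partialDeriv i f x * g x := by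
  have h := integral_partialDeriv_eq_zero (i := i) (hf.mul hg) hc.mul_left
  have h1 : ∀ x, partialDeriv i (fun y => f y * g y) x =
      partialDeriv i f x * g x + f x * partialDeriv i g x := fun x =>
    partialDeriv_mul (hf.differentiable (by norm_num) x) (hg.differentiable (by norm_num) x)
  have c1 : Continuous (partialDeriv i f) :=
    (contDiff_partialDeriv (m := 0) hf (by norm_num)).continuous
  have c2 : Continuous (partialDeriv i g) :=
    (contDiff_partialDeriv (m := 0) hg (by norm_num)).continuous
  have i1 : Integrable (fun x => partialDeriv i f x * g x) :=
    (c1.mul hg.continuous).integrable_of_hasCompactSupport hc.mul_left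
  have i2 : Integrable (fun x => f x * partialDeriv i g x) :=
    (hf.continuous.mul c2).integrable_of_hasCompactSupport
      (HasCompactSupport.partialDeriv_compact hc).mul_left
  change ∫ x, partialDeriv i (fun y => f y * g y) x = 0 at h
  simp_rw [h1] at h
  rw [integral_add i1 i2] at h
  linarith

lemma norm_fderiv_sq : ‖fderiv ℝ f x‖ ^ 2 = ∑ i, partialDeriv i f x ^ 2 := by
  have h : ‖gradient f x‖ = ‖fderiv ℝ f x‖ := by
    simp [gradient]
  rw [← h, EuclideanSpace.norm_sq_eq]
  refine Finset.sum_congr rfl fun i _ => ?_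
  have : gradient f x i = partialDeriv i f x := by
    have := InnerProductSpace.toDual_symm_apply (𝕜 := ℝ) (x := EuclideanSpace.single i (1 : ℝ))
      (y := fderiv ℝ f x)
    rw [EuclideanSpace.inner_single_right] at this
    simpa [gradient, partialDeriv] using this
  rw [this, Real.norm_eq_abs, sq_abs]

lemma norm_fderiv_le_sum : ‖fderiv ℝ f x‖ ≤ ∑ i, |partialDeriv i f x| := by
  have h : ‖fderiv ℝ f x‖ ^ 2 ≤ (∑ i, |partialDeriv i f x|) ^ 2 := by
    rw [norm_fderiv_sq]
    calc ∑ i, partialDeriv i f x ^ 2 = ∑ i, |partialDeriv i f x| ^ 2 := by simp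
      _ ≤ _ := Finset.sum_sq_le_sq_sum_of_nonneg (fun i _ => abs_nonneg _)
  exact le_of_sq_le_sq h (Finset.sum_nonneg fun i _ => abs_nonneg _)

end Calculus

section Test

variable {n : ℕ} {Ω : Set (EuclideanSpace ℝ (Fin n))} {φ ψ : EuclideanSpace ℝ (Fin n) → ℝ}
  {i : Fin n}

lemma IsTestFunction.pderiv (h : IsTestFunction Ω φ) :
    IsTestFunction Ω (partialDeriv i φ) :=
  ⟨ContDiff.partialDeriv_infty h.1, HasCompactSupport.partialDeriv_compact h.2.1,
    tsupport_partialDeriv_subset.trans h.2.2⟩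

lemma IsTestFunction.continuous (h : IsTestFunction Ω φ) : Continuous φ := h.1.continuous

lemma IsTestFunction.differentiable (h : IsTestFunction Ω φ) : Differentiable ℝ φ :=
  h.1.differentiable (by simp)

lemma IsTestFunction.memLp (h : IsTestFunction Ω φ) (p : ENNReal) (μ : Measure _)
    [IsFiniteMeasureOnCompacts μ] : MemLp φ p μ :=
  h.continuous.memLp_of_hasCompactSupport h.2.1

lemma IsTestFunction.eq_zero (h : IsTestFunction Ω φ) {x : EuclideanSpace ℝ (Fin n)}
    (hx : x ∉ Ω) : φ x = 0 :=
  image_eq_zero_of_notMem_tsupport fun h' => hx (h.2.2 h')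

lemma IsTestFunction.zero : IsTestFunction Ω (fun _ => 0) :=
  ⟨contDiff_const, HasCompactSupport.zero, by simp [tsupport, Function.support]⟩

lemma IsTestFunction.add (h : IsTestFunction Ω φ) (h' : IsTestFunction Ω ψ) :
    IsTestFunction Ω (fun x => φ x + ψ x) :=
  ⟨h.1.add h'.1, h.2.1.add h'.2.1, (tsupport_add φ ψ).trans (Set.union_subset h.2.2 h'.2.2)⟩

lemma IsTestFunction.const_mul (h : IsTestFunction Ω φ) (c : ℝ) :
    IsTestFunction Ω (fun x => c * φ x) :=
  ⟨contDiff_const.mul h.1, h.2.1.mul_left, (tsupport_mul_subset_right).trans h.2.2⟩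

end Test

/-! ### Square-integrable functions -/

section L2

variable {α : Type*} [MeasurableSpace α] {μ : Measure α} {f g : α → ℝ}

lemma integral_mul_eq_inner (hf : MemLp f 2 μ) (hg : MemLp g 2 μ) :
    ∫ x, f x * g x ∂μ = inner ℝ (hg.toLp g) (hf.toLp f) := by
  rw [L2.inner_def]
  refine integral_congr_ae ?_
  filter_upwards [hf.coeFn_toLp, hg.coeFn_toLp] with x h1 h2
  rw [h1, h2]; simp

lemma eLpNorm_two_add_le (hf : AEStronglyMeasurable f μ) (hg : AEStronglyMeasurable g μ) :
    eLpNorm (fun x => f x + g x) 2 μ ≤ eLpNorm f 2 μ + eLpNorm g 2 μ :=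
  eLpNorm_add_le hf hg (by norm_num)

lemma integral_sq_eq (hf : MemLp f 2 μ) :
    ∫ x, f x ^ 2 ∂μ = (eLpNorm f 2 μ).toReal ^ 2 := by
  have := integral_mul_eq_inner hf hf
  rw [real_inner_self_eq_norm_sq, Lp.norm_toLp] at this
  simpa [sq] using this

lemma abs_integral_mul_le (hf : MemLp f 2 μ) (hg : MemLp g 2 μ) :
    |∫ x, f x * g x ∂μ| ≤ (eLpNorm f 2 μ).toReal * (eLpNorm g 2 μ).toReal := by
  rw [integral_mul_eq_inner hf hg, mul_comm]
  refine (abs_real_inner_le_norm _ _).trans ?_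
  rw [Lp.norm_toLp, Lp.norm_toLp]

lemma toReal_eLpNorm_eq_sqrt (hf : MemLp f 2 μ) :
    (eLpNorm f 2 μ).toReal = √(∫ x, f x ^ 2 ∂μ) := by
  rw [integral_sq_eq hf, Real.sqrt_sq ENNReal.toReal_nonneg]

lemma tendsto_integral_mul {ι : Type*} {l : Filter ι} {a b : ι → α → ℝ}
    (ha : ∀ k, MemLp (a k) 2 μ) (hb : ∀ k, MemLp (b k) 2 μ) (hf : MemLp f 2 μ)
    (hg : MemLp g 2 μ) (hfa : Tendsto (fun k => eLpNorm (fun x => a k x - f x) 2 μ) l (𝓝 0))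
    (hgb : Tendsto (fun k => eLpNorm (fun x => b k x - g x) 2 μ) l (𝓝 0)) :
    Tendsto (fun k => ∫ x, a k x * b k x ∂μ) l (𝓝 (∫ x, f x * g x ∂μ)) := by
  have h1 : Tendsto (fun k => (ha k).toLp (a k)) l (𝓝 (hf.toLp f)) :=
    (Lp.tendsto_Lp_iff_tendsto_eLpNorm'' _ ha f hf).2 hfa
  have h2 : Tendsto (fun k => (hb k).toLp (b k)) l (𝓝 (hg.toLp g)) :=
    (Lp.tendsto_Lp_iff_tendsto_eLpNorm'' _ hb g hg).2 hgb
  simp_rw [fun k => integral_mul_eq_inner (ha k) (hb k)]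
  rw [integral_mul_eq_inner hf hg]
  exact h2.inner h1

lemma tendsto_integral_mul_const {ι : Type*} {l : Filter ι} {a : ι → α → ℝ}
    (ha : ∀ k, MemLp (a k) 2 μ) (hf : MemLp f 2 μ)
    (hg : MemLp g 2 μ) (hfa : Tendsto (fun k => eLpNorm (fun x => a k x - f x) 2 μ) l (𝓝 0)) :
    Tendsto (fun k => ∫ x, a k x * g x ∂μ) l (𝓝 (∫ x, f x * g x ∂μ)) :=
  tendsto_integral_mul ha (fun _ => hg) hf hg hfa (by simpa using tendsto_const_nhds)

/-- A linear functional dominated by the norm of a linear map into a Hilbert space is represented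
by a vector in the closure of the range of that map. -/
lemma exists_representer {T H : Type*} [AddCommGroup T] [Module ℝ T] [NormedAddCommGroup H]
    [InnerProductSpace ℝ H] [CompleteSpace H] (A : T →ₗ[ℝ] H) (l : T →ₗ[ℝ] ℝ) (C : ℝ)
    (hl : ∀ t, |l t| ≤ C * ‖A t‖) :
    ∃ m ∈ closure (Set.range A), ∀ t, l t = inner ℝ m (A t) := by
  have hker : LinearMap.ker A ≤ LinearMap.ker l := by
    intro t ht
    have := hl t
    rw [LinearMap.mem_ker.1 ht, norm_zero, mul_zero] at this
    exact abs_nonpos_iff.1 this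
  let l₀ : LinearMap.range A →ₗ[ℝ] ℝ :=
    ((LinearMap.ker A).liftQ l hker).comp A.quotKerEquivRange.symm.toLinearMap
  have hl₀ : ∀ t, l₀ ⟨A t, LinearMap.mem_range_self A t⟩ = l t := by
    intro t
    have : A.quotKerEquivRange.symm ⟨A t, LinearMap.mem_range_self A t⟩ =
        (LinearMap.ker A).mkQ t := by
      rw [LinearEquiv.symm_apply_eq]
      rfl
    simp only [l₀, LinearMap.comp_apply, LinearEquiv.coe_coe, this]
    simp
  have hb : ∀ y : LinearMap.range A, ‖l₀ y‖ ≤ C * ‖y‖ := by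
    rintro ⟨_, t, rfl⟩
    have := hl t
    rw [← hl₀] at this
    simpa using this
  obtain ⟨L, hL, -⟩ := exists_extension_norm_eq (LinearMap.range A) (l₀.mkContinuous C hb)
  let m₀ := (InnerProductSpace.toDual ℝ H).symm L
  let V := (LinearMap.range A).topologicalClosure
  have hV : IsClosed (V : Set H) := Submodule.isClosed_topologicalClosure _
  have : CompleteSpace V := hV.completeSpace_coe
  refine ⟨V.starProjection m₀, ?_, fun t => ?_⟩
  · have : V.starProjection m₀ ∈ V := Submodule.starProjection_apply_mem _ _
    rw [← SetLike.mem_coe, Submodule.topologicalClosure_coe] at this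
    rwa [LinearMap.coe_range] at this
  · have hA : A t ∈ V := Submodule.le_topologicalClosure _ (LinearMap.mem_range_self A t)
    have h1 : inner ℝ (m₀ - V.starProjection m₀) (A t) = 0 :=
      Submodule.starProjection_inner_eq_zero m₀ _ hA
    have h2 : inner ℝ m₀ (A t) = L (A t) := by
      simp [m₀]
    have h3 : L (A t) = l t := by
      have := hL ⟨A t, LinearMap.mem_range_self A t⟩
      rw [this, LinearMap.mkContinuous_apply, hl₀]
    rw [inner_sub_left] at h1
    linarith

end L2

/-! ### Mollification -/

section Mollify

variable {n : ℕ}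

/-- A sequence of smooth bumps at the origin, the `k`-th one supported in the closed ball of
radius `1 / (k + 1)`. -/
noncomputable def bump (n k : ℕ) : ContDiffBump (0 : EuclideanSpace ℝ (Fin n)) :=
  ⟨1 / (2 * (k + 1)), 1 / (k + 1), by positivity, by
    apply one_div_lt_one_div_of_lt <;> nlinarith [(Nat.cast_nonneg k : (0 : ℝ) ≤ k)]⟩

/-- The standard mollifier kernel at scale `1 / (k + 1)`. -/
noncomputable def kernel (n k : ℕ) (x : EuclideanSpace ℝ (Fin n)) : ℝ :=
  (bump n k).normed volume x

/-- The mollification of `f` at scale `1 / (k + 1)`. -/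
noncomputable def mollify (k : ℕ) (f : EuclideanSpace ℝ (Fin n) → ℝ) :
    EuclideanSpace ℝ (Fin n) → ℝ :=
  convolution (kernel n k) f (ContinuousLinearMap.lsmul ℝ ℝ) volume

lemma kernel_contDiff (k : ℕ) : ContDiff ℝ ∞ (kernel n k) := (bump n k).contDiff_normed

lemma kernel_compact (k : ℕ) : HasCompactSupport (kernel n k) :=
  (bump n k).hasCompactSupport_normed

lemma kernel_nonneg (k : ℕ) (x) : 0 ≤ kernel n k x := (bump n k).nonneg_normed x

lemma kernel_integral (k : ℕ) : ∫ x, kernel n k x = 1 := (bump n k).integral_normed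

lemma tsupport_kernel (k : ℕ) : tsupport (kernel n k) = Metric.closedBall 0 (1 / (k + 1)) :=
  (bump n k).tsupport_normed_eq

variable {f g : EuclideanSpace ℝ (Fin n) → ℝ} {x : EuclideanSpace ℝ (Fin n)} {k : ℕ} {i : Fin n}

lemma mollify_eq : mollify k f x = ∫ y, kernel n k (x - y) * f y := by
  rw [mollify, convolution_eq_swap]; simp

lemma mollify_contDiff (hf : LocallyIntegrable f) : ContDiff ℝ ∞ (mollify k f) :=
  (kernel_compact k).contDiff_convolution_left _ (kernel_contDiff k) hf

lemma partialDeriv_mollify (hf : LocallyIntegrable f) :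
    partialDeriv i (mollify k f) x = ∫ y, partialDeriv i (kernel n k) (x - y) * f y := by
  have h := (kernel_compact k).hasFDerivAt_convolution_left (ContinuousLinearMap.lsmul ℝ ℝ)
    ((kernel_contDiff (n := n) k).of_le (by simp)) hf x
  rw [partialDeriv, mollify, h.fderiv, convolution_eq_swap]
  rw [ContinuousLinearMap.integral_apply]
  · simp [ContinuousLinearMap.precompL, partialDeriv]
  · have := ((kernel_compact (n := n) k).fderiv ℝ).convolutionExists_left
      (L := (ContinuousLinearMap.lsmul ℝ ℝ).precompL (EuclideanSpace ℝ (Fin n)))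
      ((kernel_contDiff (n := n) k).continuous_fderiv (by simp)) hf x
    exact this.integrable_swap

lemma mollify_sub (hf : LocallyIntegrable f) (hg : LocallyIntegrable g) :
    mollify k (fun y => f y - g y) x = mollify k f x - mollify k g x := by
  have e : ∀ {h : EuclideanSpace ℝ (Fin n) → ℝ}, LocallyIntegrable h →
      Integrable (fun y => kernel n k (x - y) * h y) := by
    intro h hh
    have := (kernel_compact (n := n) k).convolutionExists_left
      (L := ContinuousLinearMap.lsmul ℝ ℝ) (kernel_contDiff (n := n) k).continuous hh x
    simpa using this.integrable_swap
  simp only [mollify_eq, mul_sub]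
  exact integral_sub (e hf) (e hg)

lemma mollify_eq_zero {s : Set (EuclideanSpace ℝ (Fin n))} (hs : ∀ y ∉ s, f y = 0)
    (hx : ∀ y ∈ s, 1 / ((k : ℝ) + 1) < dist x y) : mollify k f x = 0 := by
  rw [mollify_eq]
  refine integral_eq_zero_of_ae (Eventually.of_forall fun y => ?_)
  by_cases hy : y ∈ s
  · have : kernel n k (x - y) = 0 := by
      refine image_eq_zero_of_notMem_tsupport fun h => ?_
      rw [tsupport_kernel] at h
      have := hx y hy
      rw [dist_eq_norm] at this
      simp at h
      simp at this
      linarith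
    simp [this]
  · simp [hs y hy]

/-- Young's inequality for the mollifier: the Cauchy-Schwarz inequality, after writing the kernel as
the square of its square root, bounds `|mollify k f|²` by the mollification of `|f|²`. -/
lemma eLpNorm_mollify_le (hf : MemLp f 2) : eLpNorm (mollify k f) 2 ≤ eLpNorm f 2 := by
  have hp : (2 : ENNReal).toReal = 2 := by simp
  rw [eLpNorm_eq_lintegral_rpow_enorm_toReal (by norm_num) (by norm_num),
    eLpNorm_eq_lintegral_rpow_enorm_toReal (by norm_num) (by norm_num)]
  refine ENNReal.rpow_le_rpow ?_ (by positivity)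
  simp only [hp]
  have hkm : Measurable (kernel n k) := (kernel_contDiff k).continuous.measurable
  have hk1 : ∀ x, ∫⁻ y, ‖kernel n k (x - y)‖ₑ = 1 := by
    intro x
    rw [lintegral_sub_left_eq_self (fun y => ‖kernel n k y‖ₑ) x]
    rw [← ofReal_integral_norm_eq_lintegral_enorm
      ((kernel_contDiff k).continuous.integrable_of_hasCompactSupport (kernel_compact k))]
    simp [abs_of_nonneg (kernel_nonneg _ _), kernel_integral]
  have key : ∀ x, ‖mollify k f x‖ₑ ^ (2 : ℝ) ≤
      ∫⁻ y, ‖kernel n k (x - y)‖ₑ * ‖f y‖ₑ ^ (2 : ℝ) := by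
    intro x
    rw [mollify_eq]
    have hk' : Measurable fun y => ‖kernel n k (x - y)‖ₑ :=
      (hkm.comp (measurable_const.sub measurable_id)).enorm
    have hfm : AEMeasurable fun y => ‖f y‖ₑ := hf.1.enorm
    calc ‖∫ y, kernel n k (x - y) * f y‖ₑ ^ (2 : ℝ)
        ≤ (∫⁻ y, ‖kernel n k (x - y) * f y‖ₑ) ^ (2 : ℝ) := by
          gcongr; exact enorm_integral_le_lintegral_enorm _
      _ = (∫⁻ y, ((fun y => ‖kernel n k (x - y)‖ₑ ^ (1 / 2 : ℝ)) *
            fun y => ‖kernel n k (x - y)‖ₑ ^ (1 / 2 : ℝ) * ‖f y‖ₑ) y) ^ (2 : ℝ) := by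
          congr 2; ext y
          simp only [Pi.mul_apply, enorm_mul]
          rw [← mul_assoc, ← ENNReal.rpow_add_of_nonneg _ _ (by norm_num) (by norm_num)]
          norm_num
      _ ≤ ((∫⁻ y, (‖kernel n k (x - y)‖ₑ ^ (1 / 2 : ℝ)) ^ (2 : ℝ)) ^ (1 / 2 : ℝ) *
          (∫⁻ y, (‖kernel n k (x - y)‖ₑ ^ (1 / 2 : ℝ) * ‖f y‖ₑ) ^ (2 : ℝ)) ^ (1 / 2 : ℝ))
            ^ (2 : ℝ) := by
          gcongr
          exact ENNReal.lintegral_mul_le_Lp_mul_Lq _ (by constructor <;> norm_num)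
            (hk'.pow_const _).aemeasurable ((hk'.pow_const _).aemeasurable.mul hfm)
      _ = ∫⁻ y, ‖kernel n k (x - y)‖ₑ * ‖f y‖ₑ ^ (2 : ℝ) := by
          rw [ENNReal.mul_rpow_of_nonneg _ _ (by norm_num), ← ENNReal.rpow_mul,
            ← ENNReal.rpow_mul]
          simp_rw [ENNReal.mul_rpow_of_nonneg _ _ (show (0 : ℝ) ≤ 2 by norm_num),
            ← ENNReal.rpow_mul]
          norm_num [hk1]
  have hf2 : AEMeasurable (fun y => ‖f y‖ₑ ^ (2 : ℝ)) := hf.1.enorm.pow_const _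
  calc ∫⁻ x, ‖mollify k f x‖ₑ ^ (2 : ℝ)
      ≤ ∫⁻ x, ∫⁻ y, ‖kernel n k (x - y)‖ₑ * ‖f y‖ₑ ^ (2 : ℝ) := lintegral_mono key
    _ = ∫⁻ y, ∫⁻ x, ‖kernel n k (x - y)‖ₑ * ‖f y‖ₑ ^ (2 : ℝ) := by
        refine lintegral_lintegral_swap (AEMeasurable.mul ?_ ?_)
        · exact (hkm.comp measurable_sub).enorm.aemeasurable
        · exact hf2.comp_snd
    _ = ∫⁻ y, ‖f y‖ₑ ^ (2 : ℝ) := by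
        refine lintegral_congr fun y => ?_
        rw [lintegral_mul_const _ (by fun_prop),
          lintegral_sub_right_eq_self (fun x => ‖kernel n k x‖ₑ) y]
        have := hk1 0
        rw [lintegral_sub_left_eq_self (fun y => ‖kernel n k y‖ₑ) 0] at this
        rw [this, one_mul]

lemma mollify_memLp (hf : MemLp f 2) : MemLp (mollify k f) 2 :=
  ⟨(mollify_contDiff (hf.locallyIntegrable (by norm_num))).continuous.aestronglyMeasurable,
    (eLpNorm_mollify_le hf).trans_lt hf.2⟩

lemma tendsto_mollify_of_continuous (hf : Continuous f) (hc : HasCompactSupport f) :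
    Tendsto (fun k => eLpNorm (fun x => mollify k f x - f x) 2) atTop (𝓝 0) := by
  set S := Metric.cthickening 1 (tsupport f) with hS
  have hScomp : IsCompact S := hc.isCompact.cthickening
  have hli : LocallyIntegrable f := hf.locallyIntegrable
  rw [ENNReal.tendsto_nhds_zero]
  intro ε hε
  have hSfin : volume S ≠ ⊤ := hScomp.measure_ne_top
  obtain ⟨δ, hδ, hδε⟩ : ∃ δ : ℝ, 0 < δ ∧
      volume S ^ (1 / 2 : ℝ) * ENNReal.ofReal δ ≤ ε := by
    rcases eq_or_ne ε ⊤ with rfl | hε'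
    · exact ⟨1, one_pos, le_top⟩
    have hv : volume S ^ (1 / 2 : ℝ) ≠ ⊤ := ENNReal.rpow_ne_top_of_nonneg (by norm_num) hSfin
    refine ⟨(ε / (volume S ^ (1 / 2 : ℝ) + 1)).toReal, ?_, ?_⟩
    · exact ENNReal.toReal_pos (ENNReal.div_pos hε.ne' (by finiteness)).ne'
        (ENNReal.div_lt_top hε' (by simp)).ne
    · rw [ENNReal.ofReal_toReal (ENNReal.div_lt_top hε' (by simp)).ne]
      calc volume S ^ (1 / 2 : ℝ) * (ε / (volume S ^ (1 / 2 : ℝ) + 1))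
          ≤ (volume S ^ (1 / 2 : ℝ) + 1) * (ε / (volume S ^ (1 / 2 : ℝ) + 1)) := by
            gcongr; exact le_self_add
        _ = ε := ENNReal.mul_div_cancel (by simp) (by finiteness)
  obtain ⟨r, hr, hfr⟩ := Metric.uniformContinuous_iff.1
    (hf.uniformContinuous_of_tendsto_cocompact hc.is_zero_at_infty) δ hδ
  have : ∀ᶠ k : ℕ in atTop, 1 / ((k : ℝ) + 1) < min r 1 :=
    (tendsto_one_div_add_atTop_nhds_zero_nat (𝕜 := ℝ)).eventually_lt_const (by positivity)
  filter_upwards [this] with k hk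
  have hzero : ∀ x ∉ S, mollify k f x - f x = 0 := by
    intro x hx
    have h1 : f x = 0 := image_eq_zero_of_notMem_tsupport fun h =>
      hx (Metric.self_subset_cthickening _ h)
    have h2 : mollify k f x = 0 := by
      refine mollify_eq_zero (s := tsupport f)
        (fun y hy => image_eq_zero_of_notMem_tsupport hy) fun y hy => ?_
      by_contra! hlt
      refine hx (Metric.mem_cthickening_of_dist_le x y 1 _ hy (hlt.trans ?_))
      exact hk.le.trans (min_le_right _ _)
    simp [h1, h2]
  have hbd : ∀ x, ‖mollify k f x - f x‖ ≤ δ := by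
    intro x
    rw [← dist_eq_norm]
    refine (bump n k).dist_normed_convolution_le hf.aestronglyMeasurable fun y hy => ?_
    refine (hfr (lt_trans ?_ (hk.trans_le (min_le_left _ _)))).le
    exact Metric.mem_ball.1 hy
  have hrestr : eLpNorm (fun x => mollify k f x - f x) 2 =
      eLpNorm (fun x => mollify k f x - f x) 2 (volume.restrict S) := by
    rw [← eLpNorm_indicator_eq_eLpNorm_restrict hScomp.measurableSet]
    congr 1; ext x
    by_cases hx : x ∈ S
    · simp [hx]
    · simp [hx, hzero x hx]
  rw [hrestr]
  refine le_trans ?_ hδε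
  have := eLpNorm_le_of_ae_bound (p := 2) (μ := volume.restrict S)
    (Eventually.of_forall hbd)
  simpa using this

/-- Mollifications of a square-integrable function converge in `L²`. -/
lemma tendsto_mollify (hf : MemLp f 2) :
    Tendsto (fun k => eLpNorm (fun x => mollify k f x - f x) 2) atTop (𝓝 0) := by
  rw [ENNReal.tendsto_nhds_zero]
  intro ε hε
  have h3 : ε / 3 ≠ 0 := (ENNReal.div_pos hε.ne' (by norm_num)).ne'
  obtain ⟨g, hgc, hfg, hg, hgL⟩ := hf.exists_hasCompactSupport_eLpNorm_sub_le (by norm_num) h3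
  filter_upwards [(ENNReal.tendsto_nhds_zero.1 (tendsto_mollify_of_continuous hg hgc)) (ε / 3)
    (pos_iff_ne_zero.2 h3)] with k hk
  have lf := hf.locallyIntegrable (by norm_num)
  have lg := hgL.locallyIntegrable (by norm_num)
  have hfgL : MemLp (fun x => f x - g x) 2 := hf.sub hgL
  have m1 := mollify_memLp (k := k) hfgL
  have m2 : MemLp (fun x => mollify k g x - g x) 2 := (mollify_memLp (k := k) hgL).sub hgL
  have m3 : MemLp (fun x => g x - f x) 2 := hgL.sub hf
  have h1 : eLpNorm (mollify k fun y => f y - g y) 2 ≤ ε / 3 :=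
    (eLpNorm_mollify_le hfgL).trans hfg
  have h4 : eLpNorm (fun x => g x - f x) 2 ≤ ε / 3 := by
    have : eLpNorm (fun x => g x - f x) 2 = eLpNorm (fun x => f x - g x) 2 :=
      eLpNorm_sub_comm g f 2 volume
    exact this.le.trans hfg
  have e : ∀ x, mollify k f x - f x =
      (mollify k (fun y => f y - g y) x + (mollify k g x - g x)) + (g x - f x) := by
    intro x
    rw [mollify_sub lf lg]; ring
  rw [funext e]
  refine (eLpNorm_two_add_le (m1.add m2).1 m3.1).trans ?_
  rw [← ENNReal.add_thirds ε]
  refine add_le_add ((eLpNorm_two_add_le m1.1 m2.1).trans (add_le_add h1 hk)) h4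

end Mollify

/-! ### The space `H¹₀(Ω)` -/

section H10

variable {n : ℕ} {Ω : Set (EuclideanSpace ℝ (Fin n))}
  {φ ψ : EuclideanSpace ℝ (Fin n) → ℝ} {g g' : Fin n → EuclideanSpace ℝ (Fin n) → ℝ}

/-- The pair `(φ, g)` lies in the closure of the pairs `(θ, ∇θ)`, `θ ∈ C_c^∞(Ω)`, in `L²(Ω)`:
that is, `φ ∈ H¹₀(Ω)` and `g = ∇φ`. -/
def IsH10 (Ω : Set (EuclideanSpace ℝ (Fin n))) (φ : EuclideanSpace ℝ (Fin n) → ℝ)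
    (g : Fin n → EuclideanSpace ℝ (Fin n) → ℝ) : Prop :=
  MemLp φ 2 (volume.restrict Ω) ∧ (∀ i, MemLp (g i) 2 (volume.restrict Ω)) ∧
    ∀ ε : ENNReal, 0 < ε → ∃ θ, IsTestFunction Ω θ ∧
      eLpNorm (fun x => θ x - φ x) 2 (volume.restrict Ω) ≤ ε ∧
      ∀ i, eLpNorm (fun x => partialDeriv i θ x - g i x) 2 (volume.restrict Ω) ≤ ε

lemma IsH10.exists_seq (h : IsH10 Ω φ g) :
    ∃ θ : ℕ → EuclideanSpace ℝ (Fin n) → ℝ, (∀ k, IsTestFunction Ω (θ k)) ∧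
      Tendsto (fun k => eLpNorm (fun x => θ k x - φ x) 2 (volume.restrict Ω)) atTop (𝓝 0) ∧
      ∀ i, Tendsto (fun k => eLpNorm (fun x => partialDeriv i (θ k) x - g i x) 2
        (volume.restrict Ω)) atTop (𝓝 0) := by
  have hpos : ∀ k : ℕ, (0 : ENNReal) < ((k : ENNReal))⁻¹ := fun k => by simp
  choose θ h1 h2 h3 using fun k : ℕ => h.2.2 _ (hpos k)
  have ht : Tendsto (fun k : ℕ => ((k : ENNReal))⁻¹) atTop (𝓝 0) :=
    ENNReal.tendsto_inv_nat_nhds_zero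
  exact ⟨θ, h1, tendsto_of_tendsto_of_tendsto_of_le_of_le tendsto_const_nhds ht
    (fun _ => zero_le) h2, fun i => tendsto_of_tendsto_of_tendsto_of_le_of_le
    tendsto_const_nhds ht (fun _ => zero_le) fun k => h3 k i⟩

lemma IsH10.of_seq {θ : ℕ → EuclideanSpace ℝ (Fin n) → ℝ}
    (hφ : MemLp φ 2 (volume.restrict Ω)) (hg : ∀ i, MemLp (g i) 2 (volume.restrict Ω))
    (hθ : ∀ k, IsTestFunction Ω (θ k))
    (h1 : Tendsto (fun k => eLpNorm (fun x => θ k x - φ x) 2 (volume.restrict Ω)) atTop (𝓝 0))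
    (h2 : ∀ i, Tendsto (fun k => eLpNorm (fun x => partialDeriv i (θ k) x - g i x) 2
        (volume.restrict Ω)) atTop (𝓝 0)) : IsH10 Ω φ g := by
  refine ⟨hφ, hg, fun ε hε => ?_⟩
  have e1 := ENNReal.tendsto_nhds_zero.1 h1 ε hε
  have e2 := eventually_all.2 fun i => ENNReal.tendsto_nhds_zero.1 (h2 i) ε hε
  obtain ⟨k, hk1, hk2⟩ := (e1.and e2).exists
  exact ⟨θ k, hθ k, hk1, hk2⟩

lemma IsTestFunction.isH10 (h : IsTestFunction Ω φ) : IsH10 Ω φ fun i => partialDeriv i φ :=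
  ⟨h.memLp _ _, fun _ => h.pderiv.memLp _ _, fun ε _ => ⟨φ, h, by simp, by simp⟩⟩

/-- `H¹₀(Ω)` is closed. -/
lemma IsH10.of_approx (hφ : MemLp φ 2 (volume.restrict Ω))
    (hg : ∀ i, MemLp (g i) 2 (volume.restrict Ω))
    (h : ∀ ε : ENNReal, 0 < ε → ∃ φ' g', IsH10 Ω φ' g' ∧
      eLpNorm (fun x => φ' x - φ x) 2 (volume.restrict Ω) ≤ ε ∧
      ∀ i, eLpNorm (fun x => g' i x - g i x) 2 (volume.restrict Ω) ≤ ε) : IsH10 Ω φ g := by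
  refine ⟨hφ, hg, fun ε hε => ?_⟩
  have hε2 : 0 < ε / 2 := ENNReal.half_pos hε.ne'
  obtain ⟨φ', g', h', h1, h2⟩ := h _ hε2
  obtain ⟨θ, hθ, h3, h4⟩ := h'.2.2 _ hε2
  have key : ∀ {a b c : EuclideanSpace ℝ (Fin n) → ℝ}, MemLp a 2 (volume.restrict Ω) →
      MemLp b 2 (volume.restrict Ω) → MemLp c 2 (volume.restrict Ω) →
      eLpNorm (fun x => a x - b x) 2 (volume.restrict Ω) ≤ ε / 2 →
      eLpNorm (fun x => b x - c x) 2 (volume.restrict Ω) ≤ ε / 2 →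
      eLpNorm (fun x => a x - c x) 2 (volume.restrict Ω) ≤ ε := by
    intro a b c ha hb hc hab hbc
    have e : ∀ x, a x - c x = (a x - b x) + (b x - c x) := fun x => by ring
    rw [funext e, ← ENNReal.add_halves ε]
    exact (eLpNorm_two_add_le (ha.sub hb).1 (hb.sub hc).1).trans (add_le_add hab hbc)
  exact ⟨θ, hθ, key (hθ.memLp _ _) h'.1 hφ h3 h1,
    fun i => key (hθ.pderiv.memLp _ _) (h'.2.1 i) (hg i) (h4 i) (h2 i)⟩

lemma IsTestFunction.setIntegral (h : IsTestFunction Ω φ) (f : EuclideanSpace ℝ (Fin n) → ℝ) :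
    ∫ x in Ω, f x * φ x = ∫ x, f x * φ x :=
  setIntegral_eq_integral_of_forall_compl_eq_zero fun x hx => by simp [h.eq_zero hx]

/-- Integration by parts for `φ ∈ H¹₀(Ω)`; the smooth factor need not vanish on `∂Ω`. -/
lemma IsH10.integral_partialDeriv (h : IsH10 Ω φ g) {ζ : EuclideanSpace ℝ (Fin n) → ℝ}
    (hζ : ContDiff ℝ ∞ ζ) (hc : HasCompactSupport ζ) (i : Fin n) :
    ∫ x in Ω, φ x * partialDeriv i ζ x = -∫ x in Ω, g i x * ζ x := by
  obtain ⟨θ, hθ, h1, h2⟩ := h.exists_seq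
  have z1 : MemLp (partialDeriv i ζ) 2 (volume.restrict Ω) :=
    (ContDiff.partialDeriv_infty hζ).continuous.memLp_of_hasCompactSupport
      (HasCompactSupport.partialDeriv_compact hc)
  have z2 : MemLp ζ 2 (volume.restrict Ω) := hζ.continuous.memLp_of_hasCompactSupport hc
  have t1 := tendsto_integral_mul_const (fun k => (hθ k).memLp 2 _) h.1 z1 h1
  have t2 := (tendsto_integral_mul_const (fun k => (hθ k).pderiv.memLp 2 _)
    (h.2.1 i) z2 (h2 i)).neg
  refine tendsto_nhds_unique (t1.congr fun k => ?_) t2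
  have a1 := (hθ k).setIntegral (partialDeriv i ζ)
  have a2 := (hθ k).pderiv (i := i) |>.setIntegral ζ
  simp_rw [mul_comm (partialDeriv i ζ _)] at a1
  simp_rw [mul_comm (ζ _)] at a2
  rw [a1, a2]
  exact integral_mul_partialDeriv ((hθ k).1.of_le (by simp)) (hζ.of_le (by simp)) hc

lemma MemLp.locallyIntegrableOn_restrict {f : EuclideanSpace ℝ (Fin n) → ℝ}
    (hf : MemLp f 2 (volume.restrict Ω)) : LocallyIntegrableOn f Ω := by
  have := hf.locallyIntegrable (by norm_num)
  intro x hx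
  obtain ⟨U, hU, hi⟩ := this x
  refine ⟨U ∩ Ω, ?_, ?_⟩
  · exact inter_mem (mem_nhdsWithin_of_mem_nhds hU) self_mem_nhdsWithin
  · rw [IntegrableOn] at hi ⊢
    have hle : volume.restrict (U ∩ Ω) ≤ (volume.restrict Ω).restrict U :=
      Measure.le_iff.2 fun s hs => by
        rw [Measure.restrict_apply hs, Measure.restrict_apply hs]
        have := Measure.le_restrict_apply Ω (s ∩ U) (μ := volume)
        rwa [Set.inter_assoc] at this
    exact hi.mono_measure hle

lemma IsH10.hasWeakPartialDeriv (h : IsH10 Ω φ g) (i : Fin n) :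
    HasWeakPartialDeriv Ω i φ (g i) :=
  ⟨MemLp.locallyIntegrableOn_restrict h.1, MemLp.locallyIntegrableOn_restrict (h.2.1 i),
    fun _ hζ => h.integral_partialDeriv hζ.1 hζ.2.1 i⟩

lemma IsH10.memH10 (h : IsH10 Ω φ g) : MemH10 Ω φ :=
  ⟨h.1, g, fun i => ⟨h.2.1 i, h.hasWeakPartialDeriv i⟩, h.exists_seq⟩

lemma MemH10.exists_isH10 (h : MemH10 Ω φ) : ∃ g, IsH10 Ω φ g := by
  obtain ⟨h1, g, hg, θ, hθ, t1, t2⟩ := h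
  exact ⟨g, IsH10.of_seq h1 (fun i => (hg i).1) hθ t1 t2⟩

/-- Compactly supported `C¹` functions belong to `H¹₀(Ω)`. -/
lemma isH10_of_contDiff_one (hΩ : IsOpen Ω) (h1 : ContDiff ℝ 1 φ) (hc : HasCompactSupport φ)
    (hs : tsupport φ ⊆ Ω) : IsH10 Ω φ fun i => partialDeriv i φ := by
  have cd : ∀ i, Continuous (partialDeriv i φ) := fun i =>
    (contDiff_partialDeriv (m := 0) h1 (by norm_num)).continuous
  have hφ : MemLp φ 2 := h1.continuous.memLp_of_hasCompactSupport hc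
  have hd : ∀ i, MemLp (partialDeriv i φ) 2 := fun i =>
    (cd i).memLp_of_hasCompactSupport (HasCompactSupport.partialDeriv_compact hc)
  obtain ⟨δ, hδ, hδΩ⟩ := hc.isCompact.exists_cthickening_subset_open hΩ hs
  have hpd : ∀ k i, partialDeriv i (mollify k φ) = mollify k (partialDeriv i φ) := by
    intro k i
    ext x
    rw [partialDeriv_mollify (hφ.locallyIntegrable (by norm_num)), mollify_eq]
    have := integral_mul_partialDeriv (i := i) (f := fun y => kernel n k (x - y)) (g := φ)
      ((kernel_contDiff k).of_le (by simp) |>.comp (contDiff_const.sub contDiff_id)) h1 hc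
    have e : ∀ y, partialDeriv i (fun y => kernel n k (x - y)) y =
        -partialDeriv i (kernel n k) (x - y) := fun y =>
      partialDeriv_comp_const_sub ((kernel_contDiff k).differentiable (by simp))
    simp only [e, neg_mul, integral_neg, neg_neg] at this
    exact this.symm
  have hsupp : ∀ᶠ k : ℕ in atTop, IsTestFunction Ω (mollify k φ) := by
    filter_upwards [(tendsto_one_div_add_atTop_nhds_zero_nat (𝕜 := ℝ)).eventually_lt_const hδ]
      with k hk
    have hsub : tsupport (mollify k φ) ⊆ Metric.cthickening δ (tsupport φ) := by
      refine closure_minimal (fun x hx => ?_) Metric.isClosed_cthickening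
      by_contra hx'
      refine hx (mollify_eq_zero (s := tsupport φ)
        (fun y hy => image_eq_zero_of_notMem_tsupport hy) fun y hy => ?_)
      by_contra! hlt
      exact hx' (Metric.mem_cthickening_of_dist_le x y δ _ hy (hlt.trans hk.le))
    exact ⟨mollify_contDiff (hφ.locallyIntegrable (by norm_num)),
      hc.isCompact.cthickening.of_isClosed_subset (isClosed_tsupport _) hsub,
      hsub.trans hδΩ⟩
  refine ⟨hφ.restrict _, fun i => (hd i).restrict _, fun ε hε => ?_⟩
  have e1 := ENNReal.tendsto_nhds_zero.1 (tendsto_mollify hφ) ε hε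
  have e2 := eventually_all.2 fun i => ENNReal.tendsto_nhds_zero.1 (tendsto_mollify (hd i)) ε hε
  obtain ⟨k, hk0, hk1, hk2⟩ := (hsupp.and (e1.and e2)).exists
  refine ⟨_, hk0, (eLpNorm_mono_measure _ Measure.restrict_le_self).trans hk1, fun i => ?_⟩
  rw [hpd k i]
  exact (eLpNorm_mono_measure _ Measure.restrict_le_self).trans (hk2 i)

lemma tendsto_eLpNorm_mul_of_bounded {α : Type*} [MeasurableSpace α] {μ : Measure α}
    {a : ℕ → α → ℝ} {f : α → ℝ} (hf : MemLp f 2 μ) (M : ℝ)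
    (ham : ∀ k, AEStronglyMeasurable (a k) μ) (hM : ∀ k x, |a k x| ≤ M)
    (ha : ∀ᵐ x ∂μ, Tendsto (fun k => a k x) atTop (𝓝 0)) :
    Tendsto (fun k => eLpNorm (fun x => a k x * f x) 2 μ) atTop (𝓝 0) := by
  have hm : ∀ k, AEStronglyMeasurable (fun x => a k x * f x) μ := fun k => (ham k).mul hf.1
  have hb : MemLp (fun x => M * f x) 2 μ := hf.const_mul M
  have hL : ∀ k, MemLp (fun x => a k x * f x) 2 μ := fun k =>
    hb.of_le (hm k) (Eventually.of_forall fun x => by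
      rw [norm_mul, norm_mul]
      gcongr
      exact (hM k x).trans (le_abs_self M))
  have hint : Tendsto (fun k => ∫ x, (a k x * f x) ^ 2 ∂μ) atTop (𝓝 (∫ _, (0 : ℝ) ∂μ)) := by
    refine tendsto_integral_of_dominated_convergence (fun x => (M * f x) ^ 2)
      (fun k => (hL k).integrable_sq.1) hb.integrable_sq
      (fun k => Eventually.of_forall fun x => ?_) ?_
    · rw [Real.norm_eq_abs, abs_of_nonneg (sq_nonneg _), mul_pow, mul_pow]
      refine mul_le_mul_of_nonneg_right ?_ (sq_nonneg _)
      exact sq_le_sq' (abs_le.1 (hM k x)).1 (abs_le.1 (hM k x)).2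
    · filter_upwards [ha] with x hx
      have := (hx.mul_const (f x)).pow 2
      simpa using this
  rw [integral_zero] at hint
  have h2 : ∀ k, eLpNorm (fun x => a k x * f x) 2 μ =
      ENNReal.ofReal (√(∫ x, (a k x * f x) ^ 2 ∂μ)) := fun k => by
    rw [← toReal_eLpNorm_eq_sqrt (hL k), ENNReal.ofReal_toReal (hL k).2.ne]
  simp_rw [h2]
  have := (ENNReal.continuous_ofReal.comp Real.continuous_sqrt).tendsto 0 |>.comp hint
  simpa [Function.comp_def] using this

/-- Elements of `H¹₀(Ω)` are limits of test functions in `H¹` and almost everywhere. -/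
lemma IsH10.exists_seq_ae (h : IsH10 Ω φ g) :
    ∃ θ : ℕ → EuclideanSpace ℝ (Fin n) → ℝ, (∀ k, IsTestFunction Ω (θ k)) ∧
      Tendsto (fun k => eLpNorm (fun x => θ k x - φ x) 2 (volume.restrict Ω)) atTop (𝓝 0) ∧
      (∀ i, Tendsto (fun k => eLpNorm (fun x => partialDeriv i (θ k) x - g i x) 2
        (volume.restrict Ω)) atTop (𝓝 0)) ∧
      ∀ᵐ x ∂(volume.restrict Ω), Tendsto (fun k => θ k x) atTop (𝓝 (φ x)) := by
  obtain ⟨θ, hθ, h1, h2⟩ := h.exists_seq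
  obtain ⟨s, hs, hae⟩ := (tendstoInMeasure_of_tendsto_eLpNorm (p := 2) (by norm_num)
    (fun k => ((hθ k).memLp 2 (volume.restrict Ω)).1) h.1.1 h1).exists_seq_tendsto_ae
  exact ⟨fun k => θ (s k), fun k => hθ _, h1.comp hs.tendsto_atTop,
    fun i => (h2 i).comp hs.tendsto_atTop, hae⟩

/-- Chain rule in `H¹₀(Ω)`. -/
lemma IsH10.comp (hΩ : IsOpen Ω) (h : IsH10 Ω φ g) {β : ℝ → ℝ} (hβ : ContDiff ℝ 1 β)
    (h0 : β 0 = 0) {M : ℝ} (hM : ∀ t, |deriv β t| ≤ M) :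
    IsH10 Ω (fun x => β (φ x)) fun i x => deriv β (φ x) * g i x := by
  have hM0 : 0 ≤ M := (abs_nonneg _).trans (hM 0)
  have hLip : ∀ s t, |β s - β t| ≤ M * |s - t| := fun s t => by
    have := Convex.norm_image_sub_le_of_norm_deriv_le (f := β) (s := Set.univ) (x := t) (y := s)
      (fun x _ => hβ.differentiable (by norm_num) x) (fun x _ => hM x) convex_univ trivial trivial
    simpa using this
  have hdc : Continuous (deriv β) := hβ.continuous_deriv (by norm_num)
  have m1 : MemLp (fun x => β (φ x)) 2 (volume.restrict Ω) :=
    (h.1.const_mul M).of_le (hβ.continuous.comp_aestronglyMeasurable h.1.1)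
      (Eventually.of_forall fun x => by
        have := hLip (φ x) 0
        rw [h0, sub_zero, sub_zero] at this
        simpa [abs_of_nonneg hM0] using this)
  have m2 : ∀ {ψ f : EuclideanSpace ℝ (Fin n) → ℝ}, MemLp ψ 2 (volume.restrict Ω) →
      MemLp f 2 (volume.restrict Ω) →
      MemLp (fun x => deriv β (ψ x) * f x) 2 (volume.restrict Ω) := fun {ψ f} hψ hf =>
    (hf.const_mul M).of_le ((hdc.comp_aestronglyMeasurable hψ.1).mul hf.1)
      (Eventually.of_forall fun x => by
        rw [norm_mul, norm_mul]
        gcongr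
        exact (hM _).trans (le_abs_self M))
  obtain ⟨θ, hθ, h1, h2, h3⟩ := h.exists_seq_ae
  refine IsH10.of_approx m1 (fun i => m2 h.1 (h.2.1 i)) fun ε hε => ?_
  have hcomp : ∀ k, IsH10 Ω (fun x => β (θ k x)) fun i => partialDeriv i fun x => β (θ k x) := by
    intro k
    have hz : ∀ x, θ k x = 0 → β (θ k x) = 0 := fun x hx => by rw [hx, h0]
    have hsub : tsupport (fun x => β (θ k x)) ⊆ tsupport (θ k) :=
      closure_mono fun x hx h' => hx (hz x h')
    exact isH10_of_contDiff_one hΩ (hβ.comp ((hθ k).1.of_le (by simp)))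
      ((hθ k).2.1.comp_left h0) (hsub.trans (hθ k).2.2)
  have e1 : Tendsto (fun k => eLpNorm (fun x => β (θ k x) - β (φ x)) 2 (volume.restrict Ω))
      atTop (𝓝 0) := by
    have := ENNReal.Tendsto.const_mul (a := ENNReal.ofReal M) h1 (Or.inr ENNReal.ofReal_ne_top)
    rw [mul_zero] at this
    refine tendsto_of_tendsto_of_tendsto_of_le_of_le tendsto_const_nhds this
      (fun _ => zero_le) fun k => ?_
    exact eLpNorm_le_mul_eLpNorm_of_ae_le_mul (Eventually.of_forall fun x => hLip _ _) _
  have e2 : ∀ i, Tendsto (fun k => eLpNorm (fun x => partialDeriv i (fun x => β (θ k x)) x -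
      deriv β (φ x) * g i x) 2 (volume.restrict Ω)) atTop (𝓝 0) := by
    intro i
    have a1 := ENNReal.Tendsto.const_mul (a := ENNReal.ofReal M) (h2 i)
      (Or.inr ENNReal.ofReal_ne_top)
    have a2 := tendsto_eLpNorm_mul_of_bounded (a := fun k x => deriv β (θ k x) - deriv β (φ x))
      (h.2.1 i) (M + M) (fun k => (hdc.comp_aestronglyMeasurable ((hθ k).memLp 2 _).1).sub
        (hdc.comp_aestronglyMeasurable h.1.1))
      (fun k x => (abs_sub _ _).trans (add_le_add (hM _) (hM _))) (by
        filter_upwards [h3] with x hx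
        have := ((hdc.tendsto _).comp hx).sub_const (deriv β (φ x))
        simpa using this)
    have a3 := a1.add a2
    rw [mul_zero, zero_add] at a3
    refine tendsto_of_tendsto_of_tendsto_of_le_of_le tendsto_const_nhds a3
      (fun _ => zero_le) fun k => ?_
    have e : ∀ x, partialDeriv i (fun x => β (θ k x)) x - deriv β (φ x) * g i x =
        deriv β (θ k x) * (partialDeriv i (θ k) x - g i x) +
          (deriv β (θ k x) - deriv β (φ x)) * g i x := by
      intro x
      rw [partialDeriv_comp (hβ.differentiable (by norm_num) _) ((hθ k).differentiable x)]
      ring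
    rw [funext e]
    have mk := (hθ k).memLp 2 (volume.restrict Ω)
    have md := ((hθ k).pderiv (i := i)).memLp 2 (volume.restrict Ω)
    refine (eLpNorm_two_add_le (m2 mk (md.sub (h.2.1 i))).1 ?_).trans (add_le_add_left ?_ _)
    · exact ((hdc.comp_aestronglyMeasurable mk.1).sub
        (hdc.comp_aestronglyMeasurable h.1.1)).mul (h.2.1 i).1
    · refine eLpNorm_le_mul_eLpNorm_of_ae_le_mul (Eventually.of_forall fun x => ?_) _
      rw [norm_mul]
      exact mul_le_mul_of_nonneg_right (hM _) (norm_nonneg _)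
  obtain ⟨k, hk1, hk2⟩ := ((ENNReal.tendsto_nhds_zero.1 e1 ε hε).and
    (eventually_all.2 fun i => ENNReal.tendsto_nhds_zero.1 (e2 i) ε hε)).exists
  exact ⟨_, _, hcomp k, hk1, hk2⟩

/-- A bound of a Lebesgue norm by the gradient extends from test functions to `H¹₀(Ω)`. -/
lemma IsH10.eLpNorm_le_of_test {p C : ENNReal} (hC : C ≠ ⊤)
    (hb : ∀ θ, IsTestFunction Ω θ → eLpNorm θ p (volume.restrict Ω) ≤
      C * ∑ i, eLpNorm (partialDeriv i θ) 2 (volume.restrict Ω)) (h : IsH10 Ω φ g) :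
    eLpNorm φ p (volume.restrict Ω) ≤ C * ∑ i, eLpNorm (g i) 2 (volume.restrict Ω) := by
  obtain ⟨θ, hθ, h1, h2, h3⟩ := h.exists_seq_ae
  refine (Lp.eLpNorm_lim_le_liminf_eLpNorm (fun k => ((hθ k).memLp 2 _).1) φ h3).trans ?_
  have t : Tendsto (fun k => C * ∑ i, (eLpNorm (fun x => partialDeriv i (θ k) x - g i x) 2
      (volume.restrict Ω) + eLpNorm (g i) 2 (volume.restrict Ω))) atTop
      (𝓝 (C * ∑ i, eLpNorm (g i) 2 (volume.restrict Ω))) := by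
    refine ENNReal.Tendsto.const_mul (tendsto_finsetSum _ fun i _ => ?_) (Or.inr hC)
    simpa using (h2 i).add_const (eLpNorm (g i) 2 (volume.restrict Ω))
  rw [← t.liminf_eq]
  refine liminf_le_liminf (Eventually.of_forall fun k => (hb _ (hθ k)).trans ?_)
  gcongr with i
  have e : ∀ x, partialDeriv i (θ k) x = (partialDeriv i (θ k) x - g i x) + g i x :=
    fun x => by ring
  conv_lhs => rw [funext e]
  exact eLpNorm_two_add_le ((((hθ k).pderiv).memLp 2 _).sub (h.2.1 i)).1 (h.2.1 i).1

lemma IsTestFunction.eLpNorm_fderiv_le (h : IsTestFunction Ω φ) :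
    eLpNorm (fderiv ℝ φ) 2 volume ≤
      ∑ i, eLpNorm (partialDeriv i φ) 2 (volume.restrict Ω) := by
  have h1 : ∀ i, eLpNorm (partialDeriv i φ) 2 (volume.restrict Ω) =
      eLpNorm (partialDeriv i φ) 2 volume := fun i =>
    eLpNorm_restrict_eq_of_support_subset fun x hx => by
      by_contra hx'
      exact hx (h.pderiv.eq_zero hx')
  simp_rw [h1]
  calc eLpNorm (fderiv ℝ φ) 2 volume
      ≤ eLpNorm (∑ i, fun x => |partialDeriv i φ x|) 2 volume := by
        refine eLpNorm_mono fun x => ?_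
        rw [Finset.sum_apply]
        exact norm_fderiv_le_sum.trans (le_abs_self _)
    _ ≤ ∑ i, eLpNorm (fun x => |partialDeriv i φ x|) 2 volume :=
        eLpNorm_sum_le (fun i _ => (h.pderiv.continuous.abs).aestronglyMeasurable)
          (by norm_num)
    _ = _ := Finset.sum_congr rfl fun i _ => eLpNorm_norm (partialDeriv i φ)

/-- Sobolev's inequality in `H¹₀(Ω)`. -/
lemma exists_sobolev (hn : 5 ≤ n) (Ω : Set (EuclideanSpace ℝ (Fin n))) :
    ∃ C : ENNReal, C ≠ ⊤ ∧ ∀ φ g, IsH10 Ω φ g →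
      eLpNorm φ (ENNReal.ofReal (2 * n / (n - 2))) (volume.restrict Ω) ≤
        C * ∑ i, eLpNorm (g i) 2 (volume.restrict Ω) := by
  have hn' : (5 : ℝ) ≤ n := by exact_mod_cast hn
  refine ⟨SNormLESNormFDerivOfEqConst ℝ (volume : Measure (EuclideanSpace ℝ (Fin n))) 2,
    ENNReal.coe_ne_top, fun φ g h => h.eLpNorm_le_of_test ENNReal.coe_ne_top fun θ hθ => ?_⟩
  have hs := eLpNorm_le_eLpNorm_fderiv_of_eq (F := ℝ)
    (μ := (volume : Measure (EuclideanSpace ℝ (Fin n)))) (u := θ) (p := 2)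
    (p' := Real.toNNReal (2 * n / (n - 2))) (hθ.1.of_le (by simp)) hθ.2.1 (by norm_num)
    (by simp; omega) (by
      have : (0 : ℝ) < n - 2 := by linarith
      rw [Real.coe_toNNReal _ (by positivity)]
      simp
      field_simp)
  refine (eLpNorm_mono_measure _ Measure.restrict_le_self).trans (hs.trans ?_)
  exact mul_le_mul' le_rfl hθ.eLpNorm_fderiv_le

/-- Poincaré's inequality in `H¹₀(Ω)`. -/
lemma exists_poincare (hn : 5 ≤ n) (hb : Bornology.IsBounded Ω) :
    ∃ C : ENNReal, C ≠ ⊤ ∧ ∀ φ g, IsH10 Ω φ g →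
      eLpNorm φ 2 (volume.restrict Ω) ≤ C * ∑ i, eLpNorm (g i) 2 (volume.restrict Ω) := by
  refine ⟨eLpNormLESNormFDerivOfLeConst ℝ
    (volume : Measure (EuclideanSpace ℝ (Fin n))) Ω 2 2,
    ENNReal.coe_ne_top, fun φ g h => h.eLpNorm_le_of_test ENNReal.coe_ne_top fun θ hθ => ?_⟩
  have hs := eLpNorm_le_eLpNorm_fderiv (F := ℝ)
    (μ := (volume : Measure (EuclideanSpace ℝ (Fin n)))) (u := θ) (s := Ω) (p := 2)
    (hθ.1.of_le (by simp)) ((subset_tsupport _).trans hθ.2.2) (by norm_num)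
    (by
      simp only [finrank_euclideanSpace, Fintype.card_fin]
      exact_mod_cast (by omega : 2 < n)) hb
  refine (eLpNorm_mono_measure _ Measure.restrict_le_self).trans (hs.trans ?_)
  exact mul_le_mul' le_rfl hθ.eLpNorm_fderiv_le

end H10

/-! ### The Dirichlet problem with square-integrable data -/

section Dirichlet

variable {n : ℕ} {Ω : Set (EuclideanSpace ℝ (Fin n))}
  {h φ h' φ' ψ : EuclideanSpace ℝ (Fin n) → ℝ} {g g' : Fin n → EuclideanSpace ℝ (Fin n) → ℝ}

/-- `φ ∈ H¹₀(Ω)`, with gradient `g`, is the weak solution of `-Δφ = h` in `Ω`, `φ = 0` on `∂Ω`,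
where `h ∈ L²(Ω)`. -/
def IsDirichlet (Ω : Set (EuclideanSpace ℝ (Fin n))) (h φ : EuclideanSpace ℝ (Fin n) → ℝ)
    (g : Fin n → EuclideanSpace ℝ (Fin n) → ℝ) : Prop :=
  IsH10 Ω φ g ∧ MemLp h 2 (volume.restrict Ω) ∧
    ∀ θ, IsTestFunction Ω θ → ∑ i, ∫ x in Ω, g i x * partialDeriv i θ x = ∫ x in Ω, h x * θ x

/-- All elements of `H¹₀(Ω)` are admissible in the weak formulation. -/
lemma IsDirichlet.integral_eq (H : IsDirichlet Ω h φ g) (hψ : IsH10 Ω ψ g') :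
    ∑ i, ∫ x in Ω, g i x * g' i x = ∫ x in Ω, h x * ψ x := by
  obtain ⟨θ, hθ, h1, h2⟩ := hψ.exists_seq
  have t1 : Tendsto (fun k => ∑ i, ∫ x in Ω, partialDeriv i (θ k) x * g i x) atTop
      (𝓝 (∑ i, ∫ x in Ω, g' i x * g i x)) := tendsto_finsetSum _ fun i _ =>
    tendsto_integral_mul_const (fun k => (hθ k).pderiv.memLp 2 _) (hψ.2.1 i) (H.1.2.1 i) (h2 i)
  have t2 := tendsto_integral_mul_const (fun k => (hθ k).memLp 2 _) hψ.1 H.2.1 h1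
  simp_rw [mul_comm (g _ _), mul_comm (h _)]
  refine tendsto_nhds_unique t1 (t2.congr fun k => ?_)
  have := H.2.2 (θ k) (hθ k)
  simp_rw [mul_comm (g _ _), mul_comm (h _)] at this
  exact this.symm

/-- The solution operator of the Dirichlet problem is symmetric. -/
lemma IsDirichlet.symm (H : IsDirichlet Ω h φ g) (H' : IsDirichlet Ω h' φ' g') :
    ∫ x in Ω, h x * φ' x = ∫ x in Ω, h' x * φ x := by
  rw [← H.integral_eq H'.1, ← H'.integral_eq H.1]
  simp_rw [mul_comm]

lemma two_le_infty : (2 : WithTop ℕ∞) ≤ ∞ := WithTop.coe_le_coe.2 le_top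

lemma IsH10.sum_integral_partialDeriv (hφ : IsH10 Ω φ g) {θ : EuclideanSpace ℝ (Fin n) → ℝ}
    (hθ : IsTestFunction Ω θ) :
    ∑ i, ∫ x in Ω, g i x * partialDeriv i θ x =
      -∫ x in Ω, φ x * Laplacian.laplacian θ x := by
  simp_rw [laplacian_eq_sum (hθ.1.of_le two_le_infty), Finset.mul_sum]
  rw [integral_finsetSum (f := fun i x => φ x * partialDeriv i (partialDeriv i θ) x) _
    fun i _ => hφ.1.integrable_mul (hθ.pderiv.pderiv.memLp 2 _),
    ← Finset.sum_neg_distrib]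
  refine Finset.sum_congr rfl fun i _ => ?_
  rw [hφ.integral_partialDeriv hθ.pderiv.1 hθ.pderiv.2.1, neg_neg]

lemma IsH10.isDirichlet (hφ : IsH10 Ω φ g) (hh : MemLp h 2 (volume.restrict Ω))
    (hw : HasWeakLaplacian Ω φ h) : IsDirichlet Ω (fun x => -h x) φ g := by
  refine ⟨hφ, hh.neg, fun θ hθ => ?_⟩
  rw [hφ.sum_integral_partialDeriv hθ, hw.2.2 θ hθ, ← integral_neg]
  simp

lemma IsDirichlet.hasWeakLaplacian (H : IsDirichlet Ω h φ g) :
    HasWeakLaplacian Ω φ fun x => -h x := by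
  refine ⟨MemLp.locallyIntegrableOn_restrict H.1.1, MemLp.locallyIntegrableOn_restrict H.2.1.neg,
    fun θ hθ => ?_⟩
  have := H.1.sum_integral_partialDeriv hθ
  rw [H.2.2 θ hθ] at this
  simp only [neg_mul, integral_neg]
  linarith

/-- The vector space `C_c^∞(Ω)`. -/
def testSubmodule (Ω : Set (EuclideanSpace ℝ (Fin n))) :
    Submodule ℝ (EuclideanSpace ℝ (Fin n) → ℝ) where
  carrier := {θ | IsTestFunction Ω θ}
  add_mem' h h' := IsTestFunction.add h h'
  zero_mem' := IsTestFunction.zero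
  smul_mem' c _ h := IsTestFunction.const_mul h c

/-- The map `θ ↦ θ` from test functions to `L²(Ω)`. -/
noncomputable def testToL2 (Ω : Set (EuclideanSpace ℝ (Fin n))) :
    testSubmodule Ω →ₗ[ℝ] Lp ℝ 2 (volume.restrict Ω) where
  toFun θ := (IsTestFunction.memLp θ.2 2 _).toLp θ
  map_add' _ _ := rfl
  map_smul' _ _ := rfl

/-- The map `θ ↦ ∂ᵢθ` from test functions to `L²(Ω)`. -/
noncomputable def testPartial (Ω : Set (EuclideanSpace ℝ (Fin n))) (i : Fin n) :
    testSubmodule Ω →ₗ[ℝ] Lp ℝ 2 (volume.restrict Ω) where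
  toFun θ := (IsTestFunction.memLp (IsTestFunction.pderiv (i := i) θ.2) 2 _).toLp _
  map_add' θ θ' := by
    rw [← MemLp.toLp_add]
    congr 1
    ext x
    exact partialDeriv_add (IsTestFunction.differentiable θ.2 x)
      (IsTestFunction.differentiable θ'.2 x)
  map_smul' c θ := by
    rw [RingHom.id_apply, ← MemLp.toLp_const_smul]
    congr 1
    ext x
    have := partialDeriv_mul (i := i) (differentiableAt_const c (x := x))
      (IsTestFunction.differentiable θ.2 x)
    rw [partialDeriv_const, zero_mul, zero_add] at this
    exact this

/-- The gradient from test functions to `L²(Ω)ⁿ`. -/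
noncomputable def testGradient (Ω : Set (EuclideanSpace ℝ (Fin n))) :
    testSubmodule Ω →ₗ[ℝ] PiLp 2 (fun _ : Fin n => Lp ℝ 2 (volume.restrict Ω)) where
  toFun θ := WithLp.toLp 2 fun i => testPartial Ω i θ
  map_add' _ _ := by ext1; simp
  map_smul' _ _ := by ext1; simp

lemma norm_testToL2 (θ : testSubmodule Ω) :
    ‖testToL2 Ω θ‖ = (eLpNorm (θ : EuclideanSpace ℝ (Fin n) → ℝ) 2 (volume.restrict Ω)).toReal :=
  Lp.norm_toLp _ (IsTestFunction.memLp θ.2 2 _)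

lemma norm_testPartial (i : Fin n) (θ : testSubmodule Ω) :
    ‖testPartial Ω i θ‖ = (eLpNorm (partialDeriv i θ) 2 (volume.restrict Ω)).toReal :=
  Lp.norm_toLp _ (IsTestFunction.memLp (IsTestFunction.pderiv (i := i) θ.2) 2 _)

lemma norm_testPartial_le (i : Fin n) (θ : testSubmodule Ω) :
    ‖testPartial Ω i θ‖ ≤ ‖testGradient Ω θ‖ :=
  PiLp.norm_apply_le (testGradient Ω θ) i

lemma exists_norm_testToL2_le (hn : 5 ≤ n) (hb : Bornology.IsBounded Ω) :
    ∃ C : ℝ, 0 ≤ C ∧ ∀ θ : testSubmodule Ω, ‖testToL2 Ω θ‖ ≤ C * ‖testGradient Ω θ‖ := by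
  obtain ⟨C, hC, hP⟩ := exists_poincare hn hb
  refine ⟨C.toReal * n, by positivity, fun θ => ?_⟩
  have h1 := hP _ _ (IsTestFunction.isH10 θ.2)
  have hfin : ∀ i : Fin n, eLpNorm (partialDeriv i θ) 2 (volume.restrict Ω) ≠ ⊤ := fun i =>
    ((IsTestFunction.pderiv θ.2).memLp 2 _).2.ne
  have h2 := ENNReal.toReal_mono
    (ENNReal.mul_ne_top hC (ENNReal.sum_ne_top.2 fun i _ => hfin i)) h1
  rw [ENNReal.toReal_mul, ENNReal.toReal_sum fun i _ => hfin i, ← norm_testToL2] at h2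
  simp_rw [← norm_testPartial] at h2
  refine h2.trans ?_
  rw [mul_assoc]
  refine mul_le_mul_of_nonneg_left ?_ ENNReal.toReal_nonneg
  refine (Finset.sum_le_sum fun i _ => norm_testPartial_le i θ).trans ?_
  simp

/-- Existence of weak solutions of the Dirichlet problem. -/
lemma exists_isDirichlet (hn : 5 ≤ n) (hb : Bornology.IsBounded Ω)
    (hh : MemLp h 2 (volume.restrict Ω)) : ∃ φ g, IsDirichlet Ω h φ g := by
  obtain ⟨C, hC, hP'⟩ := exists_norm_testToL2_le hn hb
  let l : testSubmodule Ω →ₗ[ℝ] ℝ :=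
    (innerₛₗ ℝ (hh.toLp h)).comp (testToL2 Ω)
  have hl : ∀ θ : testSubmodule Ω, l θ = ∫ x in Ω, h x * (θ : _ → ℝ) x := by
    intro θ
    simp_rw [mul_comm (h _)]
    rw [integral_mul_eq_inner (IsTestFunction.memLp θ.2 2 _) hh]
    rfl
  obtain ⟨m, hm, hml⟩ := exists_representer (testGradient Ω) l (‖hh.toLp h‖ * C) (by
    intro θ
    calc |l θ| ≤ ‖hh.toLp h‖ * ‖testToL2 Ω θ‖ := abs_real_inner_le_norm (hh.toLp h) (testToL2 Ω θ)
      _ ≤ ‖hh.toLp h‖ * (C * ‖testGradient Ω θ‖) := by gcongr; exact hP' θ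
      _ = _ := by ring)
  obtain ⟨y, hy, hym⟩ := mem_closure_iff_seq_limit.1 hm
  choose θ hθ using hy
  obtain rfl : y = fun k => testGradient Ω (θ k) := funext fun k => (hθ k).symm
  have hcau : CauchySeq fun k => testToL2 Ω (θ k) := by
    have hc := hym.cauchySeq
    rw [Metric.cauchySeq_iff'] at hc ⊢
    intro ε hε
    obtain ⟨N, hN⟩ := hc (ε / (C + 1)) (by positivity)
    refine ⟨N, fun k hk => ?_⟩
    have h1 := hN k hk
    rw [dist_eq_norm, ← map_sub] at h1 ⊢
    calc _ ≤ C * ‖testGradient Ω (θ k - θ N)‖ := hP' _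
      _ ≤ (C + 1) * ‖testGradient Ω (θ k - θ N)‖ := by gcongr; linarith
      _ < (C + 1) * (ε / (C + 1)) := by gcongr
      _ = ε := by field_simp
  obtain ⟨p, hp⟩ := cauchySeq_tendsto_of_complete hcau
  have hgi : ∀ i, Tendsto (fun k => testPartial Ω i (θ k)) atTop (𝓝 (m i)) := fun i =>
    ((PiLp.continuous_apply 2 _ i).tendsto m).comp hym
  have conv : ∀ {f : ℕ → EuclideanSpace ℝ (Fin n) → ℝ} (hf : ∀ k, MemLp (f k) 2
      (volume.restrict Ω)) {q : Lp ℝ 2 (volume.restrict Ω)},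
      Tendsto (fun k => (hf k).toLp (f k)) atTop (𝓝 q) →
      Tendsto (fun k => eLpNorm (fun x => f k x - q x) 2 (volume.restrict Ω)) atTop (𝓝 0) := by
    intro f hf q hq
    refine (Lp.tendsto_Lp_iff_tendsto_eLpNorm'' f hf q (Lp.memLp q)).1 ?_
    rwa [Lp.toLp_coeFn]
  have hH : IsH10 Ω p fun i => m i :=
    IsH10.of_seq (θ := fun k => θ k) (Lp.memLp p) (fun i => Lp.memLp (m i)) (fun k => (θ k).2)
      (conv (fun k => IsTestFunction.memLp (θ k).2 2 _) hp)
      (fun i => conv (fun k => IsTestFunction.memLp (IsTestFunction.pderiv (θ k).2) 2 _) (hgi i))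
  refine ⟨p, fun i => m i, hH, hh, fun ζ hζ => ?_⟩
  have := hml ⟨ζ, hζ⟩
  rw [hl] at this
  rw [this, PiLp.inner_apply]
  refine Finset.sum_congr rfl fun i _ => ?_
  rw [L2.inner_def]
  refine integral_congr_ae ?_
  have h1 : (testGradient Ω ⟨ζ, hζ⟩) i = (hζ.pderiv.memLp 2 _).toLp (partialDeriv i ζ) := rfl
  rw [h1]
  filter_upwards [(hζ.pderiv (i := i) |>.memLp 2 (volume.restrict Ω)).coeFn_toLp] with x hx
  rw [hx]
  simp [mul_comm]

lemma contDiff_primitive {d : ℝ → ℝ} (hd : Continuous d) :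
    ContDiff ℝ 1 (fun t => ∫ s in (0 : ℝ)..t, d s) ∧
      ∀ t, deriv (fun t => ∫ s in (0 : ℝ)..t, d s) t = d t := by
  have h : ∀ t, HasDerivAt (fun t => ∫ s in (0 : ℝ)..t, d s) (d t) t := fun t =>
    hd.integral_hasStrictDerivAt 0 t |>.hasDerivAt
  refine ⟨contDiff_one_iff_deriv.2 ⟨fun t => (h t).differentiableAt, ?_⟩, fun t => (h t).deriv⟩
  rwa [funext fun t => (h t).deriv]

/-- Weak maximum principle. -/
lemma IsDirichlet.nonneg (hn : 5 ≤ n) (hΩ : IsOpen Ω) (hb : Bornology.IsBounded Ω)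
    (H : IsDirichlet Ω h φ g) (hh : ∀ᵐ x ∂(volume.restrict Ω), 0 ≤ h x) :
    ∀ᵐ x ∂(volume.restrict Ω), 0 ≤ φ x := by
  -- The test function is `β ∘ φ`, where `β` vanishes on `[0, ∞)` and is negative on `(-∞, 0)`.
  set d : ℝ → ℝ := fun t => min (max (-t) 0) 1 with hd
  have hdc : Continuous d := by fun_prop
  have hd0 : ∀ t, 0 ≤ d t := fun t => le_min (le_max_right _ _) zero_le_one
  have hd1 : ∀ t, |d t| ≤ 1 := fun t => by
    rw [abs_of_nonneg (hd0 t)]; exact min_le_right _ _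
  obtain ⟨hβ, hβ'⟩ := contDiff_primitive hdc
  set β : ℝ → ℝ := fun t => ∫ s in (0 : ℝ)..t, d s with hβdef
  have hβ0 : β 0 = 0 := by simp [hβdef]
  have hneg : ∀ t < 0, β t < 0 := by
    intro t ht
    have : 0 < ∫ s in t..0, d s := by
      refine intervalIntegral.intervalIntegral_pos_of_pos_on (hdc.intervalIntegrable _ _) ?_ ht
      intro s hs
      exact lt_min (lt_max_of_lt_left (by linarith [hs.2])) one_pos
    rw [hβdef]
    simp only
    rw [intervalIntegral.integral_symm]
    linarith
  have hnonpos : ∀ t, β t ≤ 0 := by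
    intro t
    rcases lt_or_ge t 0 with ht | ht
    · exact (hneg t ht).le
    · have : β t = ∫ s in (0 : ℝ)..t, (0 : ℝ) := by
        refine intervalIntegral.integral_congr fun s hs => ?_
        rw [Set.uIcc_of_le ht] at hs
        simp only [hd]
        rw [max_eq_right (by linarith [hs.1]), min_eq_left zero_le_one]
      rw [this]; simp
  have hc := H.1.comp hΩ hβ hβ0 (M := 1) (by simpa only [hβ'] using hd1)
  simp only [hβ'] at hc
  have e1 := H.integral_eq hc
  have e2 : ∫ x in Ω, h x * β (φ x) ≤ 0 := by
    refine integral_nonpos_of_ae ?_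
    filter_upwards [hh] with x hx
    exact mul_nonpos_of_nonneg_of_nonpos hx (hnonpos _)
  have nn : ∀ i x, 0 ≤ g i x * (d (φ x) * g i x) := fun i x => by
    have := mul_nonneg (hd0 (φ x)) (mul_self_nonneg (g i x))
    nlinarith
  have e3 : ∀ i, ∫ x in Ω, g i x * (d (φ x) * g i x) = 0 := by
    intro i
    have h1 : ∀ j ∈ Finset.univ, 0 ≤ ∫ x in Ω, g j x * (d (φ x) * g j x) := fun j _ =>
      integral_nonneg fun x => nn j x
    have h2 := Finset.single_le_sum h1 (Finset.mem_univ i)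
    linarith [h1 i (Finset.mem_univ i)]
  have e4 : ∀ i, eLpNorm (fun x => d (φ x) * g i x) 2 (volume.restrict Ω) = 0 := by
    intro i
    rw [eLpNorm_eq_zero_iff (hc.2.1 i).1 (by norm_num)]
    have := (integral_eq_zero_iff_of_nonneg_ae (Eventually.of_forall (nn i))
      ((H.1.2.1 i).integrable_mul (hc.2.1 i))).1 (e3 i)
    filter_upwards [this] with x hx
    simp only [Pi.zero_apply, mul_eq_zero] at hx ⊢
    tauto
  obtain ⟨C, hC, hP⟩ := exists_poincare hn hb
  have e5 := hP _ _ hc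
  simp only [e4, Finset.sum_const_zero, mul_zero, nonpos_iff_eq_zero] at e5
  rw [eLpNorm_eq_zero_iff hc.1.1 (by norm_num)] at e5
  filter_upwards [e5] with x hx
  by_contra! hlt
  exact (hneg _ hlt).ne hx

end Dirichlet

/-! ### The smoothing estimate `L² → L^{2n/(n-4)}` -/

section Moser

variable {n : ℕ} {Ω : Set (EuclideanSpace ℝ (Fin n))}
  {h φ : EuclideanSpace ℝ (Fin n) → ℝ} {g : Fin n → EuclideanSpace ℝ (Fin n) → ℝ}

/-- For the truncated power `d t = min |t| k ^ b`, the primitives of `d` and `d²` that vanish at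
`0` are related by `|∫ d²| ≤ (b + 1) ^ (b / (b + 1)) * |∫ d| ^ (1 + b / (b + 1))`. -/
lemma truncated_power_bounds {b k : ℝ} (hb : 0 < b) (hk : 0 ≤ k) (t : ℝ) :
    min |t| k ^ (b + 1) ≤ (b + 1) * |∫ s in (0 : ℝ)..t, min |s| k ^ b| ∧
    |∫ s in (0 : ℝ)..t, (min |s| k ^ b) ^ 2| ≤ (b + 1) ^ (b / (b + 1)) *
      |∫ s in (0 : ℝ)..t, min |s| k ^ b| ^ (1 + b / (b + 1)) := by
  wlog ht : 0 ≤ t generalizing t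
  · have h1 : ∀ f : ℝ → ℝ, (∀ s, f (-s) = f s) →
        |∫ s in (0 : ℝ)..(-t), f s| = |∫ s in (0 : ℝ)..t, f s| := by
      intro f hf
      have := intervalIntegral.integral_comp_neg (a := 0) (b := t) f
      simp only [hf, neg_zero] at this
      rw [this, intervalIntegral.integral_symm, abs_neg]
    have := this (-t) (by linarith)
    rwa [h1 _ (by simp), h1 _ (by simp), abs_neg] at this
  have hdc : Continuous fun s : ℝ => min |s| k ^ b :=
    Continuous.rpow_const (by fun_prop) fun _ => Or.inr hb.le
  have hd0 : ∀ s : ℝ, 0 ≤ min |s| k ^ b := fun s =>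
    Real.rpow_nonneg (le_min (abs_nonneg _) hk) _
  set γ := ∫ s in (0 : ℝ)..t, min |s| k ^ b with hγ
  have hγ0 : 0 ≤ γ := intervalIntegral.integral_nonneg ht fun s _ => hd0 s
  set m := min |t| k with hm
  have hm0 : 0 ≤ m := le_min (abs_nonneg _) hk
  have hmt : m ≤ t := (min_le_left _ _).trans (abs_of_nonneg ht).le
  have hlow : m ^ (b + 1) ≤ (b + 1) * γ := by
    have e1 : ∫ s in (0 : ℝ)..m, s ^ b = m ^ (b + 1) / (b + 1) := by
      rw [integral_rpow (Or.inl (by linarith)), Real.zero_rpow (by linarith), sub_zero]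
    have e2 : ∫ s in (0 : ℝ)..m, s ^ b ≤ ∫ s in (0 : ℝ)..m, min |s| k ^ b := by
      refine intervalIntegral.integral_mono_on hm0
        (intervalIntegral.intervalIntegrable_rpow (Or.inl hb.le))
        (hdc.intervalIntegrable _ _) fun s hs => ?_
      refine Real.rpow_le_rpow hs.1 (le_min (le_abs_self s) (hs.2.trans (min_le_right _ _))) hb.le
    have e3 : ∫ s in (0 : ℝ)..m, min |s| k ^ b ≤ γ := by
      rw [hγ, ← intervalIntegral.integral_add_adjacent_intervals
        (hdc.intervalIntegrable 0 m) (hdc.intervalIntegrable m t)]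
      linarith [intervalIntegral.integral_nonneg (μ := volume) hmt fun s _ => hd0 s]
    rw [e1] at e2
    rw [div_le_iff₀ (by linarith)] at e2
    nlinarith
  rw [abs_of_nonneg hγ0]
  refine ⟨hlow, ?_⟩
  have hβ0 : 0 ≤ ∫ s in (0 : ℝ)..t, (min |s| k ^ b) ^ 2 :=
    intervalIntegral.integral_nonneg ht fun s _ => sq_nonneg _
  rw [abs_of_nonneg hβ0]
  have e4 : ∫ s in (0 : ℝ)..t, (min |s| k ^ b) ^ 2 ≤ m ^ b * γ := by
    rw [hγ, ← intervalIntegral.integral_const_mul]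
    refine intervalIntegral.integral_mono_on ht ((hdc.pow 2).intervalIntegrable _ _)
      ((hdc.const_mul _).intervalIntegrable _ _) fun s hs => ?_
    rw [sq]
    refine mul_le_mul_of_nonneg_right ?_ (hd0 s)
    refine Real.rpow_le_rpow (le_min (abs_nonneg _) hk) ?_ hb.le
    refine min_le_min ?_ le_rfl
    rw [abs_of_nonneg hs.1, abs_of_nonneg ht]
    exact hs.2
  have e5 : m ^ b ≤ ((b + 1) * γ) ^ (b / (b + 1)) := by
    have := Real.rpow_le_rpow (by positivity) hlow (show 0 ≤ b / (b + 1) by positivity)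
    rwa [← Real.rpow_mul hm0, mul_div_cancel₀ _ (by linarith : b + 1 ≠ 0)] at this
  calc _ ≤ m ^ b * γ := e4
    _ ≤ ((b + 1) * γ) ^ (b / (b + 1)) * γ := mul_le_mul_of_nonneg_right e5 hγ0
    _ = (b + 1) ^ (b / (b + 1)) * γ ^ (1 + b / (b + 1)) := by
        rw [Real.mul_rpow (by linarith) hγ0, Real.rpow_add' hγ0 (by positivity), Real.rpow_one]
        ring

lemma toReal_eLpNorm_abs_rpow {f : EuclideanSpace ℝ (Fin n) → ℝ} {μ : Measure _} {p r : ℝ}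
    (hp : 0 ≤ p) (hr : 0 < r) :
    (eLpNorm (fun x => |f x| ^ r) (ENNReal.ofReal p) μ).toReal =
      (eLpNorm f (ENNReal.ofReal (p * r)) μ).toReal ^ r := by
  have := eLpNorm_norm_rpow (p := ENNReal.ofReal p) (μ := μ) f hr
  rw [ENNReal.ofReal_mul hp]
  simp only [Real.norm_eq_abs] at this
  rw [this, ENNReal.toReal_rpow]

/-- Moser's estimate: the solution operator of the Dirichlet problem maps `L²(Ω)` to
`L^{2n/(n-4)}(Ω)`. The equation is tested with `β ∘ φ`, where `β` and `γ` are the primitives of `d²`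
and `d` for a truncated power `d`; then `∫ |∇(γ ∘ φ)|² = ∫ h (β ∘ φ)`, and Sobolev's inequality
applies to `γ ∘ φ`. -/
lemma exists_moser_bound (hn : 5 ≤ n) (hΩ : IsOpen Ω) :
    ∃ C : ℝ, 0 ≤ C ∧ ∀ h φ g, IsDirichlet Ω h φ g →
      eLpNorm φ (ENNReal.ofReal (2 * n / (n - 4))) (volume.restrict Ω) ≤
        ENNReal.ofReal (C * (eLpNorm h 2 (volume.restrict Ω)).toReal) := by
  have hn' : (5 : ℝ) ≤ n := by exact_mod_cast hn
  obtain ⟨C₀, hC₀, hS⟩ := exists_sobolev hn Ω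
  -- With this exponent, `β ∘ φ` is controlled in `L²` exactly by the Sobolev norm of `γ ∘ φ`.
  set b : ℝ := 2 / (n - 4) with hb
  have hn4 : (0 : ℝ) < n - 4 := by linarith
  have hn2 : (0 : ℝ) < n - 2 := by linarith
  have hb0 : 0 < b := by positivity
  have hb1 : b + 1 = (n - 2) / (n - 4) := by rw [hb]; field_simp; ring
  set r : ℝ := 1 + b / (b + 1) with hr
  have hr0 : 0 < r := by positivity
  set q₁ : ℝ := 2 * n / (n - 2) with hq₁
  have hq₁0 : 0 < q₁ := by positivity
  have hrq : (2 : ℝ) * r = q₁ := by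
    rw [hr, hb1, hb, hq₁]; field_simp; ring
  have hbq : q₁ * (b + 1) = 2 * n / (n - 4) := by
    rw [hb1, hq₁]; field_simp
  set c₁ : ℝ := (b + 1) ^ (b / (b + 1)) with hc₁
  set C₁ : ℝ := C₀.toReal ^ 2 * n * c₁ with hC₁
  have hc₁0 : 0 ≤ c₁ := by positivity
  have hC₁0 : 0 ≤ C₁ := by positivity
  refine ⟨((b + 1) * C₁ ^ (b + 1)) ^ (1 / (b + 1)), by positivity, fun h φ g H => ?_⟩
  set μ := (volume : Measure (EuclideanSpace ℝ (Fin n))).restrict Ω with hμ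
  set A := (eLpNorm h 2 μ).toReal with hA
  have hA0 : 0 ≤ A := ENNReal.toReal_nonneg
  -- Uniform bound for the truncations of `φ`.
  have key : ∀ k : ℕ, eLpNorm (fun x => min |φ x| k) (ENNReal.ofReal (2 * n / (n - 4))) μ ≤
      ENNReal.ofReal (((b + 1) * C₁ ^ (b + 1)) ^ (1 / (b + 1)) * A) := by
    intro k
    have hk0 : (0 : ℝ) ≤ k := Nat.cast_nonneg k
    set d : ℝ → ℝ := fun s => min |s| k ^ b with hd
    have hdc : Continuous d := Continuous.rpow_const (by fun_prop) fun _ => Or.inr hb0.le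
    have hd0 : ∀ s : ℝ, 0 ≤ d s := fun s => Real.rpow_nonneg (le_min (abs_nonneg _) hk0) _
    have hdk : ∀ s, |d s| ≤ (k : ℝ) ^ b := fun s => by
      rw [abs_of_nonneg (hd0 s)]
      exact Real.rpow_le_rpow (le_min (abs_nonneg _) hk0) (min_le_right _ _) hb0.le
    have hd2k : ∀ s, |d s ^ 2| ≤ ((k : ℝ) ^ b) ^ 2 := fun s => by
      rw [abs_pow]; exact pow_le_pow_left₀ (abs_nonneg _) (hdk s) 2
    obtain ⟨hγ, hγ'⟩ := contDiff_primitive hdc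
    obtain ⟨hβ, hβ'⟩ := contDiff_primitive (d := fun s => d s ^ 2) (hdc.pow 2)
    have hb12 := fun t => truncated_power_bounds hb0 hk0 t
    set γ : ℝ → ℝ := fun t => ∫ s in (0 : ℝ)..t, d s with hγdef
    set β : ℝ → ℝ := fun t => ∫ s in (0 : ℝ)..t, d s ^ 2 with hβdef
    replace hb12 : ∀ t, min |t| (k : ℝ) ^ (b + 1) ≤ (b + 1) * |γ t| ∧
      |β t| ≤ c₁ * |γ t| ^ r := hb12
    have Hγ := H.1.comp hΩ hγ (by simp [hγdef]) (fun t => by rw [hγ']; exact hdk t)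
    have Hβ := H.1.comp hΩ hβ (by simp [hβdef]) (fun t => by rw [hβ']; exact hd2k t)
    simp only [hγ'] at Hγ
    simp only [hβ'] at Hβ
    have s1 := hS _ _ Hγ
    have hfin : ∀ i, eLpNorm (fun x => d (φ x) * g i x) 2 μ ≠ ⊤ := fun i => (Hγ.2.1 i).2.ne
    have hfin' : C₀ * ∑ i, eLpNorm (fun x => d (φ x) * g i x) 2 μ ≠ ⊤ :=
      ENNReal.mul_ne_top hC₀ (ENNReal.sum_ne_top.2 fun i _ => hfin i)
    have hγfin : eLpNorm (fun x => γ (φ x)) (ENNReal.ofReal q₁) μ ≠ ⊤ :=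
      (s1.trans_lt hfin'.lt_top).ne
    set N := (eLpNorm (fun x => γ (φ x)) (ENNReal.ofReal q₁) μ).toReal with hN
    have hN0 : 0 ≤ N := ENNReal.toReal_nonneg
    have s2 : N ≤ C₀.toReal * ∑ i, (eLpNorm (fun x => d (φ x) * g i x) 2 μ).toReal := by
      have := ENNReal.toReal_mono hfin' s1
      rwa [ENNReal.toReal_mul, ENNReal.toReal_sum fun i _ => hfin i] at this
    have s3 : ∑ i, (eLpNorm (fun x => d (φ x) * g i x) 2 μ).toReal ^ 2 =
        ∫ x in Ω, h x * β (φ x) := by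
      rw [← H.integral_eq Hβ]
      refine Finset.sum_congr rfl fun i _ => ?_
      rw [← integral_sq_eq (Hγ.2.1 i)]
      refine integral_congr_ae (Eventually.of_forall fun x => ?_)
      simp only; ring
    have s4 : ∫ x in Ω, h x * β (φ x) ≤ A * (c₁ * N ^ r) := by
      refine (le_abs_self _).trans ((abs_integral_mul_le H.2.1 Hβ.1).trans ?_)
      refine mul_le_mul_of_nonneg_left ?_ hA0
      have e1 := toReal_eLpNorm_abs_rpow (f := fun x => γ (φ x)) (μ := μ) (p := 2) (r := r)
        (by norm_num) hr0
      rw [hrq] at e1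
      rw [hN, ← e1]
      have e2 : eLpNorm (fun x => β (φ x)) 2 μ ≤ ENNReal.ofReal c₁ *
          eLpNorm (fun x => |γ (φ x)| ^ r) (ENNReal.ofReal 2) μ := by
        have h2 : ENNReal.ofReal 2 = 2 := by norm_num
        rw [h2]
        refine eLpNorm_le_mul_eLpNorm_of_ae_le_mul (Eventually.of_forall fun x => ?_) _
        rw [Real.norm_eq_abs, Real.norm_eq_abs, abs_of_nonneg (Real.rpow_nonneg (abs_nonneg _) _)]
        exact (hb12 (φ x)).2
      have e3 : eLpNorm (fun x => |γ (φ x)| ^ r) (ENNReal.ofReal 2) μ ≠ ⊤ := by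
        have := eLpNorm_norm_rpow (p := ENNReal.ofReal 2) (μ := μ) (fun x => γ (φ x)) hr0
        simp only [Real.norm_eq_abs] at this
        rw [this, ← ENNReal.ofReal_mul (by norm_num), hrq]
        exact ENNReal.rpow_ne_top_of_nonneg hr0.le hγfin
      have := ENNReal.toReal_mono (ENNReal.mul_ne_top ENNReal.ofReal_ne_top e3) e2
      rwa [ENNReal.toReal_mul, ENNReal.toReal_ofReal hc₁0] at this
    have s5 : N ^ 2 ≤ C₁ * A * N ^ r := by
      calc N ^ 2 ≤ (C₀.toReal * ∑ i, (eLpNorm (fun x => d (φ x) * g i x) 2 μ).toReal) ^ 2 :=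
            pow_le_pow_left₀ hN0 s2 2
        _ = C₀.toReal ^ 2 * (∑ i, (eLpNorm (fun x => d (φ x) * g i x) 2 μ).toReal) ^ 2 := by ring
        _ ≤ C₀.toReal ^ 2 *
              (n * ∑ i, (eLpNorm (fun x => d (φ x) * g i x) 2 μ).toReal ^ 2) := by
            gcongr
            have := sq_sum_le_card_mul_sum_sq (s := (Finset.univ : Finset (Fin n)))
              (f := fun i => (eLpNorm (fun x => d (φ x) * g i x) 2 μ).toReal)
            simpa using this
        _ ≤ C₀.toReal ^ 2 * (n * (A * (c₁ * N ^ r))) := by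
            rw [s3]; gcongr
        _ = C₁ * A * N ^ r := by rw [hC₁]; ring
    have s6 : N ≤ (C₁ * A) ^ (b + 1) := by
      rcases hN0.eq_or_lt with h0 | hpos
      · rw [← h0]; positivity
      · have e : N ^ (1 / (b + 1)) ≤ C₁ * A := by
          have h1 : N ^ (2 : ℝ) = N ^ (1 / (b + 1)) * N ^ r := by
            rw [← Real.rpow_add hpos]
            congr 1
            rw [hr]; field_simp; ring
          have h2 : N ^ (1 / (b + 1)) * N ^ r ≤ C₁ * A * N ^ r := by
            rw [← h1, Real.rpow_two]; exact s5
          exact le_of_mul_le_mul_right h2 (Real.rpow_pos_of_pos hpos _)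
        have := Real.rpow_le_rpow (by positivity) e (show 0 ≤ b + 1 by positivity)
        rwa [← Real.rpow_mul hN0, one_div_mul_cancel (by positivity), Real.rpow_one] at this
    -- Transfer the bound from `γ ∘ φ` to the truncation.
    have s7 : eLpNorm (fun x => min |φ x| (k : ℝ)) (ENNReal.ofReal (2 * n / (n - 4))) μ ^ (b + 1) ≤
        ENNReal.ofReal ((b + 1) * N) := by
      have e := eLpNorm_norm_rpow (p := ENNReal.ofReal q₁) (μ := μ)
        (fun x => min |φ x| (k : ℝ)) (show 0 < b + 1 by positivity)
      rw [← ENNReal.ofReal_mul hq₁0.le, hbq] at e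
      rw [← e, ENNReal.ofReal_mul (by positivity), hN, ENNReal.ofReal_toReal hγfin]
      refine eLpNorm_le_mul_eLpNorm_of_ae_le_mul (Eventually.of_forall fun x => ?_) _
      have hm0 : 0 ≤ min |φ x| (k : ℝ) := le_min (abs_nonneg _) hk0
      rw [Real.norm_eq_abs, Real.norm_eq_abs, Real.norm_eq_abs, abs_of_nonneg hm0,
        abs_of_nonneg (by positivity)]
      exact (hb12 (φ x)).1
    have s8 := ENNReal.rpow_le_rpow s7 (show 0 ≤ 1 / (b + 1) by positivity)
    rw [← ENNReal.rpow_mul, mul_one_div_cancel (by positivity), ENNReal.rpow_one,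
      ENNReal.ofReal_rpow_of_nonneg (by positivity) (by positivity)] at s8
    refine s8.trans (ENNReal.ofReal_le_ofReal ?_)
    calc ((b + 1) * N) ^ (1 / (b + 1)) ≤ ((b + 1) * (C₁ * A) ^ (b + 1)) ^ (1 / (b + 1)) := by
          gcongr
      _ = ((b + 1) * C₁ ^ (b + 1)) ^ (1 / (b + 1)) * A := by
          rw [Real.mul_rpow hC₁0 hA0, ← mul_assoc, Real.mul_rpow (by positivity) (by positivity),
            ← Real.rpow_mul hA0, mul_one_div_cancel (by positivity), Real.rpow_one]
  have hlim : ∀ᵐ x ∂μ, Tendsto (fun k : ℕ => min |φ x| (k : ℝ)) atTop (𝓝 |φ x|) := by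
    refine Eventually.of_forall fun x => tendsto_const_nhds.congr' ?_
    filter_upwards [(tendsto_natCast_atTop_atTop (R := ℝ)).eventually_ge_atTop |φ x|] with k hk
    rw [min_eq_left hk]
  have := Lp.eLpNorm_lim_le_liminf_eLpNorm (p := ENNReal.ofReal (2 * n / (n - 4)))
    (fun k : ℕ => (H.1.1.1.norm.inf aestronglyMeasurable_const :
      AEStronglyMeasurable (fun x => min |φ x| (k : ℝ)) μ)) _ hlim
  have e := eLpNorm_norm (p := ENNReal.ofReal (2 * n / (n - 4))) (μ := μ) φ
  simp only [Real.norm_eq_abs] at e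
  rw [← e]
  exact this.trans (liminf_le_of_le (by isBoundedDefault) fun c hc => by
    obtain ⟨k, hk⟩ := hc.exists
    exact hk.trans (key k))

end Moser

/-! ### A global defining function and Hardy's inequality -/

section Defining

variable {n : ℕ} {Ω : Set (EuclideanSpace ℝ (Fin n))}

/-- If two smooth functions define `Ω` near a boundary point `y`, then a direction that points into
`Ω` according to the first one does not point out of `Ω` according to the second one. -/
lemma fderiv_nonpos_of_local_defining {ρ₁ ρ₂ : EuclideanSpace ℝ (Fin n) → ℝ}
    {y v : EuclideanSpace ℝ (Fin n)} (h₁ : DifferentiableAt ℝ ρ₁ y)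
    (h₂ : DifferentiableAt ℝ ρ₂ y) (h10 : ρ₁ y = 0) (h20 : ρ₂ y = 0)
    (hl₁ : ∀ᶠ z in 𝓝 y, z ∈ Ω ↔ ρ₁ z < 0) (hl₂ : ∀ᶠ z in 𝓝 y, z ∈ Ω ↔ ρ₂ z < 0)
    (hv : fderiv ℝ ρ₁ y v < 0) : fderiv ℝ ρ₂ y v ≤ 0 := by
  have hline : HasDerivAt (fun t : ℝ => y + t • v) v 0 := by
    simpa using ((hasDerivAt_id (0 : ℝ)).smul_const v).const_add y
  have hd : ∀ {ρ : EuclideanSpace ℝ (Fin n) → ℝ}, DifferentiableAt ℝ ρ y → ρ y = 0 →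
      Tendsto (fun t : ℝ => t⁻¹ * ρ (y + t • v)) (𝓝[>] 0) (𝓝 (fderiv ℝ ρ y v)) := by
    intro ρ hρ h0
    have h1 : HasFDerivAt ρ (fderiv ℝ ρ y) (y + (0 : ℝ) • v) := by
      simpa using hρ.hasFDerivAt
    have := (h1.comp_hasDerivAt (0 : ℝ) hline).tendsto_slope_zero_right
    simpa [h0] using this
  have hcont : Tendsto (fun t : ℝ => y + t • v) (𝓝[>] 0) (𝓝 y) := by
    have := hline.continuousAt.tendsto
    simp only [zero_smul, add_zero] at this
    exact this.mono_left nhdsWithin_le_nhds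
  refine le_of_tendsto (hd h₂ h20) ?_
  filter_upwards [(hd h₁ h10).eventually_lt_const hv, hcont.eventually hl₁, hcont.eventually hl₂,
    self_mem_nhdsWithin] with t h3 h4 h5 ht
  have ht' : 0 < t⁻¹ := inv_pos.2 ht
  have : ρ₁ (y + t • v) < 0 := by
    by_contra! hge
    exact absurd h3 (not_lt.2 (mul_nonneg ht'.le hge))
  exact mul_nonpos_of_nonneg_of_nonpos ht'.le (h5.1 (h4.2 this)).le

/-- A bounded smooth domain has a smooth global defining function, positive inside: local ones are
glued with a partition of unity. The differential of the result does not vanish on the boundary,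
since the local differentials there are nonnegative multiples of each other. -/
lemma IsBoundedSmoothDomain.exists_defining (hΩ : IsBoundedSmoothDomain Ω) :
    ∃ ρ : EuclideanSpace ℝ (Fin n) → ℝ, ContDiff ℝ ∞ ρ ∧ (∀ x ∈ Ω, 0 < ρ x) ∧
      ∀ x ∈ frontier Ω, ρ x = 0 ∧ fderiv ℝ ρ x ≠ 0 := by
  have hfc : IsCompact (frontier Ω) :=
    hΩ.isBounded.isCompact_closure.of_isClosed_subset isClosed_frontier frontier_subset_closure
  have hloc : ∀ x ∈ frontier Ω, ∃ V : Set (EuclideanSpace ℝ (Fin n)), IsOpen V ∧ x ∈ V ∧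
      ∃ ρ : EuclideanSpace ℝ (Fin n) → ℝ, ContDiff ℝ ∞ ρ ∧
        ∀ y ∈ V, (y ∈ Ω ↔ ρ y < 0) ∧ fderiv ℝ ρ y ≠ 0 := by
    intro x hx
    obtain ⟨U, hU, ρ, hρ, hd, hdef⟩ := hΩ.smooth_boundary x hx
    have h1 : ∀ᶠ y in 𝓝 x, fderiv ℝ ρ y ≠ 0 :=
      (hρ.continuous_fderiv (by simp)).continuousAt.eventually_ne hd
    obtain ⟨V, hV, hVo, hxV⟩ := eventually_nhds_iff.1 (h1.and hU)
    exact ⟨V, hVo, hxV, ρ, hρ, fun y hy => ⟨hdef y (hV y hy).2, (hV y hy).1⟩⟩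
  choose! V hVo hxV ρ hρ hdef using hloc
  obtain ⟨t, htf, htc⟩ := hfc.elim_nhds_subcover V fun x hx => (hVo x hx).mem_nhds (hxV x hx)
  -- `none` indexes the interior chart, on which the defining function is constant.
  let U : Option t → Set (EuclideanSpace ℝ (Fin n)) := fun i => i.elim Ω fun x => V x
  let σ : Option t → EuclideanSpace ℝ (Fin n) → ℝ := fun i => i.elim (fun _ => -1) fun x => ρ x
  have hUo : ∀ i, IsOpen (U i) := by
    rintro (_ | x)
    · exact hΩ.isOpen
    · exact hVo x (htf x x.2)
  have hσ : ∀ i, ContDiff ℝ ∞ (σ i) := by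
    rintro (_ | x)
    · exact contDiff_const
    · exact hρ x (htf x x.2)
  have hUσ : ∀ i, ∀ y ∈ U i, y ∈ Ω ↔ σ i y < 0 := by
    rintro (_ | x) y hy
    · exact ⟨fun _ => by simp [σ], fun _ => hy⟩
    · exact (hdef x (htf x x.2) y hy).1
  have hcover : closure Ω ⊆ ⋃ i, U i := by
    intro y hy
    by_cases hyΩ : y ∈ Ω
    · exact Set.mem_iUnion.2 ⟨none, hyΩ⟩
    · have : y ∈ frontier Ω := ⟨hy, by rwa [hΩ.isOpen.interior_eq]⟩
      obtain ⟨x, hx, hyx⟩ := Set.mem_iUnion₂.1 (htc this)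
      exact Set.mem_iUnion.2 ⟨some ⟨x, hx⟩, hyx⟩
  obtain ⟨f, hf⟩ := SmoothPartitionOfUnity.exists_isSubordinate
    (modelWithCornersSelf ℝ (EuclideanSpace ℝ (Fin n))) isClosed_closure U hUo hcover
  have hfs : ∀ i, ContDiff ℝ ∞ (f i) := fun i => (f i).contMDiff.contDiff
  have hsum : ∀ y ∈ closure Ω, ∑ i, f i y = 1 := fun y hy => by
    rw [← finsum_eq_sum_of_fintype]; exact f.sum_eq_one hy
  have hexists : ∀ y ∈ closure Ω, ∃ i, 0 < f i y := by
    intro y hy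
    by_contra! hle
    have := Finset.sum_nonpos fun i (_ : i ∈ Finset.univ) => hle i
    rw [hsum y hy] at this
    linarith
  have hmem : ∀ i y, f i y ≠ 0 → y ∈ U i := fun i y h => hf i (subset_tsupport _ h)
  have hfrontier : ∀ y ∈ frontier Ω, ∀ i, y ∈ U i → σ i y = 0 := by
    intro y hy i hi
    have hyΩ : y ∉ Ω := fun h => hy.2 (by rwa [hΩ.isOpen.interior_eq])
    refine le_antisymm ?_ (not_lt.1 fun h => hyΩ ((hUσ i y hi).2 h))
    by_contra! hpos
    obtain ⟨z, ⟨hz1, hz2⟩, hzΩ⟩ := mem_closure_iff_nhds.1 hy.1 _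
      (inter_mem ((hUo i).mem_nhds hi) ((hσ i).continuous.continuousAt.eventually_const_lt hpos))
    exact absurd ((hUσ i z hz1).1 hzΩ) (not_lt.2 (le_of_lt hz2))
  refine ⟨fun x => -∑ i, f i x * σ i x, ?_, fun x hx => ?_, fun y hy => ⟨?_, ?_⟩⟩
  · exact (ContDiff.sum fun i _ => (hfs i).mul (hσ i)).neg
  · have hle : ∀ i ∈ Finset.univ, f i x * σ i x ≤ 0 := by
      intro i _
      rcases (f.nonneg i x).eq_or_lt with h0 | hpos
      · rw [← h0, zero_mul]
      · exact mul_nonpos_of_nonneg_of_nonpos hpos.le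
          ((hUσ i x (hmem i x hpos.ne')).1 hx).le
    obtain ⟨i, hi⟩ := hexists x (subset_closure hx)
    have hlt : f i x * σ i x < 0 :=
      mul_neg_of_pos_of_neg hi ((hUσ i x (hmem i x hi.ne')).1 hx)
    have := Finset.sum_lt_sum hle ⟨i, Finset.mem_univ i, hlt⟩
    simp only [Finset.sum_const_zero] at this
    linarith
  · rw [neg_eq_zero]
    refine Finset.sum_eq_zero fun i _ => ?_
    by_cases h : f i y = 0
    · rw [h, zero_mul]
    · rw [hfrontier y hy i (hmem i y h), mul_zero]
  · have hder : ∀ v, fderiv ℝ (fun x => -∑ i, f i x * σ i x) y v =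
        -∑ i, f i y * fderiv ℝ (σ i) y v := by
      intro v
      have h1 : ∀ i, HasFDerivAt (fun x => f i x * σ i x)
          (f i y • fderiv ℝ (σ i) y + σ i y • fderiv ℝ (f i) y) y := fun i =>
        ((hfs i).differentiable (by simp) y).hasFDerivAt.mul
          ((hσ i).differentiable (by simp) y).hasFDerivAt
      rw [(HasFDerivAt.fun_sum fun i (_ : i ∈ Finset.univ) => h1 i).fun_neg.fderiv]
      simp only [neg_apply, sum_apply, add_apply, smul_apply, smul_eq_mul, neg_inj]
      refine Finset.sum_congr rfl fun i _ => ?_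
      by_cases h : y ∈ tsupport (f i)
      · rw [hfrontier y hy i (hf i h)]; ring
      · have : fderiv ℝ (f i) y = 0 :=
          image_eq_zero_of_notMem_tsupport fun h' => h (tsupport_fderiv_subset ℝ h')
        rw [this]; simp
    obtain ⟨i, hi⟩ := hexists y hy.1
    have hiU := hmem i y hi.ne'
    have hnz : fderiv ℝ (σ i) y ≠ 0 := by
      rcases i with _ | x
      · exact absurd hiU fun h => hy.2 (by rwa [hΩ.isOpen.interior_eq])
      · exact (hdef x (htf x x.2) y hiU).2
    obtain ⟨v, hv⟩ : ∃ v, fderiv ℝ (σ i) y v < 0 := by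
      by_contra! hge
      refine hnz (ContinuousLinearMap.ext fun v => le_antisymm ?_ (hge v))
      have := hge (-v)
      simp only [map_neg] at this
      simpa using this
    -- All terms of the glued differential at `v` have the same sign, and the `i`-th is nonzero.
    intro h0
    have h1 := hder v
    rw [h0] at h1
    have hloc : ∀ j, y ∈ U j → ∀ᶠ z in 𝓝 y, z ∈ Ω ↔ σ j z < 0 := fun j hj => by
      filter_upwards [(hUo j).mem_nhds hj] with z hz using hUσ j z hz
    have hle : ∀ j ∈ Finset.univ, f j y * fderiv ℝ (σ j) y v ≤ 0 := by
      intro j _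
      rcases (f.nonneg j y).eq_or_lt with h0 | hpos
      · rw [← h0, zero_mul]
      · have hjU := hmem j y hpos.ne'
        refine mul_nonpos_of_nonneg_of_nonpos hpos.le ?_
        exact fderiv_nonpos_of_local_defining ((hσ i).differentiable (by simp) y)
          ((hσ j).differentiable (by simp) y) (hfrontier y hy i hiU) (hfrontier y hy j hjU)
          (hloc i hiU) (hloc j hjU) hv
    have := Finset.sum_lt_sum hle ⟨i, Finset.mem_univ i, mul_neg_of_pos_of_neg hi hv⟩
    simp only [Finset.sum_const_zero] at this
    simp only [zero_apply] at h1
    linarith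

/-- `ρ` is a smooth defining function of `Ω` (positive in `Ω`, zero on `∂Ω`) with
`|∇ρ|² + ρ² ≥ c` on `Ω`, and `L` bounds its first and second derivatives there. -/
structure IsDefining (Ω : Set (EuclideanSpace ℝ (Fin n))) (ρ : EuclideanSpace ℝ (Fin n) → ℝ)
    (c L : ℝ) : Prop where
  contDiff : ContDiff ℝ ∞ ρ
  pos : ∀ x ∈ Ω, 0 < ρ x
  frontier_eq : ∀ x ∈ frontier Ω, ρ x = 0
  c_pos : 0 < c
  L_pos : 0 < L
  lower : ∀ x ∈ Ω, c ≤ ∑ i, partialDeriv i ρ x ^ 2 + ρ x ^ 2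
  bound₁ : ∀ x ∈ Ω, ∀ i, |partialDeriv i ρ x| ≤ L
  bound₂ : ∀ x ∈ Ω, ∀ i j, |partialDeriv i (partialDeriv j ρ) x| ≤ L

lemma IsBoundedSmoothDomain.exists_isDefining (hΩ : IsBoundedSmoothDomain Ω) :
    ∃ ρ c L, IsDefining Ω ρ c L := by
  obtain ⟨ρ, hρ, hpos, hfr⟩ := hΩ.exists_defining
  have hK : IsCompact (closure Ω) := hΩ.isBounded.isCompact_closure
  have hne : (closure Ω).Nonempty := hΩ.isConnected.nonempty.closure
  have c1 : ∀ i, Continuous (partialDeriv i ρ) := fun i =>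
    (ContDiff.partialDeriv_infty hρ).continuous
  have c2 : ∀ i j, Continuous (partialDeriv i (partialDeriv j ρ)) := fun i j =>
    (ContDiff.partialDeriv_infty (ContDiff.partialDeriv_infty hρ)).continuous
  obtain ⟨x₀, hx₀, hmin⟩ := hK.exists_isMinOn hne
    (f := fun x => ∑ i, partialDeriv i ρ x ^ 2 + ρ x ^ 2)
    ((continuous_finsetSum _ fun i _ => (c1 i).pow 2).add (hρ.continuous.pow 2)).continuousOn
  obtain ⟨B, hB⟩ := hK.exists_bound_of_continuousOn
    (f := fun x => ∑ i, |partialDeriv i ρ x| + ∑ i, ∑ j, |partialDeriv i (partialDeriv j ρ) x|)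
    (by fun_prop)
  have hbd : ∀ x ∈ Ω, ∑ i, |partialDeriv i ρ x| +
      ∑ i, ∑ j, |partialDeriv i (partialDeriv j ρ) x| ≤ |B| + 1 := fun x hx => by
    have := (le_abs_self _).trans ((hB x (subset_closure hx)).trans (le_abs_self B))
    linarith
  have s1 : ∀ x, 0 ≤ ∑ i, |partialDeriv i ρ x| := fun x =>
    Finset.sum_nonneg fun i _ => abs_nonneg _
  have s2 : ∀ x, 0 ≤ ∑ i, ∑ j, |partialDeriv i (partialDeriv j ρ) x| := fun x =>
    Finset.sum_nonneg fun i _ => Finset.sum_nonneg fun j _ => abs_nonneg _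
  refine ⟨ρ, _, |B| + 1, hρ, hpos, fun x hx => (hfr x hx).1, ?_, by positivity,
    fun x hx => hmin (subset_closure hx), fun x hx i => ?_, fun x hx i j => ?_⟩
  · by_cases hx : x₀ ∈ Ω
    · have := hpos x₀ hx
      have h2 : 0 ≤ ∑ i, partialDeriv i ρ x₀ ^ 2 := Finset.sum_nonneg fun i _ => sq_nonneg _
      positivity
    · have := (hfr x₀ ⟨hx₀, by rwa [hΩ.isOpen.interior_eq]⟩).2
      simp only [← norm_fderiv_sq]
      have : 0 < ‖fderiv ℝ ρ x₀‖ := norm_pos_iff.2 this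
      positivity
  · have := Finset.single_le_sum (f := fun i => |partialDeriv i ρ x|)
      (fun i _ => abs_nonneg _) (Finset.mem_univ i)
    linarith [hbd x hx, s2 x]
  · have h1 := Finset.single_le_sum (f := fun j => |partialDeriv i (partialDeriv j ρ) x|)
      (fun i _ => abs_nonneg _) (Finset.mem_univ j)
    have h2 := Finset.single_le_sum
      (f := fun i => ∑ j, |partialDeriv i (partialDeriv j ρ) x|)
      (fun i _ => Finset.sum_nonneg fun j _ => abs_nonneg _) (Finset.mem_univ i)
    linarith [hbd x hx, s1 x]

variable {ρ : EuclideanSpace ℝ (Fin n) → ℝ} {c L : ℝ}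

/-- `r` is a positive smooth function on the whole space that agrees with the defining function
`ρ` on the compact subset `{r ≥ δ}` of `Ω`, which is also `{ρ ≥ δ} ∩ Ω`. -/
structure IsRegularized (Ω : Set (EuclideanSpace ℝ (Fin n)))
    (ρ r : EuclideanSpace ℝ (Fin n) → ℝ) (δ : ℝ) : Prop where
  contDiff : ContDiff ℝ ∞ r
  pos : ∀ x, 0 < r x
  isCompact : IsCompact {x | δ ≤ r x}
  subset : ∀ x, δ ≤ r x → x ∈ Ω ∧ r =ᶠ[𝓝 x] ρ
  of_mem : ∀ x ∈ Ω, δ ≤ ρ x → r =ᶠ[𝓝 x] ρ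

/-- The regularization is `δ / 2 + S(ρ) (ρ - δ / 2)` in `Ω` and `δ / 2` outside, with a smooth
transition function `S` that vanishes on `(-∞, δ / 2]` and is `1` on `[3δ / 4, ∞)`. -/
lemma IsDefining.exists_isRegularized (hΩ : IsBoundedSmoothDomain Ω) (h : IsDefining Ω ρ c L)
    {δ : ℝ} (hδ : 0 < δ) : ∃ r, IsRegularized Ω ρ r δ := by
  classical
  set S : ℝ → ℝ := fun t => Real.smoothTransition (4 * t / δ - 2) with hS
  have hS0 : ∀ t ≤ δ / 2, S t = 0 := fun t ht => Real.smoothTransition.zero_of_nonpos (by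
    rw [sub_nonpos, div_le_iff₀ hδ]; linarith)
  have hS1 : ∀ t, 3 * δ / 4 ≤ t → S t = 1 := fun t ht => Real.smoothTransition.one_of_one_le (by
    rw [le_sub_iff_add_le, le_div_iff₀ hδ]; linarith)
  have hSs : ContDiff ℝ ∞ S := Real.smoothTransition.contDiff.comp (by fun_prop)
  set q : EuclideanSpace ℝ (Fin n) → ℝ := fun x => S (ρ x) * (ρ x - δ / 2) with hq
  have hqs : ContDiff ℝ ∞ q := (hSs.comp h.contDiff).mul (h.contDiff.sub contDiff_const)
  have hq0 : ∀ x, ρ x ≤ δ / 2 → q x = 0 := fun x hx => by simp [hq, hS0 _ hx]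
  have hq1 : ∀ x, 3 * δ / 4 ≤ ρ x → q x = ρ x - δ / 2 := fun x hx => by simp [hq, hS1 _ hx]
  have hqnn : ∀ x, 0 ≤ q x := fun x => by
    rcases le_total (ρ x) (δ / 2) with h1 | h1
    · rw [hq0 x h1]
    · exact mul_nonneg (Real.smoothTransition.nonneg _) (by linarith)
  set r : EuclideanSpace ℝ (Fin n) → ℝ := fun x => δ / 2 + Ω.indicator q x with hr
  have hmem : ∀ x ∈ Ω, δ ≤ ρ x → r =ᶠ[𝓝 x] ρ := by
    intro x hx hxδ
    filter_upwards [hΩ.isOpen.mem_nhds hx, h.contDiff.continuous.continuousAt.eventually_const_lt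
      (show 3 * δ / 4 < ρ x by linarith)] with y hy hy2
    simp [hr, hy, hq1 y hy2.le]
  have hiff : ∀ x, δ ≤ r x → x ∈ Ω ∧ δ ≤ ρ x := by
    intro x hx
    have hxΩ : x ∈ Ω := by
      by_contra hx'
      simp [hr, hx'] at hx
      linarith
    refine ⟨hxΩ, ?_⟩
    simp only [hr, Set.indicator_of_mem hxΩ] at hx
    rcases le_total (ρ x) (δ / 2) with h1 | h1
    · rw [hq0 x h1] at hx; linarith
    · have : q x ≤ 1 * (ρ x - δ / 2) :=
        mul_le_mul_of_nonneg_right (Real.smoothTransition.le_one _) (by linarith)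
      linarith
  refine ⟨r, ?_, fun x => ?_, ?_, fun x hx => ⟨(hiff x hx).1, hmem x (hiff x hx).1 (hiff x hx).2⟩,
    hmem⟩
  · refine contDiff_const.add (contDiff_iff_contDiffAt.2 fun x => ?_)
    by_cases hx : x ∈ Ω
    · refine hqs.contDiffAt.congr_of_eventuallyEq ?_
      filter_upwards [hΩ.isOpen.mem_nhds hx] with y hy
      simp [hy]
    · have : Ω.indicator q =ᶠ[𝓝 x] fun _ => 0 := by
        by_cases hx' : x ∈ closure Ω
        · have h0 := h.frontier_eq x ⟨hx', by rwa [hΩ.isOpen.interior_eq]⟩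
          filter_upwards [h.contDiff.continuous.continuousAt.eventually_lt_const
            (show ρ x < δ / 2 by rw [h0]; positivity)] with y hy
          by_cases hyΩ : y ∈ Ω
          · simp [hyΩ, hq0 y hy.le]
          · simp [hyΩ]
        · filter_upwards [isClosed_closure.isOpen_compl.mem_nhds hx'] with y hy
          have : y ∉ Ω := fun h => hy (subset_closure h)
          simp [this]
      exact contDiffAt_const.congr_of_eventuallyEq this
  · have : 0 ≤ Ω.indicator q x := Set.indicator_nonneg (fun x _ => hqnn x) x
    simp only [hr]; linarith
  · have : {x | δ ≤ r x} = closure Ω ∩ {x | δ ≤ ρ x} := by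
      ext x
      refine ⟨fun hx => ⟨subset_closure (hiff x hx).1, (hiff x hx).2⟩, fun ⟨hx1, hx2⟩ => ?_⟩
      have hxΩ : x ∈ Ω := by
        by_contra hx'
        have h0 := h.frontier_eq x ⟨hx1, by rwa [hΩ.isOpen.interior_eq]⟩
        simp only [Set.mem_ofPred_eq] at hx2
        linarith
      have := (hmem x hxΩ hx2).eq_of_nhds
      simp only [Set.mem_ofPred_eq, this]
      exact hx2
    rw [this]
    exact hΩ.isBounded.isCompact_closure.inter_right
      (isClosed_le continuous_const h.contDiff.continuous)

lemma partialDeriv_congr {f g : EuclideanSpace ℝ (Fin n) → ℝ} {x : EuclideanSpace ℝ (Fin n)}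
    (h : f =ᶠ[𝓝 x] g) (i : Fin n) : partialDeriv i f =ᶠ[𝓝 x] partialDeriv i g := by
  filter_upwards [h.fderiv (𝕜 := ℝ)] with y hy
  rw [partialDeriv, partialDeriv, hy]

section

variable {r : EuclideanSpace ℝ (Fin n) → ℝ} {δ : ℝ} {x : EuclideanSpace ℝ (Fin n)}

lemma IsRegularized.lower (hr : IsRegularized Ω ρ r δ) (h : IsDefining Ω ρ c L) (hx : δ ≤ r x) :
    c ≤ ∑ i, partialDeriv i r x ^ 2 + r x ^ 2 := by
  obtain ⟨h1, h2⟩ := hr.subset x hx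
  simp_rw [fun i => (partialDeriv_congr h2 i).eq_of_nhds, h2.eq_of_nhds]
  exact h.lower x h1

lemma IsRegularized.bound₁ (hr : IsRegularized Ω ρ r δ) (h : IsDefining Ω ρ c L) (hx : δ ≤ r x)
    (i : Fin n) : |partialDeriv i r x| ≤ L := by
  obtain ⟨h1, h2⟩ := hr.subset x hx
  rw [(partialDeriv_congr h2 i).eq_of_nhds]
  exact h.bound₁ x h1 i

lemma IsRegularized.bound₂ (hr : IsRegularized Ω ρ r δ) (h : IsDefining Ω ρ c L) (hx : δ ≤ r x)
    (i j : Fin n) : |partialDeriv i (partialDeriv j r) x| ≤ L := by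
  obtain ⟨h1, h2⟩ := hr.subset x hx
  rw [(partialDeriv_congr (partialDeriv_congr h2 j) i).eq_of_nhds]
  exact h.bound₂ x h1 i j

end

/-- Every compact subset of `Ω` lies in some `{ρ ≥ δ}`. -/
lemma IsDefining.exists_le_of_isCompact (h : IsDefining Ω ρ c L)
    {S : Set (EuclideanSpace ℝ (Fin n))} (hS : IsCompact S) (hSΩ : S ⊆ Ω) :
    ∃ δ > 0, ∀ x ∈ S, δ ≤ ρ x := by
  rcases S.eq_empty_or_nonempty with rfl | hne
  · exact ⟨1, one_pos, by simp⟩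
  · obtain ⟨x₀, hx₀, hmin⟩ := hS.exists_isMinOn hne h.contDiff.continuous.continuousOn
    exact ⟨ρ x₀, h.pos x₀ (hSΩ hx₀), fun x hx => hmin hx⟩

lemma partialDeriv_inv {r : EuclideanSpace ℝ (Fin n) → ℝ} {x : EuclideanSpace ℝ (Fin n)}
    {i : Fin n} (hr : DifferentiableAt ℝ r x) (h0 : r x ≠ 0) :
    partialDeriv i (fun y => (r y)⁻¹) x = -partialDeriv i r x / r x ^ 2 := by
  rw [partialDeriv_comp (β := fun t => t⁻¹) (differentiableAt_inv h0) hr, deriv_inv]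
  field_simp

/-- Pointwise form of Hardy's inequality: the last sum is the divergence of `θ² ∇r / r`. -/
lemma hardy_pointwise {c L θ r : ℝ} {s t d : Fin n → ℝ} (hc : 0 < c) (hL : 0 < L) (hr : 0 < r)
    (hlow : c ≤ ∑ i, s i ^ 2 + r ^ 2) (hs : ∀ i, |s i| ≤ L) (hd : ∀ i, |d i| ≤ L) :
    c / 2 * (θ / r) ^ 2 ≤ (1 + n * (n * L ^ 2 / c) + 4 * n * L ^ 2 / c) *
      (θ ^ 2 + ∑ i, t i ^ 2) - ∑ i, (2 * θ * t i * (s i / r) +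
        θ ^ 2 * (-s i ^ 2 / r ^ 2 + d i / r)) := by
  rcases Nat.eq_zero_or_pos n with rfl | hn
  · simp only [Finset.univ_eq_empty, Finset.sum_empty, zero_add] at hlow ⊢
    have : (θ / r) ^ 2 * c ≤ θ ^ 2 := by
      calc (θ / r) ^ 2 * c ≤ (θ / r) ^ 2 * r ^ 2 := by gcongr
        _ = θ ^ 2 := by field_simp
    have h2 : 0 ≤ (θ / r) ^ 2 * c := by positivity
    simp
    nlinarith
  have hn0 : (0 : ℝ) < n := by exact_mod_cast hn
  set a := θ / r with ha
  have hθ : θ = a * r := by rw [ha]; field_simp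
  have key : ∀ i, a ^ 2 * s i ^ 2 + (2 * θ * t i * (s i / r) +
        θ ^ 2 * (-s i ^ 2 / r ^ 2 + d i / r)) ≤
      c / (2 * n) * a ^ 2 + 4 * n * L ^ 2 / c * t i ^ 2 + n * L ^ 2 / c * θ ^ 2 := by
    intro i
    have e : a ^ 2 * s i ^ 2 + (2 * θ * t i * (s i / r) +
        θ ^ 2 * (-s i ^ 2 / r ^ 2 + d i / r)) = 2 * (a * (t i * s i)) + a * (θ * d i) := by
      rw [hθ]; field_simp; ring
    have q1 : 2 * (a * (t i * s i)) ≤ c / (4 * n) * a ^ 2 + 4 * n / c * (t i * s i) ^ 2 := by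
      have := sq_nonneg (c * a - 4 * n * (t i * s i))
      have h3 : c / (4 * n) * a ^ 2 + 4 * n / c * (t i * s i) ^ 2 - 2 * (a * (t i * s i)) =
          (c * a - 4 * n * (t i * s i)) ^ 2 / (4 * n * c) := by field_simp; ring
      have h4 : 0 ≤ (c * a - 4 * n * (t i * s i)) ^ 2 / (4 * n * c) := by positivity
      linarith
    have q2 : a * (θ * d i) ≤ c / (4 * n) * a ^ 2 + n / c * (θ * d i) ^ 2 := by
      have h3 : c / (4 * n) * a ^ 2 + n / c * (θ * d i) ^ 2 - a * (θ * d i) =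
          (c * a - 2 * n * (θ * d i)) ^ 2 / (4 * n * c) := by field_simp; ring
      have h4 : 0 ≤ (c * a - 2 * n * (θ * d i)) ^ 2 / (4 * n * c) := by positivity
      linarith
    have q3 : (t i * s i) ^ 2 ≤ L ^ 2 * t i ^ 2 := by
      rw [mul_pow, mul_comm]
      exact mul_le_mul_of_nonneg_right (sq_le_sq' (abs_le.1 (hs i)).1 (abs_le.1 (hs i)).2)
        (sq_nonneg _)
    have q4 : (θ * d i) ^ 2 ≤ L ^ 2 * θ ^ 2 := by
      rw [mul_pow, mul_comm]
      exact mul_le_mul_of_nonneg_right (sq_le_sq' (abs_le.1 (hd i)).1 (abs_le.1 (hd i)).2)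
        (sq_nonneg _)
    have q5 : 4 * n / c * (t i * s i) ^ 2 ≤ 4 * n * L ^ 2 / c * t i ^ 2 := by
      calc 4 * n / c * (t i * s i) ^ 2 ≤ 4 * n / c * (L ^ 2 * t i ^ 2) := by gcongr
        _ = _ := by ring
    have q6 : n / c * (θ * d i) ^ 2 ≤ n * L ^ 2 / c * θ ^ 2 := by
      calc n / c * (θ * d i) ^ 2 ≤ n / c * (L ^ 2 * θ ^ 2) := by gcongr
        _ = _ := by ring
    have q7 : c / (2 * n) * a ^ 2 = c / (4 * n) * a ^ 2 + c / (4 * n) * a ^ 2 := by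
      field_simp; ring
    rw [e, q7]
    linarith
  have hsum := Finset.sum_le_sum fun i (_ : i ∈ Finset.univ) => key i
  simp only [Finset.sum_add_distrib, ← Finset.mul_sum, Finset.sum_const, Finset.card_univ,
    Fintype.card_fin, nsmul_eq_mul] at hsum
  have hlow' : c * a ^ 2 ≤ a ^ 2 * ∑ i, s i ^ 2 + θ ^ 2 := by
    calc c * a ^ 2 ≤ (∑ i, s i ^ 2 + r ^ 2) * a ^ 2 := by gcongr
      _ = _ := by rw [hθ]; ring
  have e1 : (n : ℝ) * (c / (2 * n) * a ^ 2) = c / 2 * a ^ 2 := by field_simp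
  have hT : 0 ≤ ∑ i, t i ^ 2 := Finset.sum_nonneg fun i _ => sq_nonneg _
  have p1 : 0 ≤ (1 + n * (n * L ^ 2 / c)) * ∑ i, t i ^ 2 := by positivity
  have p2 : 0 ≤ 4 * n * L ^ 2 / c * θ ^ 2 := by positivity
  simp only [Finset.sum_add_distrib, ← Finset.mul_sum] at hsum ⊢
  nlinarith

/-- Hardy's inequality for test functions. -/
lemma IsDefining.hardy_test (hΩ : IsBoundedSmoothDomain Ω) (h : IsDefining Ω ρ c L) :
    ∃ C : ℝ, 0 ≤ C ∧ ∀ θ, IsTestFunction Ω θ → ∫ x in Ω, (θ x / ρ x) ^ 2 ≤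
      C * ((∫ x in Ω, θ x ^ 2) + ∑ i, ∫ x in Ω, partialDeriv i θ x ^ 2) ∧
      IntegrableOn (fun x => (θ x / ρ x) ^ 2) Ω := by
  have hc := h.c_pos
  have hL := h.L_pos
  set K := 1 + n * (n * L ^ 2 / c) + 4 * n * L ^ 2 / c with hK
  have hK0 : 0 ≤ K := by positivity
  refine ⟨2 / c * K, by positivity, fun θ hθ => ?_⟩
  obtain ⟨δ, hδ, hδθ⟩ := h.exists_le_of_isCompact hθ.2.1.isCompact hθ.2.2
  obtain ⟨r, hr⟩ := h.exists_isRegularized hΩ hδ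
  have hr1 : ContDiff ℝ ∞ fun x => (r x)⁻¹ := hr.contDiff.inv fun x => (hr.pos x).ne'
  have hpr : ∀ i, ContDiff ℝ ∞ (partialDeriv i r) := fun i =>
    ContDiff.partialDeriv_infty hr.contDiff
  have hrδ : ∀ x ∈ tsupport θ, δ ≤ r x ∧ r x = ρ x := fun x hx => by
    have := (hr.of_mem x (hθ.2.2 hx) (hδθ x hx)).eq_of_nhds
    exact ⟨this ▸ hδθ x hx, this⟩
  set F : Fin n → EuclideanSpace ℝ (Fin n) → ℝ := fun i x =>
    θ x * θ x * ((r x)⁻¹ * partialDeriv i r x) with hF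
  have hFs : ∀ i, ContDiff ℝ ∞ (F i) := fun i => (hθ.1.mul hθ.1).mul (hr1.mul (hpr i))
  have hFc : ∀ i, HasCompactSupport (F i) := fun i => hθ.2.1.mul_left.mul_right
  have hdF : ∀ i x, partialDeriv i (F i) x = 2 * θ x * partialDeriv i θ x *
      (partialDeriv i r x / r x) + θ x ^ 2 * (-partialDeriv i r x ^ 2 / r x ^ 2 +
        partialDeriv i (partialDeriv i r) x / r x) := by
    intro i x
    have d1 := hθ.differentiable x
    have d2 := hr.contDiff.differentiable (by simp) x
    have d3 := (hpr i).differentiable (by simp) x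
    have d4 := hr1.differentiable (by simp) x
    have hrx := (hr.pos x).ne'
    have e1 := partialDeriv_mul (i := i) (f := fun y => θ y * θ y)
      (g := fun y => (r y)⁻¹ * partialDeriv i r y) (d1.mul d1) (d4.mul d3)
    have e2 := partialDeriv_mul (i := i) (f := fun y => (r y)⁻¹) d4 d3
    rw [partialDeriv_mul d1 d1, e2, partialDeriv_inv d2 hrx] at e1
    rw [hF, e1]
    field_simp
    ring
  have hpt : ∀ x, c / 2 * (θ x / r x) ^ 2 ≤ K * (θ x ^ 2 + ∑ i, partialDeriv i θ x ^ 2) -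
      ∑ i, partialDeriv i (F i) x := by
    intro x
    by_cases hx : x ∈ tsupport θ
    · simp only [hdF]
      exact hardy_pointwise hc hL (hr.pos x) (hr.lower h (hrδ x hx).1)
        (hr.bound₁ h (hrδ x hx).1) fun i => hr.bound₂ h (hrδ x hx).1 i i
    · have h0 : θ x = 0 := image_eq_zero_of_notMem_tsupport hx
      simp only [hdF, h0]
      have : 0 ≤ ∑ i, partialDeriv i θ x ^ 2 := Finset.sum_nonneg fun i _ => sq_nonneg _
      simp
      positivity
  have cint : ∀ {f : EuclideanSpace ℝ (Fin n) → ℝ}, Continuous f → HasCompactSupport f →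
      Integrable f := fun hf hc => hf.integrable_of_hasCompactSupport hc
  have i1 : Integrable fun x => θ x ^ 2 :=
    cint (hθ.continuous.pow 2) (hθ.2.1.comp_left (g := fun t : ℝ => t ^ 2) (by simp))
  have i2 : ∀ i, Integrable fun x => partialDeriv i θ x ^ 2 := fun i =>
    cint (hθ.pderiv.continuous.pow 2)
      (hθ.pderiv.2.1.comp_left (g := fun t : ℝ => t ^ 2) (by simp))
  have i3 : ∀ i, Integrable (partialDeriv i (F i)) := fun i =>
    cint (ContDiff.partialDeriv_infty (hFs i)).continuous
      (HasCompactSupport.partialDeriv_compact (hFc i))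
  have i4 : Integrable fun x => (θ x / r x) ^ 2 := by
    refine cint ((hθ.continuous.div hr.contDiff.continuous fun x => (hr.pos x).ne').pow 2)
      (hθ.2.1.mono fun x hx => ?_)
    intro h0
    simp [h0] at hx
  have hint : c / 2 * ∫ x, (θ x / r x) ^ 2 ≤
      K * ((∫ x, θ x ^ 2) + ∑ i, ∫ x, partialDeriv i θ x ^ 2) := by
    have := integral_mono (i4.const_mul (c / 2))
      (((i1.add (integrable_finsetSum _ fun i _ => i2 i)).const_mul K).sub
        (integrable_finsetSum _ fun i _ => i3 i)) (fun x => by simpa using hpt x)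
    rw [integral_const_mul] at this
    refine this.trans (le_of_eq ?_)
    rw [integral_sub' ((i1.add (integrable_finsetSum _ fun i _ => i2 i)).const_mul K)
      (integrable_finsetSum _ fun i _ => i3 i), integral_finsetSum _ fun i _ => i3 i,
      integral_const_mul]
    have e := integral_add i1 (integrable_finsetSum Finset.univ fun i _ => i2 i)
    rw [integral_finsetSum _ fun i _ => i2 i] at e
    simp only [Pi.add_apply, e]
    simp [integral_partialDeriv_eq_zero ((hFs _).of_le (by simp)) (hFc _)]
  have hset : ∀ {f : EuclideanSpace ℝ (Fin n) → ℝ}, (∀ x ∉ Ω, f x = 0) →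
      ∫ x in Ω, f x = ∫ x, f x := fun hf =>
    setIntegral_eq_integral_of_forall_compl_eq_zero hf
  have hρr : ∀ x, θ x / ρ x = θ x / r x := by
    intro x
    by_cases hx : x ∈ tsupport θ
    · rw [(hrδ x hx).2]
    · simp [image_eq_zero_of_notMem_tsupport hx]
  simp only [hρr]
  refine ⟨?_, i4.integrableOn⟩
  rw [hset fun x hx => by simp [hθ.eq_zero hx], hset fun x hx => by simp [hθ.eq_zero hx]]
  simp_rw [fun i => hset (f := fun x => partialDeriv i θ x ^ 2)
    fun x hx => by simp [hθ.pderiv.eq_zero hx]]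
  calc ∫ x, (θ x / r x) ^ 2 = 2 / c * (c / 2 * ∫ x, (θ x / r x) ^ 2) := by field_simp
    _ ≤ 2 / c * (K * ((∫ x, θ x ^ 2) + ∑ i, ∫ x, partialDeriv i θ x ^ 2)) := by gcongr
    _ = _ := by ring

end Defining

section HardyH10

variable {n : ℕ} {Ω : Set (EuclideanSpace ℝ (Fin n))} {ρ φ : EuclideanSpace ℝ (Fin n) → ℝ}
  {g : Fin n → EuclideanSpace ℝ (Fin n) → ℝ} {c L : ℝ}

/-- Hardy's inequality: the quotient of a function in `H¹₀(Ω)` by the defining function is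
square-integrable. -/
lemma IsH10.hardy (hφ : IsH10 Ω φ g) (hΩ : IsBoundedSmoothDomain Ω) (h : IsDefining Ω ρ c L) :
    MemLp (fun x => φ x / ρ x) 2 (volume.restrict Ω) := by
  obtain ⟨C, hC, hH⟩ := h.hardy_test hΩ
  obtain ⟨θ, hθ, h1, h2, h3⟩ := hφ.exists_seq_ae
  have hm : ∀ {f : EuclideanSpace ℝ (Fin n) → ℝ}, AEStronglyMeasurable f (volume.restrict Ω) →
      AEStronglyMeasurable (fun x => f x / ρ x) (volume.restrict Ω) := fun hf =>
    (hf.aemeasurable.div h.contDiff.continuous.aemeasurable).aestronglyMeasurable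
  have hL : ∀ k, MemLp (fun x => θ k x / ρ x) 2 (volume.restrict Ω) := fun k =>
    (memLp_two_iff_integrable_sq (hm ((hθ k).memLp 2 _).1)).2 (hH _ (hθ k)).2
  refine ⟨hm hφ.1.1, ?_⟩
  have hb : ∀ k, eLpNorm (fun x => θ k x / ρ x) 2 (volume.restrict Ω) ≤
      ENNReal.ofReal (√(C * ((∫ x in Ω, θ k x * θ k x) +
        ∑ i, ∫ x in Ω, partialDeriv i (θ k) x * partialDeriv i (θ k) x))) := by
    intro k
    rw [← ENNReal.ofReal_toReal (hL k).2.ne, toReal_eLpNorm_eq_sqrt (hL k)]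
    refine ENNReal.ofReal_le_ofReal (Real.sqrt_le_sqrt ?_)
    simpa only [sq] using (hH _ (hθ k)).1
  have ht : Tendsto (fun k => (∫ x in Ω, θ k x * θ k x) +
        ∑ i, ∫ x in Ω, partialDeriv i (θ k) x * partialDeriv i (θ k) x) atTop
      (𝓝 ((∫ x in Ω, φ x * φ x) + ∑ i, ∫ x in Ω, g i x * g i x)) :=
    (tendsto_integral_mul (fun k => (hθ k).memLp 2 _) (fun k => (hθ k).memLp 2 _) hφ.1 hφ.1
      h1 h1).add (tendsto_finsetSum _ fun i _ =>
        tendsto_integral_mul (fun k => (hθ k).pderiv.memLp 2 _)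
          (fun k => (hθ k).pderiv.memLp 2 _) (hφ.2.1 i) (hφ.2.1 i) (h2 i) (h2 i))
  have ht' := (ENNReal.continuous_ofReal.comp Real.continuous_sqrt).tendsto _ |>.comp
    (ht.const_mul C)
  have hlim : ∀ᵐ x ∂(volume.restrict Ω),
      Tendsto (fun k => θ k x / ρ x) atTop (𝓝 (φ x / ρ x)) := by
    filter_upwards [h3] with x hx using hx.div_const _
  refine (Lp.eLpNorm_lim_le_liminf_eLpNorm (fun k => (hL k).1) _ hlim).trans_lt ?_
  refine lt_of_le_of_lt (liminf_le_liminf (Eventually.of_forall hb)) ?_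
  have := ht'.liminf_eq
  simp only [Function.comp_def] at this
  rw [this]
  exact ENNReal.ofReal_lt_top

end HardyH10

/-! ### The Rellich identity and its pointwise consequences -/

/-- Smooth cutoff functions on the line, from `0` on `(-∞, δ]` to `1` on `[2δ, ∞)`. -/
lemma exists_cutoff : ∃ B : ℝ, 0 ≤ B ∧ ∀ δ : ℝ, 0 < δ → ∃ χ : ℝ → ℝ, ContDiff ℝ ∞ χ ∧
    (∀ t, 0 ≤ χ t) ∧ (∀ t, χ t ≤ 1) ∧ (∀ t ≤ δ, χ t = 0) ∧ (∀ t, 2 * δ ≤ t → χ t = 1) ∧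
    (∀ t, |deriv χ t| ≤ B / δ) ∧ ∀ t, t < δ ∨ 2 * δ < t → deriv χ t = 0 := by
  have hs : ContDiff ℝ ∞ Real.smoothTransition := Real.smoothTransition.contDiff
  have h0 : ∀ t < 0, deriv Real.smoothTransition t = 0 := fun t ht => by
    have : Real.smoothTransition =ᶠ[𝓝 t] fun _ => 0 := by
      filter_upwards [Iio_mem_nhds ht] with s hs
      exact Real.smoothTransition.zero_of_nonpos (le_of_lt hs)
    rw [this.deriv_eq, deriv_const]
  have h1 : ∀ t, 1 < t → deriv Real.smoothTransition t = 0 := fun t ht => by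
    have : Real.smoothTransition =ᶠ[𝓝 t] fun _ => 1 := by
      filter_upwards [Ioi_mem_nhds ht] with s hs
      exact Real.smoothTransition.one_of_one_le (le_of_lt hs)
    rw [this.deriv_eq, deriv_const]
  obtain ⟨B, hB⟩ := (isCompact_Icc (a := (0 : ℝ)) (b := 1)).exists_bound_of_continuousOn
    (hs.continuous_deriv (by simp)).continuousOn
  have hB' : ∀ t, |deriv Real.smoothTransition t| ≤ |B| := by
    intro t
    by_cases ht : t ∈ Set.Icc (0 : ℝ) 1
    · exact (hB t ht).trans (le_abs_self B)
    · rw [Set.mem_Icc, not_and_or, not_le, not_le] at ht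
      rcases ht with ht | ht
      · rw [h0 t ht, abs_zero]; exact abs_nonneg _
      · rw [h1 t ht, abs_zero]; exact abs_nonneg _
  refine ⟨|B|, abs_nonneg _, fun δ hδ => ?_⟩
  have hd : ∀ t, deriv (fun t => Real.smoothTransition ((t - δ) / δ)) t =
      deriv Real.smoothTransition ((t - δ) / δ) / δ := by
    intro t
    have e : HasDerivAt (fun t : ℝ => (t - δ) / δ) (1 / δ) t :=
      ((hasDerivAt_id t).sub_const δ).div_const δ
    have := ((hs.differentiable (by simp) ((t - δ) / δ)).hasDerivAt.comp t e).deriv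
    simp only [Function.comp_def] at this
    rw [this]; ring
  refine ⟨fun t => Real.smoothTransition ((t - δ) / δ), hs.comp (by fun_prop),
    fun t => Real.smoothTransition.nonneg _, fun t => Real.smoothTransition.le_one _,
    fun t ht => Real.smoothTransition.zero_of_nonpos ?_,
    fun t ht => Real.smoothTransition.one_of_one_le ?_, fun t => ?_, fun t ht => ?_⟩
  · exact div_nonpos_of_nonpos_of_nonneg (by linarith) hδ.le
  · rw [le_div_iff₀ hδ]; linarith
  · rw [hd, abs_div, abs_of_pos hδ]
    exact div_le_div_of_nonneg_right (hB' _) hδ.le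
  · rw [hd]
    rcases ht with ht | ht
    · rw [h0 _ (div_neg_of_neg_of_pos (by linarith) hδ), zero_div]
    · rw [h1 _ (by rw [lt_div_iff₀ hδ]; linarith), zero_div]

section Divergence

variable {n : ℕ} {a b r ψ : EuclideanSpace ℝ (Fin n) → ℝ}

/-- The divergence of the Rellich field `a ((∇r·∇ψ) ∇ψ - |∇ψ|² ∇r / 2)`: the terms with second
derivatives of `ψ` combine to the Laplacian. -/
lemma sum_partialDeriv_rellich (ha : ContDiff ℝ ∞ a) (hr : ContDiff ℝ ∞ r)
    (hψ : ContDiff ℝ ∞ ψ) (x : EuclideanSpace ℝ (Fin n)) :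
    ∑ i, partialDeriv i (fun y => a y * ((∑ j, partialDeriv j r y * partialDeriv j ψ y) *
      partialDeriv i ψ y - 1 / 2 * (∑ j, partialDeriv j ψ y * partialDeriv j ψ y) *
      partialDeriv i r y)) x =
    ∑ i, partialDeriv i a x * ((∑ j, partialDeriv j r x * partialDeriv j ψ x) *
      partialDeriv i ψ x - 1 / 2 * (∑ j, partialDeriv j ψ x * partialDeriv j ψ x) *
      partialDeriv i r x) +
    a x * (∑ i, ∑ j, partialDeriv i (partialDeriv j r) x * partialDeriv j ψ x *
        partialDeriv i ψ x +
      (∑ j, partialDeriv j r x * partialDeriv j ψ x) *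
        ∑ i, partialDeriv i (partialDeriv i ψ) x -
      1 / 2 * (∑ j, partialDeriv j ψ x * partialDeriv j ψ x) *
        ∑ i, partialDeriv i (partialDeriv i r) x) := by
  have dr : ∀ j, Differentiable ℝ (partialDeriv j r) := fun j =>
    (ContDiff.partialDeriv_infty hr).differentiable (by simp)
  have dψ : ∀ j, Differentiable ℝ (partialDeriv j ψ) := fun j =>
    (ContDiff.partialDeriv_infty hψ).differentiable (by simp)
  have da : Differentiable ℝ a := ha.differentiable (by simp)
  have dp : Differentiable ℝ (fun y => ∑ j, partialDeriv j r y * partialDeriv j ψ y) := by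
    fun_prop
  have dM : Differentiable ℝ (fun y => ∑ j, partialDeriv j ψ y * partialDeriv j ψ y) := by
    fun_prop
  have ep : ∀ i, partialDeriv i (fun y => ∑ j, partialDeriv j r y * partialDeriv j ψ y) x =
      ∑ j, (partialDeriv i (partialDeriv j r) x * partialDeriv j ψ x +
        partialDeriv j r x * partialDeriv i (partialDeriv j ψ) x) := fun i => by
    rw [partialDeriv_sum (F := fun j y => partialDeriv j r y * partialDeriv j ψ y)
      fun j _ => ((dr j x).mul (dψ j x))]
    exact Finset.sum_congr rfl fun j _ => partialDeriv_mul (dr j x) (dψ j x)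
  have eM : ∀ i, partialDeriv i (fun y => ∑ j, partialDeriv j ψ y * partialDeriv j ψ y) x =
      ∑ j, (partialDeriv i (partialDeriv j ψ) x * partialDeriv j ψ x +
        partialDeriv j ψ x * partialDeriv i (partialDeriv j ψ) x) := fun i => by
    rw [partialDeriv_sum (F := fun j y => partialDeriv j ψ y * partialDeriv j ψ y)
      fun j _ => ((dψ j x).mul (dψ j x))]
    exact Finset.sum_congr rfl fun j _ => partialDeriv_mul (dψ j x) (dψ j x)
  set p : EuclideanSpace ℝ (Fin n) → ℝ := fun y => ∑ j, partialDeriv j r y * partialDeriv j ψ y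
    with hp
  set M : EuclideanSpace ℝ (Fin n) → ℝ := fun y => ∑ j, partialDeriv j ψ y * partialDeriv j ψ y
    with hM
  have e : ∀ i, partialDeriv i (fun y => a y * (p y * partialDeriv i ψ y - 1 / 2 * M y *
      partialDeriv i r y)) x =
      partialDeriv i a x * (p x * partialDeriv i ψ x - 1 / 2 * M x * partialDeriv i r x) +
      a x * ((∑ j, (partialDeriv i (partialDeriv j r) x * partialDeriv j ψ x +
        partialDeriv j r x * partialDeriv i (partialDeriv j ψ) x)) * partialDeriv i ψ x +
        p x * partialDeriv i (partialDeriv i ψ) x -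
        (∑ j, partialDeriv j ψ x * partialDeriv i (partialDeriv j ψ) x) * partialDeriv i r x -
        1 / 2 * M x * partialDeriv i (partialDeriv i r) x) := by
    intro i
    have d1 : DifferentiableAt ℝ (fun y => p y * partialDeriv i ψ y) x := (dp x).mul (dψ i x)
    have d2 : DifferentiableAt ℝ (fun y => 1 / 2 * M y) x := (dM x).const_mul _
    have d3 : DifferentiableAt ℝ (fun y => 1 / 2 * M y * partialDeriv i r y) x := d2.mul (dr i x)
    rw [partialDeriv_mul (g := fun y => p y * partialDeriv i ψ y - 1 / 2 * M y *
      partialDeriv i r y) (da x) (d1.sub d3), partialDeriv_sub d1 d3,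
      partialDeriv_mul (dp x) (dψ i x), partialDeriv_mul d2 (dr i x),
      partialDeriv_mul (differentiableAt_const _) (dM x), partialDeriv_const, ep, eM]
    simp only [mul_comm (partialDeriv i (partialDeriv _ ψ) x) (partialDeriv _ ψ x), ← two_mul,
      ← Finset.mul_sum]
    ring
  change ∑ i, partialDeriv i (fun y => a y * (p y * partialDeriv i ψ y - 1 / 2 * M y *
      partialDeriv i r y)) x = _
  simp_rw [e]
  have hsymm : ∑ i, (∑ j, partialDeriv j r x * partialDeriv i (partialDeriv j ψ) x) *
      partialDeriv i ψ x =
      ∑ i, (∑ j, partialDeriv j ψ x * partialDeriv i (partialDeriv j ψ) x) *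
        partialDeriv i r x := by
    simp_rw [Finset.sum_mul]
    rw [Finset.sum_comm]
    refine Finset.sum_congr rfl fun i _ => Finset.sum_congr rfl fun j _ => ?_
    rw [partialDeriv_comm (hψ.of_le two_le_infty)]; ring
  rw [Finset.sum_add_distrib, ← Finset.mul_sum]
  congr 2
  simp only [Finset.sum_sub_distrib, Finset.sum_add_distrib, add_mul, ← Finset.mul_sum,
    hsymm]
  have hs3 : ∑ i, ∑ j, partialDeriv i (partialDeriv j r) x * partialDeriv j ψ x *
      partialDeriv i ψ x = ∑ i, (∑ j, partialDeriv i (partialDeriv j r) x *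
        partialDeriv j ψ x) * partialDeriv i ψ x := by
    simp_rw [Finset.sum_mul]
  have hpx : ∑ j, partialDeriv j r x * partialDeriv j ψ x = p x := rfl
  have hMx : ∑ j, partialDeriv j ψ x * partialDeriv j ψ x = M x := rfl
  rw [hs3, hpx, hMx]
  clear_value p M
  ring

/-- The divergence of `b (D²ψ ∇ψ - Δψ ∇ψ)`: third derivatives cancel. -/
lemma sum_partialDeriv_hessian (hb : ContDiff ℝ ∞ b) (hψ : ContDiff ℝ ∞ ψ)
    (x : EuclideanSpace ℝ (Fin n)) :
    ∑ i, partialDeriv i (fun y => b y * ((∑ j, partialDeriv j ψ y *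
      partialDeriv j (partialDeriv i ψ) y) - partialDeriv i ψ y *
      ∑ j, partialDeriv j (partialDeriv j ψ) y)) x =
    ∑ i, partialDeriv i b x * ((∑ j, partialDeriv j ψ x *
      partialDeriv j (partialDeriv i ψ) x) - partialDeriv i ψ x *
      ∑ j, partialDeriv j (partialDeriv j ψ) x) +
    b x * (∑ i, ∑ j, partialDeriv i (partialDeriv j ψ) x ^ 2 -
      (∑ j, partialDeriv j (partialDeriv j ψ) x) ^ 2) := by
  have s1 : ∀ j, ContDiff ℝ ∞ (partialDeriv j ψ) := fun j => ContDiff.partialDeriv_infty hψ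
  have s2 : ∀ i j, ContDiff ℝ ∞ (partialDeriv i (partialDeriv j ψ)) := fun i j =>
    ContDiff.partialDeriv_infty (s1 j)
  have d1 : ∀ j, Differentiable ℝ (partialDeriv j ψ) := fun j => (s1 j).differentiable (by simp)
  have d2 : ∀ i j, Differentiable ℝ (partialDeriv i (partialDeriv j ψ)) := fun i j =>
    (s2 i j).differentiable (by simp)
  have db : Differentiable ℝ b := hb.differentiable (by simp)
  have e : ∀ i, partialDeriv i (fun y => b y * ((∑ j, partialDeriv j ψ y *
      partialDeriv j (partialDeriv i ψ) y) - partialDeriv i ψ y *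
      ∑ j, partialDeriv j (partialDeriv j ψ) y)) x =
      partialDeriv i b x * ((∑ j, partialDeriv j ψ x *
        partialDeriv j (partialDeriv i ψ) x) - partialDeriv i ψ x *
        ∑ j, partialDeriv j (partialDeriv j ψ) x) +
      b x * (∑ j, (partialDeriv i (partialDeriv j ψ) x * partialDeriv j (partialDeriv i ψ) x +
        partialDeriv j ψ x * partialDeriv i (partialDeriv j (partialDeriv i ψ)) x) -
        (partialDeriv i (partialDeriv i ψ) x * ∑ j, partialDeriv j (partialDeriv j ψ) x +
          partialDeriv i ψ x * ∑ j, partialDeriv i (partialDeriv j (partialDeriv j ψ)) x)) := by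
    intro i
    have f1 : ∀ j, DifferentiableAt ℝ (fun y => partialDeriv j ψ y *
        partialDeriv j (partialDeriv i ψ) y) x := fun j => (d1 j x).mul (d2 j i x)
    have f2 : DifferentiableAt ℝ (fun y => ∑ j, partialDeriv j ψ y *
        partialDeriv j (partialDeriv i ψ) y) x := DifferentiableAt.fun_sum fun j _ => f1 j
    have f3 : DifferentiableAt ℝ (fun y => ∑ j, partialDeriv j (partialDeriv j ψ) y) x :=
      DifferentiableAt.fun_sum fun j _ => d2 j j x
    have f4 := (d1 i x).fun_mul f3
    rw [partialDeriv_mul (g := fun y => (∑ j, partialDeriv j ψ y *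
      partialDeriv j (partialDeriv i ψ) y) - partialDeriv i ψ y *
      ∑ j, partialDeriv j (partialDeriv j ψ) y) (db x) (f2.fun_sub f4), partialDeriv_sub f2 f4,
      partialDeriv_mul (d1 i x) f3, partialDeriv_sum fun j _ => f1 j,
      partialDeriv_sum fun j _ => d2 j j x]
    rw [Finset.sum_congr rfl fun j _ => partialDeriv_mul (d1 j x) (d2 j i x)]
  simp_rw [e]
  rw [Finset.sum_add_distrib, ← Finset.mul_sum]
  congr 2
  have h1 : ∀ i j, partialDeriv i (partialDeriv j ψ) x * partialDeriv j (partialDeriv i ψ) x =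
      partialDeriv i (partialDeriv j ψ) x ^ 2 := fun i j => by
    rw [partialDeriv_comm (i := j) (hψ.of_le two_le_infty), sq]
  have h2 : ∑ i, ∑ j, partialDeriv j ψ x * partialDeriv i (partialDeriv j (partialDeriv i ψ)) x =
      ∑ i, partialDeriv i ψ x * ∑ j, partialDeriv i (partialDeriv j (partialDeriv j ψ)) x := by
    rw [Finset.sum_comm]
    refine Finset.sum_congr rfl fun i _ => ?_
    rw [Finset.mul_sum]
    refine Finset.sum_congr rfl fun j _ => ?_
    rw [partialDeriv_comm ((s1 j).of_le two_le_infty)]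
  simp only [Finset.sum_sub_distrib, Finset.sum_add_distrib, h1, h2, ← Finset.sum_mul]
  ring

end Divergence

/-! The next lemmas are the pointwise inequalities behind the Rellich estimate; `y`, `s` and `R`
stand for `∇ψ`, `∇r` and `D²r` at a point. -/

section Pointwise

variable {n : ℕ}

lemma sum_mul_sq_le (s y : Fin n → ℝ) :
    (∑ j, s j * y j) ^ 2 ≤ (∑ j, s j ^ 2) * ∑ j, y j * y j := by
  have := Finset.sum_mul_sq_le_sq_mul_sq Finset.univ s y
  simpa only [sq (y _)] using this

lemma sum_sq_le_of_abs_le {L : ℝ} {s : Fin n → ℝ} (hs : ∀ i, |s i| ≤ L) :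
    ∑ i, s i ^ 2 ≤ n * L ^ 2 := by
  have : ∑ i, s i ^ 2 ≤ ∑ _i : Fin n, L ^ 2 := Finset.sum_le_sum fun i _ =>
    sq_le_sq' (abs_le.1 (hs i)).1 (abs_le.1 (hs i)).2
  simpa using this

lemma abs_sum_le_of_abs_le {L : ℝ} {s : Fin n → ℝ} (hs : ∀ i, |s i| ≤ L) :
    |∑ i, s i| ≤ n * L := by
  have : ∑ i, |s i| ≤ ∑ _i : Fin n, L := Finset.sum_le_sum fun i _ => hs i
  refine (Finset.abs_sum_le_sum_abs _ _).trans ?_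
  simpa using this

lemma abs_quadratic_le {L : ℝ} (hL : 0 ≤ L) {R : Fin n → Fin n → ℝ} (hR : ∀ i j, |R i j| ≤ L)
    (y : Fin n → ℝ) : |∑ i, ∑ j, R i j * y j * y i| ≤ n * L * ∑ j, y j * y j := by
  calc |∑ i, ∑ j, R i j * y j * y i| ≤ ∑ i, ∑ j, L * (|y j| * |y i|) := by
        refine (Finset.abs_sum_le_sum_abs _ _).trans (Finset.sum_le_sum fun i _ => ?_)
        refine (Finset.abs_sum_le_sum_abs _ _).trans (Finset.sum_le_sum fun j _ => ?_)
        rw [abs_mul, abs_mul, mul_assoc]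
        exact mul_le_mul_of_nonneg_right (hR i j) (by positivity)
    _ = L * (∑ j, |y j|) ^ 2 := by
        rw [sq, Finset.sum_mul_sum, Finset.mul_sum, Finset.sum_comm]
        simp_rw [Finset.mul_sum]
    _ ≤ L * (n * ∑ j, y j * y j) := by
        gcongr
        have := sq_sum_le_card_mul_sum_sq (s := (Finset.univ : Finset (Fin n)))
          (f := fun j => |y j|)
        simpa [sq] using this
    _ = _ := by ring

set_option maxHeartbeats 1000000 in
/-- The weight `t ↦ t (t / (t + ε))²` of the Rellich identity has derivative
`(t / (t + ε))² (t + 3ε) / (t + ε)`, whose second factor lies in `[1, 3]`; this makes the quadratic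
form of the identity coercive. -/
lemma rellich_pointwise {c L t ε χ χ' ψ lψ : ℝ} {s y : Fin n → ℝ} {R : Fin n → Fin n → ℝ}
    (hc : 0 < c) (hL : 0 < L) (ht : 0 < t) (hε : 0 < ε) (hχ0 : 0 ≤ χ) (hχ1 : χ ≤ 1)
    (hlow : c ≤ ∑ i, s i ^ 2 + t ^ 2) (hs : ∀ i, |s i| ≤ L) (hR : ∀ i j, |R i j| ≤ L) :
    c / 4 * (χ * (t / (t + ε)) ^ 2) * ∑ j, y j * y j ≤
      -((χ * ((t / (t + ε)) ^ 2 * ((t + 3 * ε) / (t + ε))) + t * (t / (t + ε)) ^ 2 * χ') *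
          ((∑ j, s j * y j) ^ 2 - 1 / 2 * (∑ j, y j * y j) * ∑ i, s i ^ 2) +
        t * (χ * (t / (t + ε)) ^ 2) * (∑ i, ∑ j, R i j * y j * y i +
          (∑ j, s j * y j) * lψ - 1 / 2 * (∑ j, y j * y j) * ∑ i, R i i)) +
      n * L ^ 2 * (t * (t / (t + ε)) ^ 2 * |χ'|) * ∑ j, y j * y j +
      (8 * n * L ^ 2 / c + 8 * n ^ 3 * L ^ 4 / c + 9 * n ^ 2 * L ^ 2 / c + 1) *
        ((t * lψ + 2 * (∑ j, s j * y j) + ψ * ∑ i, R i i) ^ 2 + ψ ^ 2 +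
          t ^ 2 * ∑ j, y j * y j) := by
  have hp := sum_mul_sq_le s y
  have hS := sum_sq_le_of_abs_le hs
  have hT := abs_sum_le_of_abs_le fun i => hR i i
  have hQ := abs_quadratic_le hL.le hR y
  have hS0 : 0 ≤ ∑ i, s i ^ 2 := Finset.sum_nonneg fun i _ => sq_nonneg _
  have hM0 : 0 ≤ ∑ j, y j * y j := Finset.sum_nonneg fun i _ => mul_self_nonneg _
  set S := ∑ i, s i ^ 2
  set M := ∑ j, y j * y j
  set p := ∑ j, s j * y j
  set T := ∑ i, R i i
  set Q := ∑ i, ∑ j, R i j * y j * y i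
  clear_value S M p T Q
  set w := (t / (t + ε)) ^ 2 with hw
  set σ := (t + 3 * ε) / (t + ε) with hσ
  have hw0 : 0 ≤ w := sq_nonneg _
  have hw1 : w ≤ 1 := by
    have : t / (t + ε) ≤ 1 := by rw [div_le_one (by positivity)]; linarith
    exact pow_le_one₀ (by positivity) this
  have hσ1 : 1 ≤ σ := by rw [hσ, le_div_iff₀ (by positivity)]; linarith
  have hσ3 : σ ≤ 3 := by rw [hσ, div_le_iff₀ (by positivity)]; linarith
  clear_value w σ
  set wt := χ * w with hwt
  have hwt0 : 0 ≤ wt := mul_nonneg hχ0 hw0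
  have hwt1 : wt ≤ 1 := mul_le_one₀ hχ1 hw0 hw1
  set H := t * lψ + 2 * p + ψ * T with hH
  clear_value wt H
  have hpM : p ^ 2 ≤ n * L ^ 2 * M := by
    refine hp.trans ?_; gcongr
  -- The factor `σ ∈ [1, 3]` of the derivative of the weight makes the quadratic form coercive: for
  -- `σ > 2` the negative coefficient of `p²` is compensated by `p² ≤ S M`.
  have k1 : 1 / 2 * (M * S) ≤ (2 - σ) * p ^ 2 + σ / 2 * (M * S) := by
    rw [mul_comm S M] at hp
    have hp0 := sq_nonneg p
    rcases le_total σ 2 with h2 | h2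
    · nlinarith [mul_nonneg (sub_nonneg.2 h2) hp0, mul_nonneg hM0 hS0]
    · nlinarith [mul_nonneg (sub_nonneg.2 h2) (sub_nonneg.2 hp), mul_nonneg hM0 hS0]
  have k2 : wt * (c / 2 * M) ≤ wt * (1 / 2 * (M * S)) + 1 / 2 * (t ^ 2 * M) := by
    have h1 : c * M ≤ (S + t ^ 2) * M := by gcongr
    have h2 : wt * (t ^ 2 * M) ≤ 1 * (t ^ 2 * M) := by gcongr
    nlinarith
  -- The terms with the derivative of the cutoff are only bounded in absolute value.
  have k3 : t * w * χ' * (p ^ 2 - 1 / 2 * (M * S)) ≤ n * L ^ 2 * (t * w * |χ'|) * M := by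
    have h1 : |p ^ 2 - 1 / 2 * (M * S)| ≤ n * L ^ 2 * M := by
      rw [mul_comm S M] at hp
      have h3 : M * S ≤ n * L ^ 2 * M := by nlinarith
      have := sq_nonneg p
      have := mul_nonneg hM0 hS0
      rw [abs_le]; constructor <;> linarith
    calc t * w * χ' * (p ^ 2 - 1 / 2 * (M * S)) ≤ |t * w * χ' * (p ^ 2 - 1 / 2 * (M * S))| :=
          le_abs_self _
      _ = t * w * |χ'| * |p ^ 2 - 1 / 2 * (M * S)| := by
          rw [abs_mul, abs_mul, abs_of_nonneg (mul_nonneg ht.le hw0)]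
      _ ≤ t * w * |χ'| * (n * L ^ 2 * M) := by gcongr
      _ = _ := by ring
  -- The equation replaces `t Δψ` by `H - 2p - ψ T`; its contribution and that of `D²r` are absorbed
  -- by Young's inequality.
  have hn0 : (0 : ℝ) ≤ n := Nat.cast_nonneg n
  have k4 : wt * (p * (H - ψ * T)) ≤ wt * (c / 16 * M) +
      (8 * n * L ^ 2 / c * H ^ 2 + 8 * n ^ 3 * L ^ 4 / c * ψ ^ 2) := by
    have hT2 : T ^ 2 ≤ (n * L) ^ 2 := sq_le_sq' (abs_le.1 hT).1 (abs_le.1 hT).2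
    have hX : (H - ψ * T) ^ 2 ≤ 2 * H ^ 2 + 2 * (n * L) ^ 2 * ψ ^ 2 := by
      have h5 : (ψ * T) ^ 2 ≤ (n * L) ^ 2 * ψ ^ 2 := by
        rw [mul_pow, mul_comm]; gcongr
      nlinarith [sq_nonneg (H + ψ * T)]
    rcases Nat.eq_zero_or_pos n with hn | hn
    · have : p = 0 := by
        have h6 : p ^ 2 ≤ 0 := by simpa [hn] using hpM
        exact pow_eq_zero_iff (two_ne_zero) |>.1 (le_antisymm h6 (sq_nonneg _))
      rw [this]; simp only [zero_mul, mul_zero]; positivity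
    · have hn1 : (0 : ℝ) < n := by exact_mod_cast hn
      have e1 : p * (H - ψ * T) ≤ c / (16 * n * L ^ 2) * p ^ 2 +
          4 * n * L ^ 2 / c * (H - ψ * T) ^ 2 := by
        have h7 : c / (16 * n * L ^ 2) * p ^ 2 + 4 * n * L ^ 2 / c * (H - ψ * T) ^ 2 -
            p * (H - ψ * T) = (c * p - 8 * n * L ^ 2 * (H - ψ * T)) ^ 2 /
              (16 * n * L ^ 2 * c) := by field_simp; ring
        have h8 : 0 ≤ (c * p - 8 * n * L ^ 2 * (H - ψ * T)) ^ 2 / (16 * n * L ^ 2 * c) := by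
          positivity
        linarith
      have e2 : c / (16 * n * L ^ 2) * p ^ 2 ≤ c / 16 * M := by
        calc c / (16 * n * L ^ 2) * p ^ 2 ≤ c / (16 * n * L ^ 2) * (n * L ^ 2 * M) := by gcongr
          _ = _ := by field_simp
      have e3 : 4 * n * L ^ 2 / c * (H - ψ * T) ^ 2 ≤
          8 * n * L ^ 2 / c * H ^ 2 + 8 * n ^ 3 * L ^ 4 / c * ψ ^ 2 := by
        calc 4 * n * L ^ 2 / c * (H - ψ * T) ^ 2 ≤
              4 * n * L ^ 2 / c * (2 * H ^ 2 + 2 * (n * L) ^ 2 * ψ ^ 2) := by gcongr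
          _ = _ := by ring
      calc wt * (p * (H - ψ * T)) ≤ wt * (c / 16 * M +
            (8 * n * L ^ 2 / c * H ^ 2 + 8 * n ^ 3 * L ^ 4 / c * ψ ^ 2)) := by
            gcongr; linarith
        _ = wt * (c / 16 * M) + wt * (8 * n * L ^ 2 / c * H ^ 2 + 8 * n ^ 3 * L ^ 4 / c * ψ ^ 2) := by
            ring
        _ ≤ wt * (c / 16 * M) + 1 * (8 * n * L ^ 2 / c * H ^ 2 + 8 * n ^ 3 * L ^ 4 / c * ψ ^ 2) := by
            gcongr
        _ = _ := by ring
  have k5 : wt * (t * (Q - 1 / 2 * (M * T))) ≤ wt * (c / 16 * M) +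
      9 * n ^ 2 * L ^ 2 / c * (t ^ 2 * M) := by
    have h1 : Q - 1 / 2 * (M * T) ≤ 3 / 2 * (n * L) * M := by
      have h2 := (abs_le.1 hQ).2
      have h3 : -(M * T) ≤ M * (n * L) := by
        have := mul_le_mul_of_nonneg_left (neg_le.1 (abs_le.1 hT).1) hM0
        linarith
      nlinarith
    have h4 : 3 / 2 * (n * L) * t ≤ c / 16 + 9 * n ^ 2 * L ^ 2 / c * t ^ 2 := by
      have h7 : c / 16 + 9 * n ^ 2 * L ^ 2 / c * t ^ 2 - 3 / 2 * (n * L) * t =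
          (c - 12 * n * L * t) ^ 2 / (16 * c) := by field_simp; ring
      have h8 : 0 ≤ (c - 12 * n * L * t) ^ 2 / (16 * c) := by positivity
      linarith
    calc wt * (t * (Q - 1 / 2 * (M * T))) ≤ wt * (t * (3 / 2 * (n * L) * M)) := by gcongr
      _ = wt * ((3 / 2 * (n * L) * t) * M) := by ring
      _ ≤ wt * ((c / 16 + 9 * n ^ 2 * L ^ 2 / c * t ^ 2) * M) := by gcongr
      _ = wt * (c / 16 * M) + wt * (9 * n ^ 2 * L ^ 2 / c * (t ^ 2 * M)) := by ring
      _ ≤ wt * (c / 16 * M) + 1 * (9 * n ^ 2 * L ^ 2 / c * (t ^ 2 * M)) := by gcongr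
      _ = _ := by ring
  have k1' := mul_le_mul_of_nonneg_left k1 hwt0
  have hexp : (χ * (w * σ) + t * w * χ') * (p ^ 2 - 1 / 2 * M * S) +
      t * wt * (Q + p * lψ - 1 / 2 * M * T) =
      -(wt * ((2 - σ) * p ^ 2 + σ / 2 * (M * S))) + t * w * χ' * (p ^ 2 - 1 / 2 * (M * S)) +
      wt * (p * (H - ψ * T)) + wt * (t * (Q - 1 / 2 * (M * T))) := by
    rw [hH, hwt]; ring
  rw [hexp]
  have r1 : 0 ≤ (8 * n * L ^ 2 / c + 9 * n ^ 2 * L ^ 2 / c + 1) * ψ ^ 2 := by positivity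
  have r2 : 0 ≤ (8 * n ^ 3 * L ^ 4 / c + 9 * n ^ 2 * L ^ 2 / c + 1) * H ^ 2 := by positivity
  have r3 : 0 ≤ (8 * n * L ^ 2 / c + 8 * n ^ 3 * L ^ 4 / c + 1 / 2) * (t ^ 2 * M) := by positivity
  have r4 : 0 ≤ wt * (c / 8 * M) := by positivity
  nlinarith

/-- The pointwise inequality behind the estimate of second derivatives; `A` is the Hessian of `ψ`
and `e` the gradient of the cutoff `η`. -/
lemma hessian_pointwise {η : ℝ} {e y : Fin n → ℝ} {A : Fin n → Fin n → ℝ} :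
    1 / 2 * (η ^ 2 * ∑ i, ∑ j, A j i ^ 2) ≤
      (∑ i, 2 * η * e i * (∑ j, y j * A j i - y i * ∑ j, A j j) +
        η ^ 2 * (∑ i, ∑ j, A j i ^ 2 - (∑ j, A j j) ^ 2)) +
      (1 + n) * (η * ∑ j, A j j) ^ 2 + 3 * (∑ i, e i ^ 2) * ∑ j, y j * y j := by
  set T := ∑ j, A j j
  have h1 : ∀ i j, -(1 / 2 * (η ^ 2 * A j i ^ 2) + 2 * (e i ^ 2 * (y j * y j))) ≤
      2 * η * e i * (y j * A j i) := fun i j => by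
    nlinarith [sq_nonneg (η * A j i + 2 * (e i * y j))]
  have h2 : ∀ i, 2 * η * e i * (y i * T) ≤ (η * T) ^ 2 + e i ^ 2 * (y i * y i) := fun i => by
    nlinarith [sq_nonneg (η * T - e i * y i)]
  have h3 : ∀ i, e i ^ 2 * (y i * y i) ≤ e i ^ 2 * ∑ j, y j * y j := fun i => by
    gcongr
    exact Finset.single_le_sum (f := fun j => y j * y j) (fun j _ => mul_self_nonneg _)
      (Finset.mem_univ i)
  have key : ∀ i, -(1 / 2 * (η ^ 2 * ∑ j, A j i ^ 2)) - 3 * (e i ^ 2 * ∑ j, y j * y j) -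
      (η * T) ^ 2 ≤ 2 * η * e i * (∑ j, y j * A j i - y i * T) := by
    intro i
    have := Finset.sum_le_sum fun j (_ : j ∈ Finset.univ) => h1 i j
    simp only [Finset.sum_neg_distrib, Finset.sum_add_distrib, ← Finset.mul_sum] at this
    have a1 := h2 i
    have a2 := h3 i
    nlinarith
  have := Finset.sum_le_sum fun i (_ : i ∈ Finset.univ) => key i
  simp only [Finset.sum_sub_distrib, Finset.sum_neg_distrib, ← Finset.mul_sum,
    ← Finset.sum_mul, Finset.sum_const, Finset.card_univ, Fintype.card_fin,
    nsmul_eq_mul] at this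
  linarith

end Pointwise

/-! ### Integrated Rellich estimates -/

section RellichIntegral

variable {n : ℕ} {Ω : Set (EuclideanSpace ℝ (Fin n))} {ρ r Φ : EuclideanSpace ℝ (Fin n) → ℝ}
  {c L δ ε : ℝ}

lemma setIntegral_divergence_eq_zero {F : Fin n → EuclideanSpace ℝ (Fin n) → ℝ}
    {D : Set (EuclideanSpace ℝ (Fin n))} (hD : IsCompact D) (hF : ∀ i, ContDiff ℝ 1 (F i))
    (h0 : ∀ i, ∀ x ∉ D, F i x = 0) :
    IntegrableOn (fun x => ∑ i, partialDeriv i (F i) x) D ∧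
      ∫ x in D, ∑ i, partialDeriv i (F i) x = 0 := by
  have hs : ∀ i, tsupport (F i) ⊆ D := fun i => closure_minimal
    (fun x hx => by by_contra h; exact hx (h0 i x h)) hD.isClosed
  have hc : ∀ i, Continuous (partialDeriv i (F i)) := fun i =>
    (contDiff_partialDeriv (m := 0) (hF i) (by norm_num)).continuous
  have hi : ∀ i, IntegrableOn (partialDeriv i (F i)) D := fun i =>
    (hc i).continuousOn.integrableOn_compact hD
  refine ⟨integrable_finsetSum _ fun i _ => hi i, ?_⟩
  rw [integral_finsetSum _ fun i _ => hi i]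
  refine Finset.sum_eq_zero fun i _ => ?_
  rw [setIntegral_eq_integral_of_forall_compl_eq_zero]
  · exact integral_partialDeriv_eq_zero (hF i) (hD.of_isClosed_subset (isClosed_tsupport _) (hs i))
  · intro x hx
    exact image_eq_zero_of_notMem_tsupport fun h =>
      hx (hs i (tsupport_partialDeriv_subset h))

/-- The energy density that controls the second derivatives of `Φ`. -/
noncomputable def energyDensity (r Φ : EuclideanSpace ℝ (Fin n) → ℝ)
    (x : EuclideanSpace ℝ (Fin n)) : ℝ :=
  (∑ i, partialDeriv i (partialDeriv i Φ) x) ^ 2 + (Φ x / r x) ^ 2 + ∑ i, partialDeriv i Φ x ^ 2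

lemma energyDensity_nonneg (x : EuclideanSpace ℝ (Fin n)) : 0 ≤ energyDensity r Φ x :=
  add_nonneg (add_nonneg (sq_nonneg _) (sq_nonneg _)) (Finset.sum_nonneg fun _ _ => sq_nonneg _)

lemma continuous_energyDensity (hr : ContDiff ℝ ∞ r) (hpos : ∀ x, 0 < r x)
    (hΦ : ContDiff ℝ ∞ Φ) : Continuous (energyDensity r Φ) := by
  have h1 : ∀ i, ContDiff ℝ ∞ (partialDeriv i Φ) := fun i => ContDiff.partialDeriv_infty hΦ
  have h2 : ∀ i, Continuous (partialDeriv i Φ) := fun i => (h1 i).continuous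
  have h3 : ∀ i, Continuous (partialDeriv i (partialDeriv i Φ)) := fun i =>
    (ContDiff.partialDeriv_infty (h1 i)).continuous
  have h4 : Continuous fun x => Φ x / r x := hΦ.continuous.div hr.continuous fun x => (hpos x).ne'
  unfold energyDensity
  fun_prop

section Product

variable {ψ : EuclideanSpace ℝ (Fin n) → ℝ}

lemma partialDeriv_mul_infty (hr : ContDiff ℝ ∞ r) (hψ : ContDiff ℝ ∞ ψ) (i : Fin n)
    (x : EuclideanSpace ℝ (Fin n)) :
    partialDeriv i (fun y => r y * ψ y) x =
      partialDeriv i r x * ψ x + r x * partialDeriv i ψ x :=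
  partialDeriv_mul (hr.differentiable (by simp) x) (hψ.differentiable (by simp) x)

lemma partialDeriv_partialDeriv_mul (hr : ContDiff ℝ ∞ r) (hψ : ContDiff ℝ ∞ ψ) (i j : Fin n)
    (x : EuclideanSpace ℝ (Fin n)) :
    partialDeriv i (partialDeriv j (fun y => r y * ψ y)) x =
      partialDeriv i (partialDeriv j r) x * ψ x + partialDeriv j r x * partialDeriv i ψ x +
      (partialDeriv i r x * partialDeriv j ψ x + r x * partialDeriv i (partialDeriv j ψ) x) := by
  have h1 := ContDiff.partialDeriv_infty hr (i := j)
  have h2 := ContDiff.partialDeriv_infty hψ (i := j)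
  rw [show partialDeriv j (fun y => r y * ψ y) = fun x =>
    partialDeriv j r x * ψ x + r x * partialDeriv j ψ x from
      funext (partialDeriv_mul_infty hr hψ j),
    partialDeriv_add ((h1.mul hψ).differentiable (by simp) x)
      ((hr.mul h2).differentiable (by simp) x),
    partialDeriv_mul_infty h1 hψ, partialDeriv_mul_infty hr h2]

end Product

/-- A bound for `t |∇ψ|` in terms of `∇(rψ) = ψ ∇r + t ∇ψ` at a point where `r = t`. -/
lemma mul_sq_sum_le {L t ψ : ℝ} {s y : Fin n → ℝ} (hs : ∀ i, |s i| ≤ L) :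
    t ^ 2 * ∑ j, y j * y j ≤ 2 * ∑ i, (s i * ψ + t * y i) ^ 2 + 2 * n * L ^ 2 * ψ ^ 2 := by
  have h1 : ∀ i, t ^ 2 * (y i * y i) ≤ 2 * (s i * ψ + t * y i) ^ 2 + 2 * ψ ^ 2 * s i ^ 2 :=
    fun i => by nlinarith [sq_nonneg (2 * (s i * ψ) + t * y i)]
  have h2 := Finset.sum_le_sum fun i (_ : i ∈ Finset.univ) => h1 i
  rw [Finset.sum_add_distrib, ← Finset.mul_sum, ← Finset.mul_sum, ← Finset.mul_sum] at h2
  have h3 := mul_le_mul_of_nonneg_left (sum_sq_le_of_abs_le hs)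
    (by positivity : (0 : ℝ) ≤ 2 * ψ ^ 2)
  nlinarith

set_option maxHeartbeats 1000000 in
/-- A bound for the gradient of `Φ / r` up to the boundary, from integrating the Rellich field
`τ(r) ((∇r·∇ψ) ∇ψ - |∇ψ|² ∇r / 2)`, `ψ = Φ / r`. -/
lemma IsDefining.rellich_estimate (h : IsDefining Ω ρ c L) :
    ∃ K : ℝ, 0 ≤ K ∧ ∀ δ ε : ℝ, 0 < δ → 2 * δ ≤ ε → ∀ r, IsRegularized Ω ρ r δ →
      ∀ ψ, ContDiff ℝ ∞ ψ →
      ∫ x in {x | ε ≤ r x}, ∑ j, partialDeriv j ψ x * partialDeriv j ψ x ≤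
        K * ((∫ x in {x | δ ≤ r x}, energyDensity r (fun y => r y * ψ y) x) +
          (ε ^ 2)⁻¹ * ∫ x in {x | δ ≤ r x ∧ r x ≤ 2 * δ},
            energyDensity r (fun y => r y * ψ y) x) := by
  obtain ⟨B, hB, hcut⟩ := exists_cutoff
  have hc := h.c_pos
  have hL := h.L_pos
  set N : ℝ := 2 + 2 * n * L ^ 2 with hN
  set K₁ : ℝ := 8 * n * L ^ 2 / c + 8 * n ^ 3 * L ^ 4 / c + 9 * n ^ 2 * L ^ 2 / c + 1 with hK₁
  have hN0 : 0 ≤ N := by positivity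
  have hK₁0 : 0 ≤ K₁ := by positivity
  refine ⟨16 / c * (n * L ^ 2 * (2 * B) * N + K₁ * (1 + N)), by positivity,
    fun δ ε hδ hε r hr ψ hψ => ?_⟩
  obtain ⟨χ, hχs, hχ0, hχ1, hχz, hχo, hχd, hχdz⟩ := hcut δ hδ
  have hε0 : 0 < ε := by linarith
  set e := energyDensity r (fun y => r y * ψ y) with he
  set D := {x | δ ≤ r x} with hD
  have hDc : IsCompact D := hr.isCompact
  have hrc := hr.contDiff.continuous
  have hE : IsClosed {x | ε ≤ r x} := isClosed_le continuous_const hrc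
  have hED : {x | ε ≤ r x} ⊆ D := fun x (hx : ε ≤ r x) => show δ ≤ r x by linarith
  set D' := {x | δ ≤ r x ∧ r x ≤ 2 * δ} with hD'
  have hD'm : IsClosed {x | r x ≤ 2 * δ} := isClosed_le hrc continuous_const
  have hD'D : D' = D ∩ {x | r x ≤ 2 * δ} := rfl
  have hec : Continuous e := continuous_energyDensity hr.contDiff hr.pos (hr.contDiff.mul hψ)
  have he0 : ∀ x, 0 ≤ e x := energyDensity_nonneg
  have hrr : ∀ x, r x + ε ≠ 0 := fun x => (add_pos (hr.pos x) hε0).ne'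
  set M := fun x => ∑ j, partialDeriv j ψ x * partialDeriv j ψ x with hM
  have hM0 : ∀ x, 0 ≤ M x := fun x => Finset.sum_nonneg fun j _ => mul_self_nonneg _
  have hψ1 : ∀ j, ContDiff ℝ ∞ (partialDeriv j ψ) := fun j => ContDiff.partialDeriv_infty hψ
  have hr1 : ∀ j, ContDiff ℝ ∞ (partialDeriv j r) := fun j =>
    ContDiff.partialDeriv_infty hr.contDiff
  have hMs : ContDiff ℝ ∞ M := ContDiff.sum fun j _ => (hψ1 j).mul (hψ1 j)
  set τ : ℝ → ℝ := fun t => t * (χ t * (t / (t + ε)) ^ 2) with hτ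
  set a : EuclideanSpace ℝ (Fin n) → ℝ := fun x => r x * (χ (r x) * (r x / (r x + ε)) ^ 2) with ha
  have has : ContDiff ℝ ∞ a := hr.contDiff.mul ((hχs.comp hr.contDiff).mul
    ((hr.contDiff.div (hr.contDiff.add contDiff_const) hrr).pow 2))
  have hτd : ∀ t, 0 < t → HasDerivAt τ (χ t * ((t / (t + ε)) ^ 2 * ((t + 3 * ε) / (t + ε))) +
      t * (t / (t + ε)) ^ 2 * deriv χ t) t := by
    intro t ht
    have ht' : t + ε ≠ 0 := by positivity
    have h1 := (hχs.differentiable (by simp) t).hasDerivAt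
    have h2 := ((hasDerivAt_id t).div ((hasDerivAt_id t).add_const ε) ht').pow 2
    have h3 := (hasDerivAt_id t).mul (h1.mul h2)
    refine h3.congr_deriv ?_
    simp only [id, Pi.mul_apply, Pi.pow_apply, Pi.div_apply]
    field_simp
    push_cast
    field_simp
    ring
  have hda : ∀ i x, partialDeriv i a x = (χ (r x) * ((r x / (r x + ε)) ^ 2 *
      ((r x + 3 * ε) / (r x + ε))) + r x * (r x / (r x + ε)) ^ 2 * deriv χ (r x)) *
      partialDeriv i r x := fun i x => by
    have := hτd (r x) (hr.pos x)
    rw [← this.deriv]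
    exact partialDeriv_comp this.differentiableAt (hr.contDiff.differentiable (by simp) x)
  set F : Fin n → EuclideanSpace ℝ (Fin n) → ℝ := fun i y => a y *
    ((∑ j, partialDeriv j r y * partialDeriv j ψ y) * partialDeriv i ψ y -
      1 / 2 * (∑ j, partialDeriv j ψ y * partialDeriv j ψ y) * partialDeriv i r y) with hF
  have hFs : ∀ i, ContDiff ℝ 1 (F i) := fun i => by
    refine ContDiff.of_le (n := ∞) ?_ (by simp)
    exact has.mul (((ContDiff.sum fun j _ => (hr1 j).mul (hψ1 j)).mul (hψ1 i)).sub
      ((contDiff_const.mul hMs).mul (hr1 i)))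
  obtain ⟨hFi, hF0⟩ := setIntegral_divergence_eq_zero hDc hFs fun i x hx => by
    have : a x = 0 := by
      simp only [ha, hχz (r x) (le_of_lt (not_le.1 hx)), zero_mul, mul_zero]
    simp only [hF, this, zero_mul]
  have htM : ∀ x ∈ D, r x ^ 2 * M x ≤ N * e x := fun x hx => by
    have h1 := mul_sq_sum_le (t := r x) (ψ := ψ x) (y := fun j => partialDeriv j ψ x)
      fun i => hr.bound₁ h hx i
    simp only [← partialDeriv_mul_infty hr.contDiff hψ] at h1
    refine h1.trans ?_
    have h2 : r x * ψ x / r x = ψ x := by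
      rw [mul_comm, mul_div_assoc, div_self (hr.pos x).ne', mul_one]
    have h3 : 0 ≤ ∑ i, partialDeriv i (fun y => r y * ψ y) x ^ 2 :=
      Finset.sum_nonneg fun _ _ => sq_nonneg _
    simp only [he, energyDensity, h2]
    rw [hN]
    nlinarith [sq_nonneg (∑ i, partialDeriv i (partialDeriv i (fun y => r y * ψ y)) x),
      sq_nonneg (ψ x), (by positivity : 0 ≤ 2 * (n : ℝ) * L ^ 2)]
  -- The cutoff derivative lives in the layer `δ ≤ r ≤ 2δ`, where the weight is at most `r² / ε²`.
  have key : ∀ x ∈ D, c / 16 * ({x | ε ≤ r x}.indicator M x) ≤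
      -∑ i, partialDeriv i (F i) x + n * L ^ 2 * (2 * B) * N * (ε ^ 2)⁻¹ *
        ({x | r x ≤ 2 * δ}.indicator e x) + K₁ * (1 + N) * e x := by
    intro x hx
    have ht := hr.pos x
    have h1 := rellich_pointwise (χ' := deriv χ (r x)) (ψ := ψ x)
      (lψ := ∑ i, partialDeriv i (partialDeriv i ψ) x) (s := fun i => partialDeriv i r x)
      (y := fun i => partialDeriv i ψ x) (R := fun i j => partialDeriv i (partialDeriv j r) x)
      hc hL ht hε0 (hχ0 (r x)) (hχ1 (r x)) (hr.lower h hx) (fun i => hr.bound₁ h hx i)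
      (fun i j => hr.bound₂ h hx i j)
    have h2 : ∑ i, partialDeriv i (F i) x =
        (χ (r x) * ((r x / (r x + ε)) ^ 2 * ((r x + 3 * ε) / (r x + ε))) +
          r x * (r x / (r x + ε)) ^ 2 * deriv χ (r x)) *
          ((∑ j, partialDeriv j r x * partialDeriv j ψ x) ^ 2 -
            1 / 2 * (∑ j, partialDeriv j ψ x * partialDeriv j ψ x) *
              ∑ i, partialDeriv i r x ^ 2) +
        r x * (χ (r x) * (r x / (r x + ε)) ^ 2) *
          (∑ i, ∑ j, partialDeriv i (partialDeriv j r) x * partialDeriv j ψ x *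
            partialDeriv i ψ x + (∑ j, partialDeriv j r x * partialDeriv j ψ x) *
            ∑ i, partialDeriv i (partialDeriv i ψ) x -
            1 / 2 * (∑ j, partialDeriv j ψ x * partialDeriv j ψ x) *
              ∑ i, partialDeriv i (partialDeriv i r) x) := by
      rw [hF, sum_partialDeriv_rellich has hr.contDiff hψ]
      congr 1
      simp only [hda]
      simp only [mul_assoc, ← Finset.mul_sum]
      congr 1
      simp only [mul_sub, Finset.sum_sub_distrib]
      rw [sq, Finset.mul_sum]
      congr 1
      · exact Finset.sum_congr rfl fun i _ => by ring
      · simp only [Finset.mul_sum]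
        exact Finset.sum_congr rfl fun i _ => by ring
    rw [← h2] at h1
    have hH : r x * (∑ i, partialDeriv i (partialDeriv i ψ) x) +
        2 * (∑ j, partialDeriv j r x * partialDeriv j ψ x) +
        ψ x * ∑ i, partialDeriv i (partialDeriv i r) x =
        ∑ i, partialDeriv i (partialDeriv i (fun y => r y * ψ y)) x := by
      simp only [partialDeriv_partialDeriv_mul hr.contDiff hψ, Finset.mul_sum,
        ← Finset.sum_add_distrib]
      exact Finset.sum_congr rfl fun i _ => by ring
    have h3 : (r x * (∑ i, partialDeriv i (partialDeriv i ψ) x) +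
        2 * (∑ j, partialDeriv j r x * partialDeriv j ψ x) +
        ψ x * ∑ i, partialDeriv i (partialDeriv i r) x) ^ 2 + ψ x ^ 2 ≤ e x := by
      have h5 : r x * ψ x / r x = ψ x := by
        rw [mul_comm, mul_div_assoc, div_self (hr.pos x).ne', mul_one]
      have h6 : 0 ≤ ∑ i, partialDeriv i (fun y => r y * ψ y) x ^ 2 :=
        Finset.sum_nonneg fun _ _ => sq_nonneg _
      rw [hH]
      simp only [he, energyDensity, h5]
      linarith
    have h4 : (r x * (r x / (r x + ε)) ^ 2 * |deriv χ (r x)|) * M x ≤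
        2 * B * N * (ε ^ 2)⁻¹ * ({x | r x ≤ 2 * δ}.indicator e x) := by
      by_cases hx2 : r x ≤ 2 * δ
      · rw [Set.indicator_of_mem (by exact hx2)]
        have g1 : (r x / (r x + ε)) ^ 2 ≤ r x ^ 2 * (ε ^ 2)⁻¹ := by
          rw [← div_eq_mul_inv, ← div_pow]
          gcongr
          linarith
        have g2 : r x * |deriv χ (r x)| ≤ 2 * B := by
          calc r x * |deriv χ (r x)| ≤ (2 * δ) * (B / δ) := by gcongr; exact hχd _
            _ = 2 * B := by field_simp
        calc (r x * (r x / (r x + ε)) ^ 2 * |deriv χ (r x)|) * M x =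
              (r x * |deriv χ (r x)|) * ((r x / (r x + ε)) ^ 2 * M x) := by ring
          _ ≤ (2 * B) * ((r x ^ 2 * (ε ^ 2)⁻¹) * M x) := by
              have := hM0 x
              gcongr
          _ = (2 * B) * (ε ^ 2)⁻¹ * (r x ^ 2 * M x) := by ring
          _ ≤ (2 * B) * (ε ^ 2)⁻¹ * (N * e x) :=
              mul_le_mul_of_nonneg_left (htM x hx) (by positivity)
          _ = _ := by ring
      · rw [hχdz _ (Or.inr (not_le.1 hx2)), abs_zero, mul_zero, zero_mul]
        exact mul_nonneg (by positivity) (Set.indicator_nonneg (fun y _ => he0 y) x)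
    have h5 : c / 16 * ({x | ε ≤ r x}.indicator M x) ≤
        c / 4 * (χ (r x) * (r x / (r x + ε)) ^ 2) * M x := by
      by_cases hx2 : ε ≤ r x
      · rw [Set.indicator_of_mem (by exact hx2), hχo _ (by linarith), one_mul]
        have g1 : 1 / 2 ≤ r x / (r x + ε) := by
          rw [div_le_div_iff₀ two_pos (by positivity)]; linarith
        have g2 : (1 / 2) ^ 2 ≤ (r x / (r x + ε)) ^ 2 := by gcongr
        refine mul_le_mul_of_nonneg_right ?_ (hM0 x)
        nlinarith
      · rw [Set.indicator_of_notMem (by exact hx2), mul_zero]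
        exact mul_nonneg (mul_nonneg (by positivity) (mul_nonneg (hχ0 _) (sq_nonneg _))) (hM0 x)
    have h6 := htM x hx
    have h7 := mul_le_mul_of_nonneg_left h4 (by positivity : (0 : ℝ) ≤ n * L ^ 2)
    have h8 : K₁ * ((r x * (∑ i, partialDeriv i (partialDeriv i ψ) x) +
        2 * (∑ j, partialDeriv j r x * partialDeriv j ψ x) +
        ψ x * ∑ i, partialDeriv i (partialDeriv i r) x) ^ 2 + ψ x ^ 2 + r x ^ 2 * M x) ≤
        K₁ * (e x + N * e x) := by gcongr
    refine h5.trans (h1.trans ?_)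
    linarith
  have hMc : Continuous M := hMs.continuous
  have i1 : IntegrableOn (fun x => c / 16 * ({x | ε ≤ r x}.indicator M x)) D :=
    ((hMc.continuousOn.integrableOn_compact hDc).indicator hE.measurableSet).const_mul _
  have i2 : IntegrableOn e D := hec.continuousOn.integrableOn_compact hDc
  have i3 : IntegrableOn (fun x => n * L ^ 2 * (2 * B) * N * (ε ^ 2)⁻¹ *
        ({x | r x ≤ 2 * δ}.indicator e x)) D :=
    (i2.indicator hD'm.measurableSet).const_mul _
  have i4 : IntegrableOn (fun x => K₁ * (1 + N) * e x) D := i2.const_mul _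
  have hint := setIntegral_mono_on i1 ((hFi.neg.add i3).add i4) hDc.measurableSet key
  have hsplit := integral_add (hFi.neg.add i3) i4
  rw [integral_add' hFi.neg i3, integral_neg', hF0, integral_const_mul,
    setIntegral_indicator hD'm.measurableSet, ← hD'D, integral_const_mul] at hsplit
  replace hint := hint.trans_eq hsplit
  rw [integral_const_mul, setIntegral_indicator hE.measurableSet, Set.inter_eq_right.2 hED]
    at hint
  have j1 : 0 ≤ ∫ x in D, e x := integral_nonneg he0
  have j2 : 0 ≤ ∫ x in D', e x := integral_nonneg he0
  have j3 : ∫ x in {x | ε ≤ r x}, M x ≤ 16 / c * (n * L ^ 2 * (2 * B) * N * (ε ^ 2)⁻¹ *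
      (∫ x in D', e x) + K₁ * (1 + N) * ∫ x in D, e x) := by
    rw [div_mul_eq_mul_div, le_div_iff₀ hc]
    linarith
  refine j3.trans ?_
  have j4 : 0 ≤ (ε ^ 2)⁻¹ * ∫ x in D', e x := by positivity
  rw [mul_assoc (16 / c)]
  refine mul_le_mul_of_nonneg_left ?_ (by positivity)
  have a1 : 0 ≤ n * L ^ 2 * (2 * B) * N := by positivity
  have a2 : 0 ≤ K₁ * (1 + N) := by positivity
  have b1 := mul_nonneg a1 j1
  have b2 := mul_nonneg a2 j4
  generalize n * L ^ 2 * (2 * B) * N = A₁ at *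
  generalize K₁ * (1 + N) = A₂ at *
  linarith

set_option maxHeartbeats 1000000 in
/-- Second derivatives of `Φ` up to the boundary are controlled by `ΔΦ`, `∇Φ` and `Φ / r`; the
term with `ε⁻²` is an error from the cutoff in the layer `{δ ≤ r ≤ 2δ}`. -/
lemma IsDefining.hessian_estimate (h : IsDefining Ω ρ c L) :
    ∃ K : ℝ, 0 ≤ K ∧ ∀ δ ε : ℝ, 0 < δ → 2 * δ ≤ ε → ∀ r, IsRegularized Ω ρ r δ →
      ∀ Φ, ContDiff ℝ ∞ Φ → ∀ i j,
      ∫ x in {x | 2 * ε ≤ r x}, partialDeriv i (partialDeriv j Φ) x ^ 2 ≤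
        K * ((∫ x in {x | δ ≤ r x}, energyDensity r Φ x) +
          (ε ^ 2)⁻¹ * ∫ x in {x | δ ≤ r x ∧ r x ≤ 2 * δ}, energyDensity r Φ x) := by
  obtain ⟨B, hB, hcut⟩ := exists_cutoff
  obtain ⟨K₀, hK₀, hrel⟩ := h.rellich_estimate
  have hL := h.L_pos
  set Ka : ℝ := 8 * ((1 + n) * 3 * (1 + n ^ 2 * L ^ 2)) + 4 * L ^ 2 with hKa
  set Kb : ℝ := 8 * ((1 + n) * 12 * (n * L ^ 2) + 3 * ((1 + 2 * B) ^ 2 * (n * L ^ 2))) +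
    8 * L ^ 2 with hKb
  have hKa0 : 0 ≤ Ka := by positivity
  have hKb0 : 0 ≤ Kb := by positivity
  refine ⟨Ka + Kb * K₀, by positivity, fun δ ε hδ hε r hr Φ hΦ i₀ j₀ => ?_⟩
  set ψ := fun x => Φ x / r x with hψdef
  have hψ : ContDiff ℝ ∞ ψ := hΦ.div hr.contDiff fun x => (hr.pos x).ne'
  have hΦψ : Φ = fun y => r y * ψ y := funext fun y => (mul_div_cancel₀ _ (hr.pos y).ne').symm
  have hgrad := hrel δ ε hδ hε r hr ψ hψ
  rw [← hΦψ] at hgrad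
  have hε0 : 0 < ε := by linarith
  obtain ⟨χ, hχs, hχ0, hχ1, hχz, hχo, hχd, hχdz⟩ := hcut ε hε0
  set e := energyDensity r Φ with he
  have hrc := hr.contDiff.continuous
  have hDc : IsCompact {x | δ ≤ r x} := hr.isCompact
  set D := {x | ε ≤ r x} with hD
  have hsub : D ⊆ {x | δ ≤ r x} := fun x (hx : ε ≤ r x) => show δ ≤ r x by linarith
  have hEc : IsCompact D := hDc.of_isClosed_subset (isClosed_le continuous_const hrc) hsub
  have hG : IsClosed {x | 2 * ε ≤ r x} := isClosed_le continuous_const hrc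
  have hGD : {x | 2 * ε ≤ r x} ⊆ D := fun x (hx : 2 * ε ≤ r x) => show ε ≤ r x by linarith
  have hec : Continuous e := continuous_energyDensity hr.contDiff hr.pos hΦ
  have he0 : ∀ x, 0 ≤ e x := energyDensity_nonneg
  have hψ1 : ∀ j, ContDiff ℝ ∞ (partialDeriv j ψ) := fun j => ContDiff.partialDeriv_infty hψ
  have hψ2 : ∀ i j, ContDiff ℝ ∞ (partialDeriv i (partialDeriv j ψ)) := fun i j =>
    ContDiff.partialDeriv_infty (hψ1 j)
  set M := fun x => ∑ j, partialDeriv j ψ x * partialDeriv j ψ x with hM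
  have hM0 : ∀ x, 0 ≤ M x := fun x => Finset.sum_nonneg fun j _ => mul_self_nonneg _
  have hMc : Continuous M := continuous_finsetSum _ fun j _ =>
    (hψ1 j).continuous.mul (hψ1 j).continuous
  set η : EuclideanSpace ℝ (Fin n) → ℝ := fun x => r x * χ (r x) with hη
  have hηs : ContDiff ℝ ∞ η := hr.contDiff.mul (hχs.comp hr.contDiff)
  have hηd : ∀ i x, partialDeriv i η x = (χ (r x) + r x * deriv χ (r x)) * partialDeriv i r x := by
    intro i x
    have hrd := hr.contDiff.differentiable (by simp) x
    rw [hη, partialDeriv_mul (g := fun y => χ (r y)) hrd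
        ((hχs.comp hr.contDiff).differentiable (by simp) x), partialDeriv_comp (hχs.differentiable (by simp) _) hrd]
    ring
  set F : Fin n → EuclideanSpace ℝ (Fin n) → ℝ := fun i y => η y * η y *
    ((∑ j, partialDeriv j ψ y * partialDeriv j (partialDeriv i ψ) y) - partialDeriv i ψ y *
      ∑ j, partialDeriv j (partialDeriv j ψ) y) with hF
  have hFs : ∀ i, ContDiff ℝ 1 (F i) := fun i => by
    refine ContDiff.of_le (n := ∞) ?_ (by simp)
    exact (hηs.mul hηs).mul ((ContDiff.sum fun j _ => (hψ1 j).mul (hψ2 j i)).sub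
      ((hψ1 i).mul (ContDiff.sum fun j _ => hψ2 j j)))
  obtain ⟨hFi, hF0⟩ := setIntegral_divergence_eq_zero hEc hFs fun i x hx => by
    have : η x = 0 := by
      simp only [hη, hχz (r x) (le_of_lt (not_le.1 hx)), mul_zero]
    simp only [hF, this, zero_mul]
  have hψe : ∀ x, ψ x ^ 2 ≤ e x := fun x => by
    have h6 : 0 ≤ ∑ i, partialDeriv i Φ x ^ 2 := Finset.sum_nonneg fun _ _ => sq_nonneg _
    simp only [he, energyDensity, hψdef]
    linarith [sq_nonneg (∑ i, partialDeriv i (partialDeriv i Φ) x)]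
  have hΔe : ∀ x, (∑ i, partialDeriv i (partialDeriv i Φ) x) ^ 2 ≤ e x := fun x => by
    have h6 : 0 ≤ ∑ i, partialDeriv i Φ x ^ 2 := Finset.sum_nonneg fun _ _ => sq_nonneg _
    simp only [he, energyDensity]
    linarith [sq_nonneg (Φ x / r x)]
  have key : ∀ x ∈ D, {x | 2 * ε ≤ r x}.indicator
      (fun x => partialDeriv i₀ (partialDeriv j₀ Φ) x ^ 2) x ≤
      8 * ∑ i, partialDeriv i (F i) x + (Ka * e x + Kb * M x) := by
    intro x hxD
    have hx : δ ≤ r x := hsub hxD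
    have hpos := hr.pos x
    have hs := fun i => hr.bound₁ h hx i
    have h1 := hessian_pointwise (η := η x) (e := fun i => partialDeriv i η x)
      (y := fun i => partialDeriv i ψ x) (A := fun i j => partialDeriv i (partialDeriv j ψ) x)
    have h2 : ∑ i, partialDeriv i (F i) x =
        (∑ i, 2 * η x * partialDeriv i η x * (∑ j, partialDeriv j ψ x *
          partialDeriv j (partialDeriv i ψ) x - partialDeriv i ψ x *
            ∑ j, partialDeriv j (partialDeriv j ψ) x)) +
        η x ^ 2 * (∑ i, ∑ j, partialDeriv j (partialDeriv i ψ) x ^ 2 -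
          (∑ j, partialDeriv j (partialDeriv j ψ) x) ^ 2) := by
      rw [hF, sum_partialDeriv_hessian (hηs.mul hηs) hψ, sq (η x)]
      congr 1
      · refine Finset.sum_congr rfl fun i _ => ?_
        rw [partialDeriv_mul_infty hηs hηs]
        ring
      · rw [Finset.sum_comm]
    rw [← h2] at h1
    -- `η = r χ(r)`, and `|r χ'(r)| ≤ 2B` uniformly in `ε`.
    have h3 : ∑ i, partialDeriv i η x ^ 2 ≤ (1 + 2 * B) ^ 2 * (n * L ^ 2) := by
      have g1 : |χ (r x) + r x * deriv χ (r x)| ≤ 1 + 2 * B := by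
        refine (abs_add_le _ _).trans (add_le_add ?_ ?_)
        · rw [abs_of_nonneg (hχ0 _)]; exact hχ1 _
        · by_cases hx2 : r x ≤ 2 * ε
          · rw [abs_mul, abs_of_pos hpos]
            calc r x * |deriv χ (r x)| ≤ (2 * ε) * (B / ε) := by gcongr; exact hχd _
              _ = 2 * B := by field_simp
          · rw [hχdz _ (Or.inr (not_le.1 hx2)), mul_zero, abs_zero]; positivity
      have g2 : (χ (r x) + r x * deriv χ (r x)) ^ 2 ≤ (1 + 2 * B) ^ 2 :=
        sq_le_sq' (abs_le.1 g1).1 (abs_le.1 g1).2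
      simp only [hηd, mul_pow, ← Finset.mul_sum]
      have := sum_sq_le_of_abs_le hs
      gcongr
    -- `r Δψ` is expressed through `ΔΦ` and first derivatives of `ψ`.
    have h4 : (η x * ∑ j, partialDeriv j (partialDeriv j ψ) x) ^ 2 ≤
        3 * (1 + n ^ 2 * L ^ 2) * e x + 12 * (n * L ^ 2) * M x := by
      have hp := sum_mul_sq_le (fun i => partialDeriv i r x) (fun i => partialDeriv i ψ x)
      have hS := sum_sq_le_of_abs_le hs
      have hT := abs_sum_le_of_abs_le fun i => hr.bound₂ h hx i i
      have g1 : r x * (∑ i, partialDeriv i (partialDeriv i ψ) x) =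
          (∑ i, partialDeriv i (partialDeriv i Φ) x) -
          2 * (∑ j, partialDeriv j r x * partialDeriv j ψ x) -
          ψ x * ∑ i, partialDeriv i (partialDeriv i r) x := by
        rw [hΦψ]
        simp only [partialDeriv_partialDeriv_mul hr.contDiff hψ, Finset.mul_sum,
          ← Finset.sum_sub_distrib]
        exact Finset.sum_congr rfl fun i _ => by ring
      have g2 : (η x * ∑ j, partialDeriv j (partialDeriv j ψ) x) ^ 2 ≤
          (r x * (∑ i, partialDeriv i (partialDeriv i ψ) x)) ^ 2 := by
        rw [show η x = χ (r x) * r x from mul_comm _ _, mul_assoc, mul_pow]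
        exact mul_le_of_le_one_left (sq_nonneg _) (pow_le_one₀ (hχ0 _) (hχ1 _))
      have g3 := hψe x
      have g4 := hΔe x
      have hM0x := hM0 x
      change _ ≤ _ * M x at hp
      refine g2.trans ?_
      rw [g1]
      generalize (∑ i, partialDeriv i (partialDeriv i Φ) x) = H at *
      generalize (∑ j, partialDeriv j r x * partialDeriv j ψ x) = p at *
      generalize (∑ i, partialDeriv i (partialDeriv i r) x) = T at *
      generalize ψ x = z at *
      have g5 : (H - 2 * p - z * T) ^ 2 ≤ 3 * (H ^ 2 + 4 * p ^ 2 + z ^ 2 * T ^ 2) := by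
        nlinarith [sq_nonneg (H + 2 * p), sq_nonneg (H + z * T), sq_nonneg (2 * p - z * T)]
      have g6 : T ^ 2 ≤ (n * L) ^ 2 := sq_le_sq' (abs_le.1 hT).1 (abs_le.1 hT).2
      have g7 : z ^ 2 * T ^ 2 ≤ e x * (n * L) ^ 2 := by
        have := he0 x
        gcongr
      have g8 : p ^ 2 ≤ n * L ^ 2 * M x := hp.trans (by gcongr)
      linarith
    have h5 : {x | 2 * ε ≤ r x}.indicator
        (fun x => partialDeriv i₀ (partialDeriv j₀ Φ) x ^ 2) x ≤
        4 * (η x ^ 2 * ∑ i, ∑ j, partialDeriv j (partialDeriv i ψ) x ^ 2) + 8 * L ^ 2 * M x +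
          4 * L ^ 2 * e x := by
      have hA0 : 0 ≤ ∑ i, ∑ j, partialDeriv j (partialDeriv i ψ) x ^ 2 :=
        Finset.sum_nonneg fun _ _ => Finset.sum_nonneg fun _ _ => sq_nonneg _
      by_cases hx2 : 2 * ε ≤ r x
      · rw [Set.indicator_of_mem (by exact hx2)]
        have g0 : η x = r x := by rw [hη]; simp only [hχo _ hx2, mul_one]
        have g1 : partialDeriv i₀ (partialDeriv j₀ ψ) x ^ 2 ≤
            ∑ i, ∑ j, partialDeriv j (partialDeriv i ψ) x ^ 2 :=
          (Finset.single_le_sum (f := fun j => partialDeriv j (partialDeriv j₀ ψ) x ^ 2)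
            (fun _ _ => sq_nonneg _) (Finset.mem_univ i₀)).trans
          (Finset.single_le_sum (f := fun i => ∑ j, partialDeriv j (partialDeriv i ψ) x ^ 2)
            (fun _ _ => Finset.sum_nonneg fun _ _ => sq_nonneg _) (Finset.mem_univ j₀))
        have g2 : ∀ k, partialDeriv k ψ x ^ 2 ≤ M x := fun k => by
          rw [sq]
          exact Finset.single_le_sum (f := fun j => partialDeriv j ψ x * partialDeriv j ψ x)
            (fun _ _ => mul_self_nonneg _) (Finset.mem_univ k)
        have g3 := hψe x
        have g4 : ∀ {z L : ℝ}, |z| ≤ L → z ^ 2 ≤ L ^ 2 := fun hz =>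
          sq_le_sq' (abs_le.1 hz).1 (abs_le.1 hz).2
        have g5 := g4 (hs i₀)
        have g6 := g4 (hs j₀)
        have g7 := g4 (hr.bound₂ h hx i₀ j₀)
        have gi := g2 i₀
        have gj := g2 j₀
        have hM0x := hM0 x
        have he0x := he0 x
        rw [g0, hΦψ, partialDeriv_partialDeriv_mul hr.contDiff hψ]
        generalize partialDeriv i₀ (partialDeriv j₀ r) x = a₁ at *
        generalize partialDeriv i₀ r x = a₂ at *
        generalize partialDeriv j₀ r x = a₃ at *
        generalize partialDeriv i₀ ψ x = b₂ at *
        generalize partialDeriv j₀ ψ x = b₃ at *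
        generalize partialDeriv i₀ (partialDeriv j₀ ψ) x = b₄ at *
        generalize ψ x = z at *
        have k1 : a₁ ^ 2 * z ^ 2 ≤ L ^ 2 * e x := by gcongr
        have k2 : a₃ ^ 2 * b₂ ^ 2 ≤ L ^ 2 * M x := by gcongr
        have k3 : a₂ ^ 2 * b₃ ^ 2 ≤ L ^ 2 * M x := by gcongr
        have k4 := mul_le_mul_of_nonneg_left g1 (sq_nonneg (r x))
        have k5 : (a₁ * z + a₃ * b₂ + (a₂ * b₃ + r x * b₄)) ^ 2 ≤
            4 * (a₁ ^ 2 * z ^ 2 + a₃ ^ 2 * b₂ ^ 2 + a₂ ^ 2 * b₃ ^ 2 + r x ^ 2 * b₄ ^ 2) := by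
          nlinarith [sq_nonneg (a₁ * z - a₃ * b₂), sq_nonneg (a₁ * z - a₂ * b₃),
            sq_nonneg (a₁ * z - r x * b₄), sq_nonneg (a₃ * b₂ - a₂ * b₃),
            sq_nonneg (a₃ * b₂ - r x * b₄), sq_nonneg (a₂ * b₃ - r x * b₄)]
        linarith
      · rw [Set.indicator_of_notMem (by exact hx2)]
        have := hM0 x
        have := he0 x
        positivity
    have h6 := mul_le_mul_of_nonneg_right h3 (hM0 x)
    have h7 := mul_le_mul_of_nonneg_left h4 (by positivity : (0 : ℝ) ≤ 1 + n)
    have hMx : ∑ j, partialDeriv j ψ x * partialDeriv j ψ x = M x := rfl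
    rw [hMx] at h1
    rw [hKa, hKb]
    linarith
  have i1 : IntegrableOn ({x | 2 * ε ≤ r x}.indicator
      (fun x => partialDeriv i₀ (partialDeriv j₀ Φ) x ^ 2)) D :=
    (Continuous.continuousOn (((ContDiff.partialDeriv_infty
      (ContDiff.partialDeriv_infty hΦ)).continuous).pow 2)
      |>.integrableOn_compact hEc).indicator hG.measurableSet
  have i2 : IntegrableOn (fun x => Ka * e x) D :=
    (hec.continuousOn.integrableOn_compact hEc).const_mul _
  have i3 : IntegrableOn (fun x => Kb * M x) D :=
    (hMc.continuousOn.integrableOn_compact hEc).const_mul _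
  have hint := setIntegral_mono_on i1 ((hFi.const_mul 8).add (i2.add i3)) hEc.measurableSet key
  have hsplit := integral_add (hFi.const_mul 8) (i2.add i3)
  rw [integral_const_mul, hF0, integral_add' i2 i3, integral_const_mul, integral_const_mul]
    at hsplit
  replace hint := hint.trans_eq hsplit
  rw [setIntegral_indicator hG.measurableSet, Set.inter_eq_right.2 hGD] at hint
  have j1 : ∫ x in D, e x ≤ ∫ x in {x | δ ≤ r x}, e x :=
    setIntegral_mono_set (hec.continuousOn.integrableOn_compact hDc)
      (Eventually.of_forall he0) hsub.eventuallyLE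
  have j2 : 0 ≤ ∫ x in {x | δ ≤ r x ∧ r x ≤ 2 * δ}, e x := integral_nonneg he0
  have j4 : 0 ≤ (ε ^ 2)⁻¹ * ∫ x in {x | δ ≤ r x ∧ r x ≤ 2 * δ}, e x := by positivity
  have j5 := mul_le_mul_of_nonneg_left j1 hKa0
  have j6 := mul_le_mul_of_nonneg_left hgrad hKb0
  have j7 := mul_nonneg hKa0 j4
  linarith

end RellichIntegral

/-! ### `H²` regularity up to the boundary -/

section Regularity

variable {n : ℕ} {Ω : Set (EuclideanSpace ℝ (Fin n))} {ρ φ h : EuclideanSpace ℝ (Fin n) → ℝ}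
  {g : Fin n → EuclideanSpace ℝ (Fin n) → ℝ} {c L : ℝ}

lemma integral_mul_indicator (hΩ : MeasurableSet Ω) (a f : EuclideanSpace ℝ (Fin n) → ℝ) :
    ∫ y, a y * Ω.indicator f y = ∫ y in Ω, f y * a y := by
  rw [← integral_indicator hΩ]
  congr 1
  ext y
  by_cases hy : y ∈ Ω <;> simp [hy, mul_comm]

lemma MemLp.indicator_restrict (hΩ : MeasurableSet Ω) {f : EuclideanSpace ℝ (Fin n) → ℝ}
    (hf : MemLp f 2 (volume.restrict Ω)) : MemLp (Ω.indicator f) 2 :=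
  (memLp_indicator_iff_restrict hΩ).2 hf

lemma kernel_comp_sub (k : ℕ) (x : EuclideanSpace ℝ (Fin n)) :
    ContDiff ℝ ∞ (fun y => kernel n k (x - y)) ∧ HasCompactSupport (fun y => kernel n k (x - y)) ∧
      tsupport (fun y => kernel n k (x - y)) ⊆ Metric.closedBall x (1 / (k + 1)) := by
  have h0 : ∀ y ∉ Metric.closedBall x (1 / ((k : ℝ) + 1)), kernel n k (x - y) = 0 := by
    intro y hy
    refine image_eq_zero_of_notMem_tsupport fun h => hy ?_
    rw [tsupport_kernel, mem_closedBall_zero_iff] at h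
    rwa [Metric.mem_closedBall, dist_comm, dist_eq_norm]
  refine ⟨(kernel_contDiff k).comp (contDiff_const.sub contDiff_id),
    HasCompactSupport.intro (isCompact_closedBall x _) h0,
    closure_minimal (fun y hy => ?_) Metric.isClosed_closedBall⟩
  by_contra h
  exact hy (h0 y h)

/-- Mollification commutes with the gradient on all of `ℝⁿ`, since elements of `H¹₀(Ω)` may be
extended by zero. -/
lemma IsH10.partialDeriv_mollify (hΩ : MeasurableSet Ω) (hφ : IsH10 Ω φ g) (k : ℕ) (i : Fin n) :
    partialDeriv i (mollify k (Ω.indicator φ)) = mollify k (Ω.indicator (g i)) := by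
  ext x
  obtain ⟨h1, h2, -⟩ := kernel_comp_sub (n := n) k x
  rw [NavierBiharmonic.partialDeriv_mollify
    ((MemLp.indicator_restrict hΩ hφ.1).locallyIntegrable (by norm_num)), mollify_eq,
    integral_mul_indicator hΩ, integral_mul_indicator hΩ]
  have := hφ.integral_partialDeriv h1 h2 i
  simp only [partialDeriv_comp_const_sub ((kernel_contDiff (n := n) k).differentiable (by simp)),
    mul_neg, integral_neg, neg_inj] at this
  exact this

/-- The mollification of a solution solves the mollified equation away from the boundary. -/
lemma IsDirichlet.sum_partialDeriv_mollify (hΩ : MeasurableSet Ω) (H : IsDirichlet Ω h φ g)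
    {k : ℕ} {x : EuclideanSpace ℝ (Fin n)} (hx : Metric.closedBall x (1 / ((k : ℝ) + 1)) ⊆ Ω) :
    ∑ i, partialDeriv i (mollify k (Ω.indicator (g i))) x = -mollify k (Ω.indicator h) x := by
  obtain ⟨h1, h2, h3⟩ := kernel_comp_sub (n := n) k x
  have := H.2.2 _ ⟨h1, h2, h3.trans hx⟩
  simp only [partialDeriv_comp_const_sub ((kernel_contDiff (n := n) k).differentiable (by simp)),
    mul_neg, integral_neg, Finset.sum_neg_distrib] at this
  rw [mollify_eq, integral_mul_indicator hΩ, ← this, neg_neg]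
  refine Finset.sum_congr rfl fun i _ => ?_
  rw [NavierBiharmonic.partialDeriv_mollify
    ((MemLp.indicator_restrict hΩ (H.1.2.1 i)).locallyIntegrable (by norm_num)),
    integral_mul_indicator hΩ]

/-- Mollification converges in `L²` on subsets of `Ω`, also with a bounded weight `w`. -/
lemma tendsto_setIntegral_mollify (hΩ : MeasurableSet Ω) {f w : EuclideanSpace ℝ (Fin n) → ℝ}
    (hf : MemLp f 2 (volume.restrict Ω)) {S : Set (EuclideanSpace ℝ (Fin n))}
    (hS : MeasurableSet S) (hSΩ : S ⊆ Ω) (hw : Measurable w) {C : ℝ} (hC : ∀ x ∈ S, |w x| ≤ C) :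
    Tendsto (fun k => ∫ x in S, (w x * mollify k (Ω.indicator f) x) ^ 2) atTop
      (𝓝 (∫ x in S, (w x * f x) ^ 2)) ∧ (∀ k, IntegrableOn (fun x =>
        (w x * mollify k (Ω.indicator f) x) ^ 2) S) ∧
      IntegrableOn (fun x => (w x * f x) ^ 2) S := by
  have hf' := MemLp.indicator_restrict hΩ hf
  have hb : ∀ {u : EuclideanSpace ℝ (Fin n) → ℝ}, ∀ᵐ x ∂(volume.restrict S),
      ‖w x * u x‖ ≤ C * ‖u x‖ := fun {u} => by
    filter_upwards [ae_restrict_mem hS] with x hx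
    rw [norm_mul]
    exact mul_le_mul_of_nonneg_right (hC x hx) (norm_nonneg _)
  have hm : ∀ k, MemLp (fun x => w x * mollify k (Ω.indicator f) x) 2 (volume.restrict S) :=
    fun k => ((mollify_memLp hf').restrict S).of_le_mul
      (hw.aestronglyMeasurable.mul ((mollify_memLp hf').1.restrict)) hb
  have hm' : MemLp (fun x => w x * f x) 2 (volume.restrict S) :=
    (hf.mono_measure (Measure.restrict_mono hSΩ le_rfl)).of_le_mul
      (hw.aestronglyMeasurable.mul (hf.1.mono_measure (Measure.restrict_mono hSΩ le_rfl))) hb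
  have ht : Tendsto (fun k => eLpNorm (fun x => w x * mollify k (Ω.indicator f) x - w x * f x) 2
      (volume.restrict S)) atTop (𝓝 0) := by
    have h2 := ENNReal.Tendsto.const_mul (tendsto_mollify hf')
      (Or.inr (ENNReal.ofReal_ne_top (r := C)))
    rw [mul_zero] at h2
    refine tendsto_of_tendsto_of_tendsto_of_le_of_le tendsto_const_nhds h2
      (fun _ => zero_le) fun k => ?_
    refine (eLpNorm_le_mul_eLpNorm_of_ae_le_mul ?_ 2).trans (mul_le_mul_right
      (eLpNorm_mono_measure _ Measure.restrict_le_self) _)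
    filter_upwards [ae_restrict_mem hS] with x hx
    rw [← mul_sub, norm_mul, Set.indicator_of_mem (hSΩ hx)]
    exact mul_le_mul_of_nonneg_right (hC x hx) (norm_nonneg _)
  simp only [sq]
  exact ⟨tendsto_integral_mul hm hm hm' hm' ht ht, fun k => (hm k).integrable_mul (hm k),
    hm'.integrable_mul hm'⟩

/-- The energies of the mollifications converge on sets away from the boundary. -/
lemma IsDirichlet.tendsto_energyDensity (hΩ : IsOpen Ω) (H : IsDirichlet Ω h φ g)
    {r : EuclideanSpace ℝ (Fin n) → ℝ} {δ : ℝ} (hδ : 0 < δ) (hr : IsRegularized Ω ρ r δ)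
    {S : Set (EuclideanSpace ℝ (Fin n))} (hS : MeasurableSet S) (hSr : ∀ x ∈ S, δ ≤ r x) :
    Tendsto (fun k => ∫ x in S, energyDensity r (mollify k (Ω.indicator φ)) x) atTop
      (𝓝 (∫ x in S, (h x ^ 2 + (φ x / ρ x) ^ 2 + ∑ i, g i x ^ 2))) := by
  have hSΩ : S ⊆ Ω := fun x hx => (hr.subset x (hSr x hx)).1
  obtain ⟨η, hη, hηΩ⟩ := hr.isCompact.exists_cthickening_subset_open hΩ
    (fun x hx => (hr.subset x hx).1)
  have hev : ∀ᶠ k : ℕ in atTop, 1 / ((k : ℝ) + 1) ≤ η :=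
    (tendsto_one_div_add_atTop_nhds_zero_nat.eventually (ge_mem_nhds hη))
  have hm := hΩ.measurableSet
  obtain ⟨a1, a2, a3⟩ := tendsto_setIntegral_mollify (w := fun _ => 1) (C := 1) hm H.2.1 hS hSΩ
    measurable_const (by simp)
  obtain ⟨b1, b2, b3⟩ := tendsto_setIntegral_mollify (w := fun x => (r x)⁻¹) (C := δ⁻¹) hm H.1.1
    hS hSΩ (hr.contDiff.continuous.measurable.inv) (fun x hx => by
      rw [abs_of_pos (inv_pos.2 (hr.pos x))]
      exact inv_anti₀ hδ (hSr x hx))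
  have hc := fun i => tendsto_setIntegral_mollify (w := fun _ => 1) (C := 1) hm (H.1.2.1 i) hS hSΩ
    measurable_const (by simp)
  have ht := (a1.add b1).add (tendsto_finsetSum Finset.univ fun i _ => (hc i).1)
  have e2 : ∫ x in S, (h x ^ 2 + (φ x / ρ x) ^ 2 + ∑ i, g i x ^ 2) =
      (∫ x in S, (1 * h x) ^ 2) + (∫ x in S, ((r x)⁻¹ * φ x) ^ 2) +
        ∑ i, ∫ x in S, (1 * g i x) ^ 2 := by
    rw [← integral_finsetSum _ fun i _ => (hc i).2.2, ← integral_add a3 b3,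
      ← integral_add (f := fun x => (1 * h x) ^ 2 + ((r x)⁻¹ * φ x) ^ 2) (by exact a3.add b3) (integrable_finsetSum _ fun i _ => (hc i).2.2)]
    refine setIntegral_congr_fun hS fun x hx => ?_
    simp only [one_mul, (hr.subset x (hSr x hx)).2.eq_of_nhds, div_eq_inv_mul]
  rw [e2]
  refine ht.congr' ?_
  filter_upwards [hev] with k hk
  rw [← integral_finsetSum _ fun i _ => (hc i).2.1 k, ← integral_add (a2 k) (b2 k),
      ← integral_add (f := fun x => (1 * mollify k (Ω.indicator h) x) ^ 2 +
        ((r x)⁻¹ * mollify k (Ω.indicator φ) x) ^ 2) (by exact (a2 k).add (b2 k)) (integrable_finsetSum _ fun i _ => (hc i).2.1 k)]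
  refine setIntegral_congr_fun hS fun x hx => ?_
  have h1 : Metric.closedBall x (1 / ((k : ℝ) + 1)) ⊆ Ω :=
    (Metric.closedBall_subset_closedBall hk).trans
      ((Metric.closedBall_subset_cthickening (show x ∈ {x | δ ≤ r x} from hSr x hx) η).trans hηΩ)
  simp only [energyDensity, one_mul, H.1.partialDeriv_mollify hm, H.sum_partialDeriv_mollify hm h1,
    neg_sq, div_eq_inv_mul]

/-- Second derivatives of the mollifications are bounded on compact sets, uniformly in the compact
set. -/
lemma IsDirichlet.exists_hessian_bound (hΩ : IsBoundedSmoothDomain Ω) (H : IsDirichlet Ω h φ g)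
    (hd : IsDefining Ω ρ c L) : ∃ B : ℝ, ∀ ε > 0, ∃ S : Set (EuclideanSpace ℝ (Fin n)),
      IsCompact S ∧ S ⊆ Ω ∧ (∀ x ∈ Ω, 2 * ε ≤ ρ x → x ∈ S) ∧ ∀ i j, ∀ᶠ k in atTop,
      ∫ x in S, partialDeriv i (partialDeriv j (mollify k (Ω.indicator φ))) x ^ 2 ≤ B := by
  obtain ⟨K, hK, hest⟩ := hd.hessian_estimate
  set W := fun x => h x ^ 2 + (φ x / ρ x) ^ 2 + ∑ i, g i x ^ 2 with hW
  have hW0 : ∀ x, 0 ≤ W x := fun x =>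
    add_nonneg (add_nonneg (sq_nonneg _) (sq_nonneg _)) (Finset.sum_nonneg fun _ _ => sq_nonneg _)
  have hWi : IntegrableOn W Ω := by
    refine (Integrable.add ?_ ?_).add (integrable_finsetSum _ fun i _ => ?_)
    · exact H.2.1.integrable_sq
    · exact (H.1.hardy hΩ hd).integrable_sq
    · exact (H.1.2.1 i).integrable_sq
  set T : ℕ → Set (EuclideanSpace ℝ (Fin n)) := fun m => {x | x ∈ Ω ∧ ρ x ≤ 2 * (1 / ((m : ℝ) + 1))}
    with hT
  have hρc := hd.contDiff.continuous
  have hTm : ∀ m, MeasurableSet (T m) := fun m =>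
    hΩ.isOpen.measurableSet.inter (isClosed_le hρc continuous_const).measurableSet
  -- Hardy's inequality makes `W` integrable, so its integral over a thin layer is small; this pays
  -- for the factor `ε⁻²` in the estimate.
  have hlayer : Tendsto (fun m => ∫ x in T m, W x) atTop (𝓝 0) := by
    have h1 := tendsto_setIntegral_of_antitone (f := W) (μ := volume) hTm (fun m m' hm x hx =>
      ⟨hx.1, hx.2.trans (by gcongr)⟩) ⟨0, hWi.mono_set fun x hx => hx.1⟩
    have h2 : ⋂ m, T m = ∅ := by
      rw [Set.eq_empty_iff_forall_notMem]
      intro x hx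
      rw [Set.mem_iInter] at hx
      have hpos := hd.pos x (hx 0).1
      have h3 : Tendsto (fun m : ℕ => 2 * (1 / ((m : ℝ) + 1))) atTop (𝓝 (2 * 0)) :=
        tendsto_one_div_add_atTop_nhds_zero_nat.const_mul 2
      rw [mul_zero] at h3
      obtain ⟨m, hm⟩ := (h3.eventually (gt_mem_nhds hpos)).exists
      linarith [(hx m).2]
    rwa [h2, Measure.restrict_empty, integral_zero_measure] at h1
  refine ⟨K * ((∫ x in Ω, W x) + 1 + 2), fun ε hε => ?_⟩
  have hev1 : ∀ᶠ m : ℕ in atTop, 2 * (1 / ((m : ℝ) + 1)) ≤ ε := by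
    have h3 : Tendsto (fun m : ℕ => 2 * (1 / ((m : ℝ) + 1))) atTop (𝓝 (2 * 0)) :=
      tendsto_one_div_add_atTop_nhds_zero_nat.const_mul 2
    rw [mul_zero] at h3
    exact h3.eventually (ge_mem_nhds hε)
  have hev2 : ∀ᶠ m in atTop, (ε ^ 2)⁻¹ * ∫ x in T m, W x ≤ 1 := by
    have := hlayer.const_mul (ε ^ 2)⁻¹
    rw [mul_zero] at this
    exact this.eventually (ge_mem_nhds one_pos)
  obtain ⟨m, hm1, hm2⟩ := (hev1.and hev2).exists
  set δ : ℝ := 1 / ((m : ℝ) + 1) with hδdef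
  have hδ : 0 < δ := by positivity
  obtain ⟨r, hr⟩ := hd.exists_isRegularized hΩ hδ
  have hrc := hr.contDiff.continuous
  have hsub : {x | 2 * ε ≤ r x} ⊆ {x | δ ≤ r x} := fun x (hx : 2 * ε ≤ r x) =>
    show δ ≤ r x by linarith
  refine ⟨{x | 2 * ε ≤ r x}, hr.isCompact.of_isClosed_subset (isClosed_le continuous_const hrc)
    hsub, fun x hx => (hr.subset x (hsub hx)).1, fun x hx hxε => ?_, fun i j => ?_⟩
  · have := (hr.of_mem x hx (by linarith)).eq_of_nhds
    change 2 * ε ≤ r x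
    rwa [this]
  have hDm : MeasurableSet {x | δ ≤ r x} := (isClosed_le continuous_const hrc).measurableSet
  have t1 := H.tendsto_energyDensity hΩ.isOpen hδ hr hDm fun x hx => hx
  have t2 := (H.tendsto_energyDensity hΩ.isOpen hδ hr
    (hDm.inter (isClosed_le hrc continuous_const).measurableSet) fun x
      (hx : δ ≤ r x ∧ r x ≤ 2 * δ) => hx.1).const_mul (ε ^ 2)⁻¹
  have l1 : ∫ x in {x | δ ≤ r x}, W x ≤ ∫ x in Ω, W x :=
    setIntegral_mono_set hWi (Eventually.of_forall hW0)
      (LE.le.eventuallyLE fun x hx => (hr.subset x hx).1)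
  have l2 : ∫ x in {x | δ ≤ r x} ∩ {x | r x ≤ 2 * δ}, W x ≤ ∫ x in T m, W x := by
    refine setIntegral_mono_set (hWi.mono_set fun x hx => hx.1) (Eventually.of_forall hW0)
      (LE.le.eventuallyLE fun x hx => ?_)
    obtain ⟨h1, h2⟩ := hr.subset x hx.1
    refine ⟨h1, ?_⟩
    rw [← h2.eq_of_nhds]
    exact hx.2
  have l3 : (ε ^ 2)⁻¹ * ∫ x in {x | δ ≤ r x} ∩ {x | r x ≤ 2 * δ}, W x ≤ 1 :=
    (mul_le_mul_of_nonneg_left l2 (by positivity)).trans hm2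
  filter_upwards [t1.eventually (ge_mem_nhds (lt_add_of_pos_right _ one_pos)),
    t2.eventually (ge_mem_nhds (lt_add_of_pos_right _ one_pos))] with k hk1 hk2
  refine (hest δ ε hδ hm1 r hr _ (mollify_contDiff ((MemLp.indicator_restrict
    hΩ.isOpen.measurableSet H.1.1).locallyIntegrable (by norm_num))) i j).trans ?_
  refine mul_le_mul_of_nonneg_left (add_le_add (hk1.trans (by gcongr)) (hk2.trans ?_)) hK
  linarith

/-- Weak solutions of the Dirichlet problem with right-hand side in `L²(Ω)` are in `H²(Ω)`. The
uniform bounds show that `ζ ↦ ∫ gᵢ ∂ⱼζ` is bounded for the `L²` norm, and the Riesz representation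
theorem provides the second derivatives. -/
theorem IsDirichlet.memH2 (hΩ : IsBoundedSmoothDomain Ω) (H : IsDirichlet Ω h φ g) :
    MemH2 Ω φ := by
  obtain ⟨ρ, c, L, hd⟩ := hΩ.exists_isDefining
  obtain ⟨B, hB⟩ := H.exists_hessian_bound hΩ hd
  have hm := hΩ.isOpen.measurableSet
  have key : ∀ i j ζ, IsTestFunction Ω ζ → |∫ x in Ω, g i x * partialDeriv j ζ x| ≤
      √B * (eLpNorm ζ 2 (volume.restrict Ω)).toReal := by
    intro i j ζ hζ
    obtain ⟨δ, hδ, hδζ⟩ := hd.exists_le_of_isCompact hζ.2.1 hζ.2.2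
    obtain ⟨S, hSc, hSΩ, hS, hbd⟩ := hB (δ / 2) (by positivity)
    have hgi := MemLp.indicator_restrict hm (H.1.2.1 i)
    have hgs : ∀ k, ContDiff ℝ ∞ (mollify k (Ω.indicator (g i))) := fun k =>
      mollify_contDiff (hgi.locallyIntegrable (by norm_num))
    have hlim : Tendsto (fun k => ∫ x in Ω, mollify k (Ω.indicator (g i)) x * partialDeriv j ζ x)
        atTop (𝓝 (∫ x in Ω, g i x * partialDeriv j ζ x)) := by
      refine tendsto_integral_mul_const (fun k => (mollify_memLp hgi).restrict Ω) (H.1.2.1 i)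
        (hζ.pderiv.memLp 2 _) (tendsto_of_tendsto_of_tendsto_of_le_of_le tendsto_const_nhds
          (tendsto_mollify hgi) (fun _ => zero_le) fun k => ?_)
      refine le_trans (eLpNorm_congr_ae ?_).le (eLpNorm_mono_measure _ Measure.restrict_le_self)
      filter_upwards [ae_restrict_mem hm] with x hx
      rw [Set.indicator_of_mem hx]
    refine le_of_tendsto hlim.abs ?_
    filter_upwards [hbd j i] with k hk
    rw [H.1.partialDeriv_mollify hm] at hk
    have hcont : Continuous (partialDeriv j (mollify k (Ω.indicator (g i)))) :=
      (ContDiff.partialDeriv_infty (hgs k)).continuous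
    have hL : MemLp (partialDeriv j (mollify k (Ω.indicator (g i)))) 2 (volume.restrict S) :=
      (memLp_two_iff_integrable_sq hcont.aestronglyMeasurable).2
        ((hcont.pow 2).continuousOn.integrableOn_compact hSc)
    have e1 : ∫ x in Ω, mollify k (Ω.indicator (g i)) x * partialDeriv j ζ x =
        -∫ x in S, partialDeriv j (mollify k (Ω.indicator (g i))) x * ζ x := by
      rw [hζ.pderiv.setIntegral, integral_mul_partialDeriv ((hgs k).of_le (by simp))
        (hζ.1.of_le (by simp)) hζ.2.1, setIntegral_eq_integral_of_forall_compl_eq_zero]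
      intro x hx
      rw [image_eq_zero_of_notMem_tsupport fun hx' => hx (hS x (hζ.2.2 hx') ?_), mul_zero]
      linarith [hδζ x hx']
    rw [e1, abs_neg]
    refine (abs_integral_mul_le hL (hζ.memLp 2 _)).trans ?_
    rw [toReal_eLpNorm_eq_sqrt hL]
    refine mul_le_mul (Real.sqrt_le_sqrt hk) (ENNReal.toReal_mono (hζ.memLp 2 _).2.ne
      (eLpNorm_mono_measure _ (Measure.restrict_mono hSΩ le_rfl))) ENNReal.toReal_nonneg
      (Real.sqrt_nonneg _)
  have hrep : ∀ i j, ∃ m : EuclideanSpace ℝ (Fin n) → ℝ, MemLp m 2 (volume.restrict Ω) ∧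
      ∀ ζ, IsTestFunction Ω ζ → ∫ x in Ω, g i x * partialDeriv j ζ x = ∫ x in Ω, m x * ζ x := by
    intro i j
    let l : testSubmodule Ω →ₗ[ℝ] ℝ := (innerₛₗ ℝ ((H.1.2.1 i).toLp (g i))).comp (testPartial Ω j)
    have hl : ∀ θ : testSubmodule Ω, l θ = ∫ x in Ω, g i x * partialDeriv j (θ : _ → ℝ) x := by
      intro θ
      simp_rw [mul_comm (g i _)]
      rw [integral_mul_eq_inner (IsTestFunction.memLp (IsTestFunction.pderiv θ.2) 2 _) (H.1.2.1 i)]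
      rfl
    obtain ⟨m, -, hml⟩ := exists_representer (testToL2 Ω) l (√B) fun θ => by
      rw [hl, norm_testToL2]
      exact key i j θ θ.2
    refine ⟨m, Lp.memLp m, fun ζ hζ => ?_⟩
    have h1 := hml ⟨ζ, hζ⟩
    rw [hl] at h1
    rw [h1]
    have h2 := integral_mul_eq_inner (hζ.memLp 2 (volume.restrict Ω)) (Lp.memLp m)
    rw [Lp.toLp_coeFn] at h2
    simp_rw [mul_comm (m _)]
    exact h2.symm
  choose m hm2 hmw using hrep
  refine ⟨H.1.1, g, fun i j x => -m i j x, fun i => ⟨H.1.2.1 i, H.1.hasWeakPartialDeriv i⟩,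
    fun i j => ⟨(hm2 i j).neg, MemLp.locallyIntegrableOn_restrict (H.1.2.1 i),
      MemLp.locallyIntegrableOn_restrict (hm2 i j).neg, fun ζ hζ => ?_⟩⟩
  simp only [neg_mul, integral_neg, neg_neg]
  exact hmw i j ζ hζ

end Regularity

/-! ### Absorbing the negative part -/

section NegPart

variable {n : ℕ} {Ω : Set (EuclideanSpace ℝ (Fin n))} {K u : EuclideanSpace ℝ (Fin n) → ℝ}

/-- No integrability is assumed: otherwise the left-hand side is zero. -/
lemma ofReal_integral_le_lintegral_ofReal {α : Type*} [MeasurableSpace α] {μ : Measure α}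
    (f : α → ℝ) : ENNReal.ofReal (∫ x, f x ∂μ) ≤ ∫⁻ x, ENNReal.ofReal (f x) ∂μ := by
  by_cases hf : Integrable f μ
  · calc ENNReal.ofReal (∫ x, f x ∂μ) ≤ ENNReal.ofReal (∫ x, max (f x) 0 ∂μ) :=
          ENNReal.ofReal_le_ofReal (integral_mono hf hf.pos_part fun x => le_max_left _ _)
      _ = ∫⁻ x, ENNReal.ofReal (max (f x) 0) ∂μ :=
          ofReal_integral_eq_lintegral_ofReal hf.pos_part
            (Eventually.of_forall fun x => le_max_right _ _)
      _ = _ := by simp only [ENNReal.ofReal_max, ENNReal.ofReal_zero, max_zero]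
  · rw [integral_undef hf, ENNReal.ofReal_zero]; exact zero_le

/-- Testing the equation with solutions of the Dirichlet problem. -/
lemma IsNavierSolution.integral_eq (hΩ : IsBoundedSmoothDomain Ω) (hu : IsNavierSolution Ω K u) :
    ∃ v g, IsDirichlet Ω v u g ∧ ∀ h φ g', IsDirichlet Ω h φ g' →
      ∫ x in Ω, v x * h x = ∫ x in Ω, K x * |u x| ^ ((8 : ℝ) / ((n : ℝ) - 4)) * u x * φ x := by
  obtain ⟨h1, h2, Lu, h3, h4, h5⟩ := hu
  obtain ⟨g, hg⟩ := h2.exists_isH10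
  refine ⟨_, g, hg.isDirichlet h3 h4, fun h φ g' H => ?_⟩
  rw [← h5 φ _ (H.memH2 hΩ) H.1.memH10 H.hasWeakLaplacian]
  simp only [neg_mul, mul_neg]

variable (n) in
/-- The Hölder conjugate of the critical exponent `2n / (n - 4)` is `2n / (n + 4)`. -/
lemma critical_exponents (hn : 5 ≤ n) : (0 : ℝ) < 2 * n / (n - 4) ∧ (0 : ℝ) < 2 * n / (n + 4) ∧
    (1 : ℝ) < (n + 4) / (n - 4) ∧ (2 * n / (n + 4) : ℝ).HolderConjugate (2 * n / (n - 4)) ∧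
    (2 * n / (n - 4) : ℝ) = (n + 4) / (n - 4) + 1 ∧
    ((n + 4) / (n - 4) * (2 * n / (n + 4)) : ℝ) = 2 * n / (n - 4) ∧
    (8 / (n - 4) + 1 : ℝ) = (n + 4) / (n - 4) ∧
    (1 / (2 * n / (n + 4)) : ℝ) = (n + 4) / (n - 4) * (1 / (2 * n / (n - 4))) := by
  have h5 : (5 : ℝ) ≤ n := by exact_mod_cast hn
  have h4 : (0 : ℝ) < n - 4 := by linarith
  have h4' : (n : ℝ) - 4 ≠ 0 := h4.ne'
  refine ⟨by positivity, by positivity, ?_, Real.holderConjugate_iff.2 ⟨?_, ?_⟩, ?_, ?_, ?_, ?_⟩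
  · rw [one_lt_div h4]; linarith
  · rw [one_lt_div (by positivity)]; linarith
  all_goals field_simp
  all_goals ring

/-- The `L^q` norm of the double solution operator is controlled by the dual norm of the data. -/
lemma exists_dual_bound (hn : 5 ≤ n) (hΩ : IsOpen Ω) :
    ∃ C : ℝ, 0 < C ∧ ∀ h ψ w g g', IsDirichlet Ω h ψ g → IsDirichlet Ω ψ w g' →
      (∫⁻ x in Ω, ‖w x‖ₑ ^ (2 * n / (n - 4) : ℝ)) ^ (1 / (2 * n / (n - 4) : ℝ)) ≤
        ENNReal.ofReal C *
          (∫⁻ x in Ω, ‖h x‖ₑ ^ (2 * n / (n + 4) : ℝ)) ^ (1 / (2 * n / (n + 4) : ℝ)) := by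
  obtain ⟨hq0, hp0, -, hpq, -⟩ := critical_exponents n hn
  obtain ⟨C, hC, hM⟩ := exists_moser_bound hn hΩ
  refine ⟨C ^ 2 + 1, by positivity, fun h ψ w g g' H H' => ?_⟩
  have h1 := hM _ _ _ H'
  rw [eLpNorm_eq_lintegral_rpow_enorm_toReal (by simpa using hq0) ENNReal.ofReal_ne_top,
    ENNReal.toReal_ofReal hq0.le] at h1
  set s := (eLpNorm ψ 2 (volume.restrict Ω)).toReal with hs
  have hs0 : 0 ≤ s := ENNReal.toReal_nonneg
  have h2 : s ^ 2 = ∫ x in Ω, h x * w x := by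
    rw [H.symm H', ← integral_sq_eq H'.2.1]
    simp only [sq]
  set N := (∫⁻ x in Ω, ‖h x‖ₑ ^ (2 * n / (n + 4) : ℝ)) ^ (1 / (2 * n / (n + 4) : ℝ)) with hN
  set W := (∫⁻ x in Ω, ‖w x‖ₑ ^ (2 * n / (n - 4) : ℝ)) ^ (1 / (2 * n / (n - 4) : ℝ)) with hW
  have h3 : ENNReal.ofReal (s ^ 2) ≤ N * W := by
    rw [h2]
    refine (ofReal_integral_le_lintegral_ofReal _).trans ?_
    refine le_trans (lintegral_mono fun x => ?_) (ENNReal.lintegral_mul_le_Lp_mul_Lq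
      (volume.restrict Ω) hpq (f := fun x => ‖h x‖ₑ) (g := fun x => ‖w x‖ₑ)
      H.2.1.1.enorm H'.1.1.1.enorm)
    rw [Pi.mul_apply, ← enorm_mul]
    exact Real.ofReal_le_enorm _
  rcases eq_or_ne N ⊤ with hNt | hNt
  · rw [hNt, ENNReal.mul_top (by simp only [ne_eq, ENNReal.ofReal_eq_zero, not_le]; positivity)]
    exact le_top
  · rw [← ENNReal.ofReal_toReal hNt] at h3 ⊢
    set ν := N.toReal
    have hν : 0 ≤ ν := ENNReal.toReal_nonneg
    have h4 : s ^ 2 ≤ ν * (C * s) := by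
      refine (ENNReal.ofReal_le_ofReal_iff (by positivity)).1 ?_
      rw [ENNReal.ofReal_mul hν]
      exact h3.trans (by gcongr)
    have h5 : s ≤ ν * C := by
      rcases hs0.eq_or_lt with h0 | h0
      · rw [← h0]; positivity
      · refine le_of_mul_le_mul_right ?_ h0
        linarith
    rw [← ENNReal.ofReal_mul (by positivity)]
    refine h1.trans (ENNReal.ofReal_le_ofReal ?_)
    nlinarith

/-- The self-improving inequality for the negative part of a solution. -/
lemma exists_negPart_bound (hn : 5 ≤ n) (hΩ : IsBoundedSmoothDomain Ω)
    {k : ℝ} (hk : 0 < k) (hK : ∀ x ∈ Ω, 0 ≤ K x ∧ K x ≤ k) :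
    ∃ C : ℝ, 0 < C ∧ ∀ u, IsNavierSolution Ω K u →
      (∫⁻ x in Ω, ENNReal.ofReal (-u x) ^ (2 * n / (n - 4) : ℝ)) ^ (1 / (2 * n / (n - 4) : ℝ)) ≤
      ENNReal.ofReal C * ((∫⁻ x in Ω, ENNReal.ofReal (-u x) ^ (2 * n / (n - 4) : ℝ)) ^
        (1 / (2 * n / (n - 4) : ℝ))) ^ ((n + 4) / (n - 4) : ℝ) := by
  obtain ⟨hq0, hq0', hp1, hpq, hqp, hpq', h8, hinv⟩ := critical_exponents n hn
  obtain ⟨C, hC, hdual⟩ := exists_dual_bound hn hΩ.isOpen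
  refine ⟨k * C, by positivity, fun u hu => ?_⟩
  obtain ⟨v, gu, hv, hint⟩ := hu.integral_eq hΩ
  set q : ℝ := 2 * n / (n - 4) with hq
  set q' : ℝ := 2 * n / (n + 4) with hq'
  set p : ℝ := (n + 4) / (n - 4) with hp
  have hp0 : 0 < p := by linarith
  set U : EuclideanSpace ℝ (Fin n) → ENNReal := fun x => ENNReal.ofReal (-u x) with hU
  have hum : AEMeasurable u (volume.restrict Ω) := hv.1.1.1.aemeasurable
  have hUm : AEMeasurable U (volume.restrict Ω) := hum.neg.ennreal_ofReal
  have : IsFiniteMeasure (volume.restrict Ω) := ⟨by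
    rw [Measure.restrict_apply_univ]; exact hΩ.isBounded.measure_lt_top⟩
  set A := ∫⁻ x in Ω, U x ^ q with hA
  -- The negative part is truncated because the data of the Dirichlet problem must be in `L²`, and
  -- because a finite integral is needed for division.
  set T : ℕ → EuclideanSpace ℝ (Fin n) → ℝ := fun m x => min (max 0 (-u x)) m with hT
  have hT0 : ∀ m x, 0 ≤ T m x := fun m x => le_min (le_max_left _ _) (Nat.cast_nonneg m)
  have hTm : ∀ m, AEMeasurable (T m) (volume.restrict Ω) := fun m =>
    (aemeasurable_const.max hum.neg).min aemeasurable_const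
  have hTU : ∀ m x, ENNReal.ofReal (T m x) = min (U x) m := fun m x => by
    simp only [hT, hU, ENNReal.ofReal_min, ENNReal.ofReal_max, ENNReal.ofReal_zero,
      ENNReal.ofReal_natCast, zero_max]
  have key : ∀ m, (∫⁻ x in Ω, ENNReal.ofReal (T m x) ^ q) ^ (1 / q) ≤
      ENNReal.ofReal (k * C) * (A ^ (1 / q)) ^ p := by
    intro m
    set a := ∫⁻ x in Ω, ENNReal.ofReal (T m x) ^ q with ha
    set h : EuclideanSpace ℝ (Fin n) → ℝ := fun x => T m x ^ p with hh
    have hh0 : ∀ x, 0 ≤ h x := fun x => Real.rpow_nonneg (hT0 m x) p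
    have hhL : MemLp h 2 (volume.restrict Ω) := by
      refine MemLp.of_bound ((hTm m).pow_const p).aestronglyMeasurable ((m : ℝ) ^ p)
        (Eventually.of_forall fun x => ?_)
      rw [Real.norm_of_nonneg (hh0 x)]
      exact Real.rpow_le_rpow (hT0 m x) (min_le_right _ _) hp0.le
    obtain ⟨ψ, g₁, H₁⟩ := exists_isDirichlet hn hΩ.isBounded hhL
    obtain ⟨w, g₂, H₂⟩ := exists_isDirichlet hn hΩ.isBounded H₁.1.1
    have hψ0 := H₁.nonneg hn hΩ.isOpen hΩ.isBounded (Eventually.of_forall hh0)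
    have hw0 := H₂.nonneg hn hΩ.isOpen hΩ.isBounded hψ0
    have e1 : ∫ x in Ω, h x * u x = ∫ x in Ω, K x * |u x| ^ ((8 : ℝ) / ((n : ℝ) - 4)) * u x * w x :=
      (hv.symm H₁).symm.trans (hint _ _ _ H₂)
    have hafin : a ≠ ⊤ := by
      refine (lt_of_le_of_lt (lintegral_mono fun x => ENNReal.rpow_le_rpow
        (ENNReal.ofReal_le_ofReal (min_le_right _ _)) hq0.le)
        (?_ : ∫⁻ _ in Ω, ENNReal.ofReal m ^ q < ⊤)).ne
      rw [lintegral_const]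
      exact ENNReal.mul_lt_top (ENNReal.rpow_lt_top_of_nonneg hq0.le ENNReal.ofReal_ne_top)
        (measure_lt_top _ _)
    -- On the left, `u⁻ ≥ min(u⁻, m)`.
    have e2 : a ≤ ENNReal.ofReal (-∫ x in Ω, h x * u x) := by
      rw [← integral_neg, ofReal_integral_eq_lintegral_ofReal (f := fun x => -(h x * u x))]
      · refine lintegral_mono fun x => ?_
        rw [← mul_neg, ENNReal.ofReal_mul (hh0 x), hh, ← ENNReal.ofReal_rpow_of_nonneg (hT0 m x)
          hp0.le, hqp, ENNReal.rpow_add_of_nonneg _ _ hp0.le zero_le_one, ENNReal.rpow_one]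
        refine mul_le_mul_right ?_ _
        rw [hTU]
        exact min_le_left _ _
      · exact (hhL.integrable_mul hv.1.1).neg
      · refine Eventually.of_forall fun x => ?_
        change 0 ≤ -(h x * u x)
        rw [← mul_neg]
        rcases le_total (u x) 0 with h0 | h0
        · exact mul_nonneg (hh0 x) (neg_nonneg.2 h0)
        · have : h x = 0 := by
            simp only [hh, hT, max_eq_left (neg_nonpos.2 h0), min_eq_left (Nat.cast_nonneg m),
              Real.zero_rpow hp0.ne']
          rw [this, zero_mul]
    -- On the right only `u < 0` counts. If the integrand is not integrable, the integral is `0`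
    -- and the bound is trivial.
    have e3 : ENNReal.ofReal (-∫ x in Ω, h x * u x) ≤
        ENNReal.ofReal k * ∫⁻ x in Ω, U x ^ p * ‖w x‖ₑ := by
      rw [e1, ← integral_neg, ← lintegral_const_mul' _ _ ENNReal.ofReal_ne_top]
      refine (ofReal_integral_le_lintegral_ofReal _).trans (lintegral_mono_ae ?_)
      filter_upwards [hw0, ae_restrict_mem hΩ.isOpen.measurableSet] with x hwx hxΩ
      obtain ⟨k0, k1⟩ := hK x hxΩ
      rcases le_total 0 (u x) with h0 | h0
      · rw [ENNReal.ofReal_of_nonpos]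
        · exact zero_le
        · have := Real.rpow_nonneg (abs_nonneg (u x)) ((8 : ℝ) / ((n : ℝ) - 4))
          have : 0 ≤ K x * |u x| ^ ((8 : ℝ) / ((n : ℝ) - 4)) * u x * w x := by positivity
          linarith
      · have h1 : -(K x * |u x| ^ ((8 : ℝ) / ((n : ℝ) - 4)) * u x * w x) =
            K x * ((-u x) ^ p * w x) := by
          rcases h0.eq_or_lt with h0 | h0
          · rw [h0, neg_zero, Real.zero_rpow hp0.ne']; ring
          · rw [abs_of_neg h0, ← h8, Real.rpow_add (neg_pos.2 h0), Real.rpow_one]; ring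
        rw [h1, ENNReal.ofReal_mul k0, ENNReal.ofReal_mul (Real.rpow_nonneg (neg_nonneg.2 h0) _),
          ← ENNReal.ofReal_rpow_of_nonneg (neg_nonneg.2 h0) hp0.le, Real.enorm_of_nonneg hwx]
        gcongr
    have e4 : ∫⁻ x in Ω, U x ^ p * ‖w x‖ₑ ≤
        A ^ (1 / q') * (ENNReal.ofReal C * a ^ (1 / q')) := by
      have h1 := ENNReal.lintegral_mul_le_Lp_mul_Lq (volume.restrict Ω) hpq
        (f := fun x => U x ^ p) (g := fun x => ‖w x‖ₑ) (hUm.pow_const p) H₂.1.1.1.enorm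
      simp only [← ENNReal.rpow_mul, hpq'] at h1
      refine h1.trans (mul_le_mul_right ?_ _)
      have h2 := hdual _ _ _ _ _ H₁ H₂
      have h3 : ∀ x, ‖h x‖ₑ ^ q' = ENNReal.ofReal (T m x) ^ q := fun x => by
        rw [Real.enorm_of_nonneg (hh0 x), hh, ← ENNReal.ofReal_rpow_of_nonneg (hT0 m x) hp0.le,
          ← ENNReal.rpow_mul, hpq']
      simp only [h3] at h2
      exact h2
    have e5 : a ≤ (ENNReal.ofReal (k * C) * (A ^ (1 / q)) ^ p) * (a ^ (1 / q)) ^ p := by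
      refine e2.trans (e3.trans ((mul_le_mul_right e4 _).trans_eq ?_))
      rw [ENNReal.ofReal_mul hk.le, ← ENNReal.rpow_mul, ← ENNReal.rpow_mul, hinv, mul_comm p]
      ring
    rcases eq_or_ne a 0 with h0 | h0
    · rw [h0, ENNReal.zero_rpow_of_pos (by positivity)]
      exact zero_le
    · have ha1 : (a ^ (1 / q)) ^ p ≠ 0 := by
        simp [ENNReal.rpow_eq_zero_iff, h0, hafin]
      have ha2 : (a ^ (1 / q)) ^ p ≠ ⊤ := ENNReal.rpow_ne_top_of_nonneg hp0.le
        (ENNReal.rpow_ne_top_of_nonneg (by positivity) hafin)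
      refine (ENNReal.mul_le_mul_iff_left ha1 ha2).1 (le_trans (le_of_eq ?_) e5)
      rw [← ENNReal.rpow_mul, ← ENNReal.rpow_add _ _ h0 hafin,
        show 1 / q + 1 / q * p = 1 by rw [hqp]; field_simp; ring, ENNReal.rpow_one]
  -- Monotone convergence removes the truncation.
  have hmono : Tendsto (fun m => ∫⁻ x in Ω, ENNReal.ofReal (T m x) ^ q) atTop (𝓝 A) := by
    refine lintegral_tendsto_of_tendsto_of_monotone (fun m => ((hTm m).ennreal_ofReal.pow_const q))
      (Eventually.of_forall fun x m m' hmm => ?_) (Eventually.of_forall fun x => ?_)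
    · refine ENNReal.rpow_le_rpow (ENNReal.ofReal_le_ofReal (min_le_min_left _ ?_)) hq0.le
      exact_mod_cast hmm
    · refine ((ENNReal.continuous_rpow_const.tendsto _).comp (tendsto_const_nhds.congr' ?_))
      filter_upwards [eventually_ge_atTop ⌈max 0 (-u x)⌉₊] with m hm
      rw [hTU, min_eq_left]
      have : -u x ≤ m := (le_max_right 0 _).trans ((Nat.le_ceil _).trans (by exact_mod_cast hm))
      rw [hU]
      exact (ENNReal.ofReal_le_ofReal this).trans_eq (ENNReal.ofReal_natCast m)
  exact le_of_tendsto' ((ENNReal.continuous_rpow_const.tendsto _).comp hmono) key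

/-- Solutions whose negative part is small in the critical norm are nonnegative. -/
lemma exists_forall_nonneg (hn : 5 ≤ n) (hΩ : IsBoundedSmoothDomain Ω)
    {k : ℝ} (hk : 0 < k) (hK : ∀ x ∈ Ω, 0 ≤ K x ∧ K x ≤ k) :
    ∃ ε : ℝ, 0 < ε ∧ ∀ u, IsNavierSolution Ω K u →
      eLpNorm (fun x => max 0 (-u x)) (ENNReal.ofReal (2 * (n : ℝ) / ((n : ℝ) - 4)))
        (volume.restrict Ω) < ENNReal.ofReal ε →
      ∀ᵐ x ∂(volume.restrict Ω), 0 ≤ u x := by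
  obtain ⟨hq0, -, hp1, -⟩ := critical_exponents n hn
  obtain ⟨C, hC, hbound⟩ := exists_negPart_bound hn hΩ hk hK
  set q : ℝ := 2 * n / (n - 4) with hq
  set p : ℝ := (n + 4) / (n - 4) with hp
  have hp1' : 0 < p - 1 := sub_pos.2 hp1
  refine ⟨(1 / C) ^ (1 / (p - 1)), by positivity, fun u hu hsmall => ?_⟩
  have hb := hbound u hu
  have hum : AEMeasurable u (volume.restrict Ω) := hu.1.1.1.aemeasurable
  rw [eLpNorm_eq_lintegral_rpow_enorm_toReal (by simpa using hq0) ENNReal.ofReal_ne_top,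
    ENNReal.toReal_ofReal hq0.le] at hsmall
  have he : ∀ x, ‖max 0 (-u x)‖ₑ = ENNReal.ofReal (-u x) := fun x => by
    rw [Real.enorm_of_nonneg (le_max_left _ _), ENNReal.ofReal_max, ENNReal.ofReal_zero, zero_max]
  simp only [he] at hsmall
  set m := (∫⁻ x in Ω, ENNReal.ofReal (-u x) ^ q) ^ (1 / q) with hm
  have hm0 : m = 0 := by
    by_contra h0
    have hmt : m ≠ ⊤ := hsmall.ne_top
    set t := m.toReal with ht
    have ht0 : 0 < t := ENNReal.toReal_pos h0 hmt
    rw [← ENNReal.ofReal_toReal hmt, ← ht] at hb hsmall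
    have h1 : t < (1 / C) ^ (1 / (p - 1)) := (ENNReal.ofReal_lt_ofReal_iff (by positivity)).1 hsmall
    rw [ENNReal.ofReal_rpow_of_pos ht0, ← ENNReal.ofReal_mul hC.le,
      ENNReal.ofReal_le_ofReal_iff (by positivity)] at hb
    have h2 : t ^ (p - 1) < 1 / C := by
      have := Real.rpow_lt_rpow ht0.le h1 hp1'
      rwa [← Real.rpow_mul (by positivity), one_div_mul_cancel hp1'.ne', Real.rpow_one] at this
    have h3 : t ^ p = t ^ (p - 1) * t := by
      rw [← Real.rpow_add_one ht0.ne', sub_add_cancel]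
    rw [h3] at hb
    rw [lt_div_iff₀ hC] at h2
    nlinarith
  have h1 : ∫⁻ x in Ω, ENNReal.ofReal (-u x) ^ q = 0 := by
    rw [hm, ENNReal.rpow_eq_zero_iff] at hm0
    rcases hm0 with h | h
    · exact h.1
    · exact absurd h.2 (not_lt.2 (by positivity))
  replace h1 := (lintegral_eq_zero_iff' (f := fun x => ENNReal.ofReal (-u x) ^ q)
    (hum.neg.ennreal_ofReal.pow_const q)).1 h1
  filter_upwards [h1] with x hx
  rw [Pi.zero_apply, ENNReal.rpow_eq_zero_iff] at hx
  rcases hx with h | h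
  · simpa using h.1
  · exact absurd h.2 (not_lt.2 hq0.le)

/-- A nonnegative solution is weakly superharmonic. -/
lemma IsNavierSolution.integral_laplacian_nonpos (hn : 5 ≤ n) (hΩ : IsBoundedSmoothDomain Ω)
    (hK : ∀ x ∈ Ω, 0 ≤ K x) (hu : IsNavierSolution Ω K u)
    (hu0 : ∀ᵐ x ∂(volume.restrict Ω), 0 ≤ u x) {θ : EuclideanSpace ℝ (Fin n) → ℝ}
    (hθ : IsTestFunction Ω θ) (hθ0 : ∀ x, 0 ≤ θ x) :
    ∫ x in Ω, u x * Laplacian.laplacian θ x ≤ 0 := by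
  obtain ⟨v, g, hv, hint⟩ := hu.integral_eq hΩ
  have hvm := hv.2.1
  have hneg : MemLp (fun x => max (-v x) 0) 2 (volume.restrict Ω) := hvm.neg.pos_part
  obtain ⟨φ, g', H⟩ := exists_isDirichlet hn hΩ.isBounded hneg
  have hφ := H.nonneg hn hΩ.isOpen hΩ.isBounded (Eventually.of_forall fun x => le_max_right _ _)
  have h1 : 0 ≤ ∫ x in Ω, v x * max (-v x) 0 := by
    rw [hint _ _ _ H]
    refine integral_nonneg_of_ae ?_
    filter_upwards [hφ, hu0, ae_restrict_mem hΩ.isOpen.measurableSet] with x h1 h2 h3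
    have := hK x h3
    have := Real.rpow_nonneg (abs_nonneg (u x)) ((8 : ℝ) / ((n : ℝ) - 4))
    change 0 ≤ K x * |u x| ^ ((8 : ℝ) / ((n : ℝ) - 4)) * u x * φ x
    positivity
  have h2 : ∫ x in Ω, v x * max (-v x) 0 = -∫ x in Ω, max (-v x) 0 ^ 2 := by
    rw [← integral_neg]
    congr 1
    ext x
    rcases le_total (v x) 0 with h | h
    · rw [max_eq_left (neg_nonneg.2 h)]; ring
    · rw [max_eq_right (neg_nonpos.2 h)]; ring
  have h3 : ∫ x in Ω, max (-v x) 0 ^ 2 = 0 :=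
    le_antisymm (by linarith) (integral_nonneg fun x => sq_nonneg _)
  rw [integral_eq_zero_iff_of_nonneg (fun x => sq_nonneg _) hneg.integrable_sq] at h3
  rw [hv.hasWeakLaplacian.2.2 θ hθ]
  refine integral_nonpos_of_ae ?_
  filter_upwards [h3] with x hx
  have h4 : max (-v x) 0 = 0 := by simpa using hx
  have h5 : 0 ≤ v x := by
    have := le_max_left (-v x) 0
    linarith
  have := mul_nonneg h5 (hθ0 x)
  change -v x * θ x ≤ 0
  linarith

end NegPart

/-! ### Weakly superharmonic functions -/

section Superharmonic

variable {n : ℕ} {Ω : Set (EuclideanSpace ℝ (Fin n))} {u : EuclideanSpace ℝ (Fin n) → ℝ}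

/-- A smooth nonincreasing profile `e` on `[0, ∞)`, equal to `1` on `[0, 1/2]` and to `0` on
`[1, ∞)`, together with a nonnegative primitive `P` of `-e` that vanishes on `[1, ∞)`. -/
lemma exists_profile : ∃ (e P : ℝ → ℝ) (B : ℝ), ContDiff ℝ ∞ e ∧ ContDiff ℝ ∞ P ∧
    (∀ s, 0 ≤ e s) ∧ (∀ s, e s ≤ 1) ∧ (∀ s ≤ 1 / 2, e s = 1) ∧ (∀ s, 1 ≤ s → e s = 0) ∧
    (∀ s, 0 ≤ s → |s * deriv e s| ≤ B) ∧ (∀ s, 0 ≤ P s) ∧ (∀ s, 1 ≤ s → P s = 0) ∧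
    ∀ s, HasDerivAt P (-e s) s := by
  obtain ⟨B, hB, hcut⟩ := exists_cutoff
  obtain ⟨χ, hχ, hχ0, hχ1, hχz, hχo, hχd, hχdz⟩ := hcut (1 / 2) (by norm_num)
  have hes : ContDiff ℝ ∞ fun s => 1 - χ s := contDiff_const.sub hχ
  have hd : ∀ s, deriv (fun s => 1 - χ s) s = -deriv χ s := fun s => by
    rw [deriv_const_sub]
  obtain ⟨hP, hP'⟩ := contDiff_primitive hes.continuous
  set Q : ℝ → ℝ := fun t => ∫ s in (0 : ℝ)..t, (1 - χ s) with hQ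
  have hPd : ∀ s, HasDerivAt (fun s => Q 1 - Q s) (-(1 - χ s)) s := fun s => by
    have := (hP.differentiable (by norm_num) s).hasDerivAt
    rw [hP'] at this
    exact this.const_sub _
  have hP1 : ∀ s, 1 ≤ s → Q 1 - Q s = 0 := fun s hs => by
    have h1 : Q s - Q 1 = ∫ t in (1 : ℝ)..s, (1 - χ t) :=
      intervalIntegral.integral_interval_sub_left (hes.continuous.intervalIntegrable _ _)
        (hes.continuous.intervalIntegrable _ _)
    have h2 : ∫ t in (1 : ℝ)..s, (1 - χ t) = ∫ t in (1 : ℝ)..s, (0 : ℝ) := by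
      refine intervalIntegral.integral_congr fun t ht => ?_
      rw [Set.uIcc_of_le hs] at ht
      simp only [hχo t (by linarith [ht.1]), sub_self]
    rw [h2, intervalIntegral.integral_zero] at h1
    linarith
  have hanti : Antitone fun s => Q 1 - Q s :=
    antitone_of_deriv_nonpos (fun s => (hPd s).differentiableAt) fun s => by
      rw [(hPd s).deriv]; linarith [hχ1 s]
  refine ⟨fun s => 1 - χ s, fun s => Q 1 - Q s, 2 * B, hes, ?_, fun s => sub_nonneg.2 (hχ1 s),
    fun s => by linarith [hχ0 s], fun s hs => by simp only [hχz s hs, sub_zero],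
    fun s hs => by simp only [hχo s (by linarith), sub_self], fun s hs => ?_, fun s => ?_, hP1, hPd⟩
  · refine contDiff_infty_iff_deriv.2 ⟨fun s => (hPd s).differentiableAt, ?_⟩
    rw [funext fun s => (hPd s).deriv]
    exact hes.neg
  · rw [hd, abs_mul, abs_neg, abs_of_nonneg hs]
    by_cases h1 : s ≤ 1
    · calc s * |deriv χ s| ≤ 1 * (B / (1 / 2)) := by gcongr; exact hχd s
        _ = 2 * B := by ring
    · rw [hχdz s (Or.inr (by linarith)), abs_zero, mul_zero]; positivity
  · calc (0 : ℝ) = Q 1 - Q (max s 1) := (hP1 _ (le_max_right _ _)).symm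
      _ ≤ Q 1 - Q s := hanti (le_max_left s 1)

lemma partialDeriv_norm_sub_sq (x y : EuclideanSpace ℝ (Fin n)) (i : Fin n) :
    partialDeriv i (fun y => ‖y - x‖ ^ 2) y = 2 * (y i - x i) := by
  have h := ((hasFDerivAt_id y).sub_const x).norm_sq
  rw [partialDeriv, show (fun y => ‖y - x‖ ^ 2) = fun y => ‖id y - x‖ ^ 2 from rfl, h.fderiv]
  simp [EuclideanSpace.inner_single_right]

lemma partialDeriv_coord_sub (x y : EuclideanSpace ℝ (Fin n)) (i : Fin n) :
    partialDeriv i (fun y => y i - x i) y = 1 := by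
  have h := ((EuclideanSpace.proj (𝕜 := ℝ) i).hasFDerivAt (x := y)).sub_const (x i)
  rw [partialDeriv, show (fun y : EuclideanSpace ℝ (Fin n) => y i - x i) =
    fun y => EuclideanSpace.proj (𝕜 := ℝ) i y - x i from rfl, h.fderiv]
  simp

/-- The Laplacian of a radial function of the form `P(t²|y - x|²)`, with `P' = -e`. -/
lemma laplacian_radial {e P : ℝ → ℝ} (he : ContDiff ℝ ∞ e) (hP : ContDiff ℝ ∞ P)
    (hPd : ∀ s, HasDerivAt P (-e s) s) (t : ℝ) (x y : EuclideanSpace ℝ (Fin n)) :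
    Laplacian.laplacian (fun y => P (t ^ 2 * ‖y - x‖ ^ 2)) y =
      -(2 * t ^ 2) * (n * e (t ^ 2 * ‖y - x‖ ^ 2) +
        2 * ((t ^ 2 * ‖y - x‖ ^ 2) * deriv e (t ^ 2 * ‖y - x‖ ^ 2))) := by
  have hN : ContDiff ℝ ∞ fun y : EuclideanSpace ℝ (Fin n) => ‖y - x‖ ^ 2 :=
    (contDiff_id.sub contDiff_const).norm_sq ℝ
  have hNd := hN.differentiable (by simp)
  have hcd : ∀ i, Differentiable ℝ fun y : EuclideanSpace ℝ (Fin n) => y i - x i := fun i => by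
    fun_prop
  have hsc : ∀ s : ℝ, HasDerivAt (fun s => t ^ 2 * s) (t ^ 2) s := fun s => by
    simpa using (hasDerivAt_id s).const_mul (t ^ 2)
  have h1 : ∀ i, partialDeriv i (fun y => P (t ^ 2 * ‖y - x‖ ^ 2)) =
      fun y => -(2 * t ^ 2) * (e (t ^ 2 * ‖y - x‖ ^ 2) * (y i - x i)) := fun i => by
    ext y
    have hd : HasDerivAt (fun s => P (t ^ 2 * s)) (-e (t ^ 2 * ‖y - x‖ ^ 2) * t ^ 2)
      (‖y - x‖ ^ 2) := (hPd (t ^ 2 * ‖y - x‖ ^ 2)).comp (‖y - x‖ ^ 2) (hsc _)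
    rw [partialDeriv_comp (f := fun y => ‖y - x‖ ^ 2) (β := fun s => P (t ^ 2 * s))
      hd.differentiableAt (hNd y), partialDeriv_norm_sub_sq, hd.deriv]
    ring
  have h2 : ∀ i, partialDeriv i (partialDeriv i (fun y => P (t ^ 2 * ‖y - x‖ ^ 2))) y =
      -(2 * t ^ 2) * (deriv e (t ^ 2 * ‖y - x‖ ^ 2) * t ^ 2 * 2 * (y i - x i) ^ 2 +
        e (t ^ 2 * ‖y - x‖ ^ 2)) := fun i => by
    have hd : HasDerivAt (fun s => e (t ^ 2 * s)) (deriv e (t ^ 2 * ‖y - x‖ ^ 2) * t ^ 2)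
      (‖y - x‖ ^ 2) := ((he.differentiable (by simp) (t ^ 2 * ‖y - x‖ ^ 2)).hasDerivAt).comp
        (‖y - x‖ ^ 2) (hsc _)
    have hed : Differentiable ℝ fun y : EuclideanSpace ℝ (Fin n) => e (t ^ 2 * ‖y - x‖ ^ 2) :=
      (he.comp (contDiff_const.mul hN)).differentiable (by simp)
    rw [h1, partialDeriv_mul (differentiableAt_const _) ((hed y).fun_mul (hcd i y)),
      partialDeriv_const, partialDeriv_mul (hed y) (hcd i y), partialDeriv_coord_sub,
      partialDeriv_comp (f := fun y => ‖y - x‖ ^ 2) (β := fun s => e (t ^ 2 * s))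
        hd.differentiableAt (hNd y), partialDeriv_norm_sub_sq, hd.deriv]
    ring
  have h3 : ∑ i, (y i - x i) ^ 2 = ‖y - x‖ ^ 2 := by
    rw [EuclideanSpace.norm_sq_eq]
    simp
  rw [laplacian_eq_sum (f := fun y => P (t ^ 2 * ‖y - x‖ ^ 2))
    ((hP.comp (contDiff_const.mul hN)).of_le two_le_infty)]
  simp only [h2]
  rw [← Finset.mul_sum, Finset.sum_add_distrib, ← Finset.mul_sum, h3]
  simp only [Finset.sum_const, Finset.card_univ, Fintype.card_fin, nsmul_eq_mul]
  ring

/-- Weighted averages of a weakly superharmonic function over balls around `x` increase as the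
radius `1 / t` shrinks. -/
lemma monotoneOn_average (hn : 1 ≤ n) (hu : IntegrableOn u Ω)
    (hsup : ∀ θ, IsTestFunction Ω θ → (∀ x, 0 ≤ θ x) →
      ∫ x in Ω, u x * Laplacian.laplacian θ x ≤ 0)
    {e P : ℝ → ℝ} {B : ℝ} (he : ContDiff ℝ ∞ e) (hP : ContDiff ℝ ∞ P) (he0 : ∀ s, 0 ≤ e s)
    (he1 : ∀ s, e s ≤ 1) (heB : ∀ s, 0 ≤ s → |s * deriv e s| ≤ B) (hP0 : ∀ s, 0 ≤ P s)
    (hP1 : ∀ s, 1 ≤ s → P s = 0) (hPd : ∀ s, HasDerivAt P (-e s) s)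
    {x : EuclideanSpace ℝ (Fin n)} {R : ℝ} (hR : 0 < R) (hx : Metric.closedBall x R ⊆ Ω) :
    MonotoneOn (fun t => ∫ y in Ω, u y * (t ^ n * e (t ^ 2 * ‖y - x‖ ^ 2))) (Set.Ici (1 / R)) := by
  have hN : Continuous fun y : EuclideanSpace ℝ (Fin n) => ‖y - x‖ ^ 2 := by fun_prop
  have hec := he.continuous
  have hec' : Continuous (deriv e) := he.continuous_deriv (by simp)
  set F' : ℝ → EuclideanSpace ℝ (Fin n) → ℝ := fun t y => u y * (t ^ (n - 1) *
    (n * e (t ^ 2 * ‖y - x‖ ^ 2) +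
      2 * ((t ^ 2 * ‖y - x‖ ^ 2) * deriv e (t ^ 2 * ‖y - x‖ ^ 2)))) with hF'
  have hd : ∀ t y, HasDerivAt (fun t => u y * (t ^ n * e (t ^ 2 * ‖y - x‖ ^ 2))) (F' t y) t := by
    intro t y
    have h1 : HasDerivAt (fun t : ℝ => t ^ 2 * ‖y - x‖ ^ 2) (2 * t * ‖y - x‖ ^ 2) t := by
      simpa using (hasDerivAt_pow 2 t).mul_const (‖y - x‖ ^ 2)
    have h2 := ((he.differentiable (by simp) (t ^ 2 * ‖y - x‖ ^ 2)).hasDerivAt).comp t h1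
    refine (((hasDerivAt_pow n t).mul h2).const_mul (u y)).congr_deriv ?_
    obtain ⟨m, rfl⟩ : ∃ m, n = m + 1 := ⟨n - 1, by omega⟩
    simp only [hF', Nat.add_sub_cancel, Function.comp_apply]
    ring
  have hcont : ∀ t, Continuous fun y : EuclideanSpace ℝ (Fin n) =>
      t ^ n * e (t ^ 2 * ‖y - x‖ ^ 2) := fun t => by fun_prop
  have hcont' : ∀ t, Continuous fun y : EuclideanSpace ℝ (Fin n) => t ^ (n - 1) *
    (n * e (t ^ 2 * ‖y - x‖ ^ 2) +
      2 * ((t ^ 2 * ‖y - x‖ ^ 2) * deriv e (t ^ 2 * ‖y - x‖ ^ 2))) := fun t => by fun_prop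
  have hder : ∀ t, 0 < t → HasDerivAt
      (fun t => ∫ y in Ω, u y * (t ^ n * e (t ^ 2 * ‖y - x‖ ^ 2))) (∫ y in Ω, F' t y) t := by
    intro t ht
    refine (hasDerivAt_integral_of_dominated_loc_of_deriv_le (s := Set.Ioo 0 (t + 1))
      (bound := fun y => ‖u y‖ * ((t + 1) ^ (n - 1) * (n + 2 * B)))
      (Ioo_mem_nhds ht (by linarith)) (Eventually.of_forall fun s =>
        hu.1.mul (hcont s).aestronglyMeasurable) ?_ (hu.1.mul (hcont' t).aestronglyMeasurable)
      (Eventually.of_forall fun y s hs => ?_) (hu.norm.mul_const _)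
      (Eventually.of_forall fun y s _ => hd s y)).2
    · refine Integrable.mono' (hu.norm.mul_const (t ^ n)) (hu.1.mul (hcont t).aestronglyMeasurable)
        (Eventually.of_forall fun y => ?_)
      rw [Pi.mul_apply, norm_mul]
      refine mul_le_mul_of_nonneg_left ?_ (norm_nonneg _)
      rw [Real.norm_of_nonneg (mul_nonneg (by positivity) (he0 _))]
      exact mul_le_of_le_one_right (by positivity) (he1 _)
    · rw [hF', norm_mul]
      refine mul_le_mul_of_nonneg_left ?_ (norm_nonneg _)
      rw [norm_mul, Real.norm_of_nonneg (pow_nonneg hs.1.le _)]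
      have hσ : 0 ≤ s ^ 2 * ‖y - x‖ ^ 2 := by positivity
      have h1 := heB _ hσ
      refine mul_le_mul (pow_le_pow_left₀ hs.1.le hs.2.le _) ?_ (norm_nonneg _)
        (by have := hs.1; positivity)
      refine (norm_add_le _ _).trans (add_le_add ?_ ?_)
      · rw [Real.norm_of_nonneg (mul_nonneg (Nat.cast_nonneg _) (he0 _))]
        exact mul_le_of_le_one_right (Nat.cast_nonneg _) (he1 _)
      · rw [norm_mul, Real.norm_of_nonneg zero_le_two]
        exact mul_le_mul_of_nonneg_left h1 zero_le_two
  have hpos : ∀ t, 1 / R ≤ t → 0 < t := fun t ht => lt_of_lt_of_le (by positivity) ht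
  refine monotoneOn_of_deriv_nonneg (convex_Ici _)
    (fun t ht => (hder t (hpos t ht)).continuousAt.continuousWithinAt)
    (fun t ht => (hder t (hpos t (interior_subset ht))).differentiableAt.differentiableWithinAt)
    fun t ht => ?_
  have htR : 1 / R ≤ t := interior_subset ht
  have ht0 := hpos t htR
  rw [(hder t ht0).deriv]
  -- The derivative in `t` of the averaging kernel is a negative multiple of the Laplacian of the
  -- nonnegative test function `P(t²|y - x|²)`.
  have hz : ∀ y ∉ Metric.closedBall x R, P (t ^ 2 * ‖y - x‖ ^ 2) = 0 := by
    intro y hy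
    rw [Metric.mem_closedBall, not_le, dist_eq_norm] at hy
    refine hP1 _ ?_
    rw [← mul_pow]
    refine one_le_pow₀ ?_
    calc (1 : ℝ) = 1 / R * R := by field_simp
      _ ≤ t * ‖y - x‖ := by gcongr
  have htest : IsTestFunction Ω fun y => P (t ^ 2 * ‖y - x‖ ^ 2) := by
    refine ⟨hP.comp (contDiff_const.mul ((contDiff_id.sub contDiff_const).norm_sq ℝ)),
      HasCompactSupport.intro (isCompact_closedBall x R) hz,
      (closure_minimal (fun y hy => ?_) Metric.isClosed_closedBall).trans hx⟩
    by_contra h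
    exact hy (hz y h)
  have hneg := hsup _ htest fun y => hP0 _
  simp only [laplacian_radial he hP hPd] at hneg
  have heq : ∫ y in Ω, F' t y = -(t ^ (n - 1) / (2 * t ^ 2)) *
      ∫ y in Ω, u y * (-(2 * t ^ 2) * (n * e (t ^ 2 * ‖y - x‖ ^ 2) +
        2 * ((t ^ 2 * ‖y - x‖ ^ 2) * deriv e (t ^ 2 * ‖y - x‖ ^ 2)))) := by
    rw [← integral_const_mul]
    congr 1
    ext y
    rw [hF']
    field_simp
  rw [heq]
  exact mul_nonneg_of_nonpos_of_nonpos (neg_nonpos.2 (by positivity)) hneg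

/-- A weak form of Harnack's inequality for nonnegative superharmonic functions. -/
lemma ae_setIntegral_ball_le (hn : 1 ≤ n) (hΩ : IsOpen Ω) (hu : IntegrableOn u Ω)
    (hu0 : ∀ᵐ x ∂(volume.restrict Ω), 0 ≤ u x)
    (hsup : ∀ θ, IsTestFunction Ω θ → (∀ x, 0 ≤ θ x) →
      ∫ x in Ω, u x * Laplacian.laplacian θ x ≤ 0) :
    ∀ᵐ x ∂(volume.restrict Ω), ∀ R, 0 < R → Metric.closedBall x R ⊆ Ω →
      ∫ y in Metric.ball x (R / 2), u y ≤
        R ^ n * (volume.real (Metric.ball (0 : EuclideanSpace ℝ (Fin n)) 1) * u x) := by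
  obtain ⟨e, P, B, he, hP, he0, he1, heh, heo, heB, hP0, hP1, hPd⟩ := exists_profile
  have hm := hΩ.measurableSet
  have hleb := IsUnifLocDoublingMeasure.ae_tendsto_average (μ := volume)
    (hu.integrable_indicator hm).locallyIntegrable 1
  filter_upwards [ae_restrict_of_ae hleb, ae_restrict_mem hm] with x hx hxΩ R hR hRΩ
  set b := volume.real (Metric.ball (0 : EuclideanSpace ℝ (Fin n)) 1) with hb
  set A : ℝ → ℝ := fun t => ∫ y in Ω, u y * (t ^ n * e (t ^ 2 * ‖y - x‖ ^ 2)) with hA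
  have hmono : MonotoneOn A (Set.Ici (1 / R)) :=
    monotoneOn_average hn hu hsup he hP he0 he1 heB hP0 hP1 hPd hR hRΩ
  have hki : ∀ t, IntegrableOn (fun y => u y * (t ^ n * e (t ^ 2 * ‖y - x‖ ^ 2))) Ω := by
    intro t
    have hc : Continuous fun y : EuclideanSpace ℝ (Fin n) => t ^ n * e (t ^ 2 * ‖y - x‖ ^ 2) := by
      have := he.continuous
      fun_prop
    refine Integrable.mono' (hu.norm.mul_const (|t ^ n|)) (hu.1.mul hc.aestronglyMeasurable)
      (Eventually.of_forall fun y => ?_)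
    rw [norm_mul]
    refine mul_le_mul_of_nonneg_left ?_ (norm_nonneg _)
    rw [norm_mul, Real.norm_of_nonneg (he0 _), Real.norm_eq_abs]
    exact mul_le_of_le_one_right (abs_nonneg _) (he1 _)
  have hpos : ∀ t, 1 / R ≤ t → 0 < t := fun t ht => lt_of_lt_of_le (by positivity) ht
  -- The profile is `1` on `[0, 1/4]`, so the average at scale `R` dominates the half ball.
  have hlow : (1 / R) ^ n * ∫ y in Metric.ball x (R / 2), u y ≤ A (1 / R) := by
    have hsub : Metric.ball x (R / 2) ⊆ Ω := fun y hy => hRΩ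
      (Metric.ball_subset_closedBall (Metric.ball_subset_ball (by linarith) hy))
    rw [← integral_const_mul]
    refine le_trans (le_of_eq ?_) (setIntegral_mono_set (s := Metric.ball x (R / 2)) (hki (1 / R))
      ?_ hsub.eventuallyLE)
    · refine setIntegral_congr_fun Metric.isOpen_ball.measurableSet fun y hy => ?_
      rw [Metric.mem_ball, dist_eq_norm] at hy
      have h1 : (1 / R) ^ 2 * ‖y - x‖ ^ 2 ≤ 1 / 2 := by
        calc (1 / R) ^ 2 * ‖y - x‖ ^ 2 ≤ (1 / R) ^ 2 * (R / 2) ^ 2 := by gcongr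
          _ = 1 / 4 := by field_simp; norm_num
          _ ≤ 1 / 2 := by norm_num
      simp only [heh _ h1]
      ring
    · filter_upwards [hu0] with y hy
      exact mul_nonneg hy (mul_nonneg (by positivity) (he0 _))
  -- At small scales Lebesgue's theorem applies to the averages over balls.
  have hup : ∀ t, 1 / R ≤ t → A t ≤ b * ⨍ y in Metric.closedBall x (1 / t), Ω.indicator u y := by
    intro t ht
    have ht0 := hpos t ht
    have hsub : Metric.closedBall x (1 / t) ⊆ Ω := by
      refine (Metric.closedBall_subset_closedBall ?_).trans hRΩ
      rw [div_le_iff₀ ht0]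
      rwa [div_le_iff₀ hR, mul_comm] at ht
    have hvol : volume.real (Metric.closedBall x (1 / t)) = (1 / t) ^ n * b := by
      rw [measureReal_def, Measure.addHaar_closedBall _ _ (by positivity), ENNReal.toReal_mul,
        ENNReal.toReal_ofReal (by positivity), finrank_euclideanSpace_fin, hb, measureReal_def]
    have hb0 : 0 < b := by
      rw [hb, measureReal_def]
      exact ENNReal.toReal_pos (Metric.measure_ball_pos _ _ one_pos).ne' measure_ball_lt_top.ne
    rw [setAverage_eq, hvol, smul_eq_mul,
      setIntegral_congr_fun (g := u) measurableSet_closedBall fun y hy =>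
        Set.indicator_of_mem (hsub hy) u]
    have h1 : b * (((1 / t) ^ n * b)⁻¹ * ∫ y in Metric.closedBall x (1 / t), u y) =
        ∫ y in Metric.closedBall x (1 / t), u y * t ^ n := by
      rw [integral_mul_const, one_div, inv_pow]
      field_simp
    have h2 : A t = ∫ y in Metric.closedBall x (1 / t),
        u y * (t ^ n * e (t ^ 2 * ‖y - x‖ ^ 2)) := by
      refine setIntegral_eq_of_subset_of_forall_sdiff_eq_zero hm hsub fun y hy => ?_
      have h3 := hy.2
      rw [Metric.mem_closedBall, not_le, dist_eq_norm] at h3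
      rw [heo, mul_zero, mul_zero]
      rw [← mul_pow]
      refine one_le_pow₀ ?_
      calc (1 : ℝ) = t * (1 / t) := by field_simp
        _ ≤ t * ‖y - x‖ := by gcongr
    rw [h1, h2]
    refine setIntegral_mono_on_ae ((hki t).mono_set hsub) ((hu.mono_set hsub).mul_const _)
      measurableSet_closedBall ?_
    filter_upwards [(ae_restrict_iff' hm).1 hu0] with y hy hy'
    exact mul_le_mul_of_nonneg_left (mul_le_of_le_one_right (by positivity) (he1 _))
      (hy (hsub hy'))
  have hδ : Tendsto (fun t : ℝ => 1 / t) atTop (𝓝[>] 0) := by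
    simpa only [one_div] using tendsto_inv_atTop_nhdsGT_zero (𝕜 := ℝ)
  have hlim := (hx (fun _ => x) (fun t => 1 / t) hδ (by
    filter_upwards [eventually_gt_atTop (0 : ℝ)] with t ht
    exact Metric.mem_closedBall_self (by positivity))).const_mul b
  rw [Set.indicator_of_mem hxΩ] at hlim
  have hfin : A (1 / R) ≤ b * u x := by
    refine ge_of_tendsto hlim ?_
    filter_upwards [eventually_ge_atTop (1 / R)] with t ht
    exact (hmono Set.self_mem_Ici ht ht).trans (hup t ht)
  have := hlow.trans hfin
  rw [one_div, inv_pow, inv_mul_le_iff₀ (by positivity)] at this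
  exact this

/-- Strong maximum principle: on a connected open set, a nonnegative weakly superharmonic function
is locally bounded below by positive constants or vanishes almost everywhere. -/
lemma exists_le_of_superharmonic (hn : 1 ≤ n) (hΩ : IsOpen Ω) (hc : IsPreconnected Ω)
    (hu : IntegrableOn u Ω) (hu0 : ∀ᵐ x ∂(volume.restrict Ω), 0 ≤ u x)
    (hsup : ∀ θ, IsTestFunction Ω θ → (∀ x, 0 ≤ θ x) →
      ∫ x in Ω, u x * Laplacian.laplacian θ x ≤ 0)
    (hne : ¬ ∀ᵐ x ∂(volume.restrict Ω), u x = 0) {C : Set (EuclideanSpace ℝ (Fin n))}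
    (hC : IsCompact C) (hCΩ : C ⊆ Ω) :
    ∃ c : ℝ, 0 < c ∧ ∀ᵐ x ∂(volume.restrict C), c ≤ u x := by
  have hm := hΩ.measurableSet
  have hbpos : 0 < volume.real (Metric.ball (0 : EuclideanSpace ℝ (Fin n)) 1) := by
    rw [measureReal_def]
    exact ENNReal.toReal_pos (Metric.measure_ball_pos _ _ one_pos).ne' measure_ball_lt_top.ne
  have hharnack := ae_setIntegral_ball_le hn hΩ hu hu0 hsup
  -- The open sets where `u` vanishes locally and where it is locally bounded below by a positive
  -- constant are disjoint and cover `Ω`.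
  set Z : Set (EuclideanSpace ℝ (Fin n)) := {x | ∃ r > 0,
    ∀ᵐ y ∂(volume.restrict (Metric.ball x r)), u y = 0} with hZ
  set G : Set (EuclideanSpace ℝ (Fin n)) := {x | ∃ r > 0, ∃ c : ℝ, 0 < c ∧
    ∀ᵐ y ∂(volume.restrict (Metric.ball x r)), c ≤ u y} with hG
  have hopen : ∀ p : Set (EuclideanSpace ℝ (Fin n)) → Prop, (∀ s t, s ⊆ t → p t → p s) →
      IsOpen {x | ∃ r > 0, p (Metric.ball x r)} := by
    intro p hp
    rw [Metric.isOpen_iff]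
    rintro x ⟨r, hr, h⟩
    refine ⟨r / 2, by positivity, fun y hy => ⟨r / 2, by positivity, hp _ _ ?_ h⟩⟩
    refine Metric.ball_subset_ball' ?_
    rw [Metric.mem_ball] at hy
    linarith
  have hZo : IsOpen Z := hopen (fun s => ∀ᵐ y ∂(volume.restrict s), u y = 0)
    fun s t hst h => ae_mono (Measure.restrict_mono hst le_rfl) h
  have hGo : IsOpen G := hopen (fun s => ∃ c : ℝ, 0 < c ∧ ∀ᵐ y ∂(volume.restrict s), c ≤ u y)
    fun s t hst h => h.imp fun c h => ⟨h.1, ae_mono (Measure.restrict_mono hst le_rfl) h.2⟩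
  have hcover : Ω ⊆ Z ∪ G := by
    intro x hx
    obtain ⟨ε, hε, hεΩ⟩ := Metric.isOpen_iff.1 hΩ x hx
    set R := ε / 2 with hR
    have hR0 : 0 < R := by positivity
    have hball : ∀ y ∈ Metric.ball x (R / 4), Metric.closedBall y R ⊆ Ω := fun y hy =>
      (Metric.closedBall_subset_ball' (by rw [Metric.mem_ball] at hy; linarith)).trans hεΩ
    have hsub : Metric.ball x (R / 4) ⊆ Ω := fun y hy =>
      hball y hy (Metric.mem_closedBall_self hR0.le)
    have h0 : ∀ᵐ y ∂(volume.restrict (Metric.ball x (R / 4))), 0 ≤ u y :=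
      ae_mono (Measure.restrict_mono hsub le_rfl) hu0
    set J := ∫ y in Metric.ball x (R / 4), u y with hJ
    rcases (integral_nonneg_of_ae h0 : 0 ≤ J).eq_or_lt with hJ0 | hJ0
    · left
      refine ⟨R / 4, by positivity, ?_⟩
      exact (integral_eq_zero_iff_of_nonneg_ae h0 (hu.mono_set hsub)).1 hJ0.symm
    · right
      refine ⟨R / 4, by positivity, J / (R ^ n *
        volume.real (Metric.ball (0 : EuclideanSpace ℝ (Fin n)) 1)), by positivity, ?_⟩
      filter_upwards [ae_mono (Measure.restrict_mono hsub le_rfl) hharnack,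
        ae_restrict_mem Metric.isOpen_ball.measurableSet] with y hy hyb
      have hsub' : Metric.ball y (R / 2) ⊆ Ω := fun z hz => hball y hyb
        (Metric.ball_subset_closedBall (Metric.ball_subset_ball (by linarith) hz))
      have h1 : J ≤ ∫ z in Metric.ball y (R / 2), u z := by
        refine setIntegral_mono_set (hu.mono_set hsub')
          (ae_mono (Measure.restrict_mono hsub' le_rfl) hu0) (LE.le.eventuallyLE ?_)
        refine Metric.ball_subset_ball' ?_
        rw [Metric.mem_ball, dist_comm] at hyb
        linarith
      rw [div_le_iff₀ (by positivity)]
      linarith [hy R hR0 (hball y hyb)]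
  have hdisj : Z ∩ G = ∅ := by
    rw [Set.eq_empty_iff_forall_notMem]
    rintro x ⟨⟨r, hr, h⟩, r', hr', c, hc, h'⟩
    have h1 : Metric.ball x (min r r') ⊆ Metric.ball x r :=
      Metric.ball_subset_ball (min_le_left _ _)
    have h2 : Metric.ball x (min r r') ⊆ Metric.ball x r' :=
      Metric.ball_subset_ball (min_le_right _ _)
    have h3 : ∀ᵐ y ∂(volume.restrict (Metric.ball x (min r r'))), False := by
      filter_upwards [ae_mono (Measure.restrict_mono h1 le_rfl) h,
        ae_mono (Measure.restrict_mono h2 le_rfl) h'] with y hy hy'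
      linarith
    rw [eventually_false_iff_eq_bot, ae_eq_bot, Measure.restrict_eq_zero] at h3
    exact (Metric.measure_ball_pos volume x (lt_min hr hr')).ne' h3
  have hΩG : Ω ⊆ G := by
    rcases isPreconnected_iff_subset_of_disjoint.1 hc Z G hZo hGo hcover
      (by rw [hdisj, Set.inter_empty]) with h | h
    · refine absurd ?_ hne
      rw [ae_iff, Measure.restrict_apply' hm]
      refine measure_null_of_locally_null _ fun x hx => ?_
      obtain ⟨r, hr, hxr⟩ := h hx.2
      refine ⟨_, inter_mem_nhdsWithin _ (Metric.ball_mem_nhds x hr), ?_⟩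
      rw [ae_iff, Measure.restrict_apply' Metric.isOpen_ball.measurableSet] at hxr
      refine measure_mono_null ?_ hxr
      rintro y ⟨⟨hy1, -⟩, hy2⟩
      exact ⟨hy1, hy2⟩
    · exact h
  refine hC.induction_on (p := fun s => ∃ c : ℝ, 0 < c ∧ ∀ᵐ x ∂(volume.restrict s), c ≤ u x)
    ⟨1, one_pos, by simp⟩ (fun s t hst h => h.imp fun c h =>
      ⟨h.1, ae_mono (Measure.restrict_mono hst le_rfl) h.2⟩) ?_ ?_
  · rintro s t ⟨c, hc, h⟩ ⟨c', hc', h'⟩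
    refine ⟨min c c', lt_min hc hc', ?_⟩
    rw [ae_restrict_union_iff]
    exact ⟨h.mono fun x hx => (min_le_left _ _).trans hx,
      h'.mono fun x hx => (min_le_right _ _).trans hx⟩
  · intro x hx
    obtain ⟨r, hr, c, hc, h⟩ := hΩG (hCΩ hx)
    exact ⟨Metric.ball x r, mem_nhdsWithin_of_mem_nhds (Metric.ball_mem_nhds x hr), c, hc, h⟩

end Superharmonic

end NavierBiharmonic

theorem proposition4p1 (n : ℕ) (hn : 5 ≤ n) (Ω : Set (EuclideanSpace ℝ (Fin n)))
    (hΩ : NavierBiharmonic.IsBoundedSmoothDomain Ω)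
    (K : EuclideanSpace ℝ (Fin n) → ℝ)
    (hK : ContDiffOn ℝ 3 K (closure Ω)) (hKpos : ∀ x ∈ closure Ω, 0 < K x) :
    ∃ ε₀ : ℝ, 0 < ε₀ ∧ ∀ u : EuclideanSpace ℝ (Fin n) → ℝ,
      NavierBiharmonic.IsNavierSolution Ω K u →
      eLpNorm (fun x => max 0 (-u x)) (ENNReal.ofReal (2 * (n : ℝ) / ((n : ℝ) - 4)))
        (volume.restrict Ω) < ENNReal.ofReal ε₀ →
      (∀ᵐ x ∂(volume.restrict Ω), 0 ≤ u x) ∧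
      (¬ (∀ᵐ x ∂(volume.restrict Ω), u x = 0) →
        ∀ C : Set (EuclideanSpace ℝ (Fin n)), IsCompact C → C ⊆ Ω →
          ∃ c : ℝ, 0 < c ∧ ∀ᵐ x ∂(volume.restrict C), c ≤ u x) := by
  have hcl : IsCompact (closure Ω) := hΩ.isBounded.isCompact_closure
  obtain ⟨x₀, hx₀, hmax⟩ := hcl.exists_isMaxOn hΩ.isConnected.nonempty.closure hK.continuousOn
  have hKb : ∀ x ∈ Ω, 0 ≤ K x ∧ K x ≤ K x₀ := fun x hx =>
    ⟨(hKpos x (subset_closure hx)).le, hmax (subset_closure hx)⟩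
  obtain ⟨ε, hε, h⟩ := NavierBiharmonic.exists_forall_nonneg hn hΩ (hKpos x₀ hx₀) hKb
  refine ⟨ε, hε, fun u hu hsmall => ?_⟩
  have hu0 := h u hu hsmall
  refine ⟨hu0, fun hne C hC hCΩ => ?_⟩
  have : IsFiniteMeasure (volume.restrict Ω) := ⟨by
    rw [Measure.restrict_apply_univ]; exact hΩ.isBounded.measure_lt_top⟩
  exact NavierBiharmonic.exists_le_of_superharmonic (by omega) hΩ.isOpen
    hΩ.isConnected.isPreconnected (hu.1.1.integrable (by norm_num)) hu0
    (fun θ hθ hθ0 => hu.integral_laplacian_nonpos hn hΩ (fun x hx => (hKb x hx).1) hu0 hθ hθ0)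
    hne hC hCΩ
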